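/- **Setting.** Let $\Omega\subset\mathbb R^2$ be a bounded domain (nonempty, open, connected) satisfying the cone condition (for instance a bounded Lipschitz domain), and let $T,M,\nu,\gamma,\varepsilon>0$, $\delta\in\mathbb R$. Write $(\cdot,\cdot)$, $\|\cdot\|$ for the inner product and norm of $L^2(\Omega)$ (scalar or vector valued), $F(s)=\frac1{4\varepsilon^2}(1-s^2)^2-\frac\gamma2 s^2$, $E_1(\phi)=\int_\Omega F(\phi)\,dx$, and $\mathbf H=\{\mathbf v\in L^2(\Omega)^2:\nabla\cdot\mathbf v=0,\ \mathbf v\cdot\mathbf n|_{\partial\Omega}=0\}$ (weakly: $(\mathbf v,\nabla\chi)=0$ for all $\chi\in H^1(\Omega)$). For $N\ge1$ put $\Delta t=T/N$, $t^n=n\Delta t$, and $\bar g^{n+1}=2g^n-g^{n-1}$ for any sequence $(g^n)$. **Scheme.** For $1\le n\le N-1$, given levels $n-1$ and $n$, find $(\phi^{n+1},\mu^{n+1},\tilde{\mathbf u}^{n+1},\mathbf u^{n+1},p^{n+1},r^{n+1},q^{n+1})$ such that $$\tfrac{3\phi^{n+1}-4\phi^n+\phi^{n-1}}{2\Delta t}+\tfrac{r^{n+1}}{\sqrt{E_1(\bar\phi^{n+1})+\delta}}(\bar{\mathbf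 u}^{n+1}\cdot\nabla)\bar\phi^{n+1}=M\Delta\mu^{n+1},$$ $$\mu^{n+1}=-\Delta\phi^{n+1}+\gamma\phi^{n+1}+\tfrac{r^{n+1}}{\sqrt{E_1(\bar\phi^{n+1})+\delta}}F'(\bar\phi^{n+1}),\qquad \partial_{\mathbf n}\phi^{n+1}|_{\partial\Omega}=\partial_{\mathbf n}\mu^{n+1}|_{\partial\Omega}=0,$$ $$\tfrac{3r^{n+1}-4r^n+r^{n-1}}{2\Delta t}=\tfrac{1}{2\sqrt{E_1(\bar\phi^{n+1})+\delta}}\Big(\big(F'(\bar\phi^{n+1}),\tfrac{3\phi^{n+1}-4\phi^n+\phi^{n-1}}{2\Delta t}\big)+(\mu^{n+1},\bar{\mathbf u}^{n+1}\cdot\nabla\bar\phi^{n+1})-(\tilde{\mathbf u}^{n+1},\bar\mu^{n+1}\nabla\bar\phi^{n+1})\Big),$$ $$\tfrac{3\tilde{\mathbf u}^{n+1}-4\mathbf u^n+\mathbf u^{n-1}}{2\Delta t}+e^{t^{n+1}/T}q^{n+1}\,\bar{\mathbf u}^{n+1}\cdot\nabla\bar{\mathbf u}^{n+1}-\nu\Delta\tilde{\mathbf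 u}^{n+1}+\nabla p^n=\tfrac{r^{n+1}}{\sqrt{E_1(\bar\phi^{n+1})+\delta}}\,\bar\mu^{n+1}\nabla\bar\phi^{n+1},\qquad \tilde{\mathbf u}^{n+1}|_{\partial\Omega}=0,$$ $$\tfrac{3\mathbf u^{n+1}-3\tilde{\mathbf u}^{n+1}}{2\Delta t}+\nabla(p^{n+1}-p^n+\nu\nabla\cdot\tilde{\mathbf u}^{n+1})=0,\qquad \mathbf u^{n+1}\in\mathbf H,$$ $$\tfrac{3q^{n+1}-4q^n+q^{n-1}}{2\Delta t}=-\tfrac1Tq^{n+1}+e^{t^{n+1}/T}(\bar{\mathbf u}^{n+1}\cdot\nabla\bar{\mathbf u}^{n+1},\tilde{\mathbf u}^{n+1}).$$ The equations are understood in the weak sense, with $\phi^{n+1},\mu^{n+1}\in H^1(\Omega)$, $\tilde{\mathbf u}^{n+1}\in H^1_0(\Omega)^2$, $\mathbf u^{n+1}\in\mathbf H$, $p^{n+1}\in L^2(\Omega)$, $p^{n+1}-p^n+\nu\nabla\cdot\tilde{\mathbf u}^{n+1}\in H^1(\Omega)$ and $r^{n+1},q^{n+1}\in\mathbb R$. The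 two given levels are called *admissible* if at both of them $\phi,\mu\in H^1(\Omega)$, $\mathbf u\in\mathbf H\cap H^1(\Omega)^2$, $p\in L^2(\Omega)$, and if $E_1(\bar\phi^{n+1})+\delta>0$. **Theorem.** (i) *Unconditional energy stability.* Let $N\ge1$ and let the levels $0,1,\dots,N$ solve the scheme, where for each $1\le n\le N-1$ the levels $n-1$, $n$ are admissible, and the otherwise arbitrary starting level $1$ satisfies $\tilde{\mathbf u}^1\in H^1_0(\Omega)^2$ and $p^1+\nu\nabla\cdot\tilde{\mathbf u}^1\in H^1(\Omega)$. Put $$g^0=0,\qquad g^{n+1}=\nu\nabla\cdot\tilde{\mathbf u}^{n+1}+g^n,\qquad H^{n+1}=p^{n+1}+g^{n+1}\qquad(n\ge0),$$ $$\begin{aligned}\tilde E^{n+1}={}&\tfrac12\|\mathbf u^{n+1}\|^2+\tfrac12\|2\mathbf u^{n+1}-\mathbf u^n\|^2+\tfrac23(\Delta t)^2\|\nabla H^{n+1}\|^2+\nu^{-1}\Delta t\|g^{n+1}\|^2\\&+\tfrac12\|\nabla\phi^{n+1}\|^2+\tfrac12\|2\nabla\phi^{n+1}-\nabla\phi^n\|^2+\tfrac\gamma2\|\phi^{n+1}\|^2+\tfrac\gamma2\|2\phi^{n+1}-\phi^n\|^2\\&+|r^{n+1}|^2+|2r^{n+1}-r^n|^2+\tfrac12|q^{n+1}|^2+\tfrac12|2q^{n+1}-q^n|^2.\end{aligned}$$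 Then for every $1\le n\le N-1$ we have $H^n,H^{n+1}\in H^1(\Omega)$, $\nabla\times\mathbf u^{n+1}\in L^2(\Omega)$ and $$\tilde E^{n+1}-\tilde E^n\le-\nu\Delta t\|\nabla\tilde{\mathbf u}^{n+1}\|^2-\nu\Delta t\|\nabla\times\mathbf u^{n+1}\|^2-\frac{2\Delta t}{T}|q^{n+1}|^2-2M\Delta t\|\nabla\mu^{n+1}\|^2 .$$ (ii) *Unique solvability.* There is $\Delta t_0>0$, depending only on $\Omega,T,M,\nu,\gamma,\delta,\varepsilon$, such that if $\Delta t=T/N<\Delta t_0$, then for every $1\le n\le N-1$ and all admissible levels $n-1$ and $n$ the scheme has exactly one solution at level $n+1$, the pressure being normalized by $\int_\Omega p^{n+1}\,dx=0$. -/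

import Mathlib

open MeasureTheory TopologicalSpace

noncomputable section

namespace CHNS

/-- The plane `ℝ²` with its Euclidean norm. -/
abbrev Plane : Type := EuclideanSpace ℝ (Fin 2)

/-- The cone condition: there are a height `h` and an aperture (of cosine `κ`) such that every point
`x` of `Ω` is the vertex of a finite open cone of this height and aperture, with some axis `e`,
that lies in `Ω`.  Every bounded domain with Lipschitz boundary satisfies it. -/
def ConeCondition (Ω : Opens Plane) : Prop :=
  ∃ h : ℝ, 0 < h ∧ ∃ κ : ℝ, 0 < κ ∧ κ < 1 ∧ ∀ x ∈ Ω, ∃ e : Plane, ‖e‖ = 1 ∧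
    ∀ y : Plane, ‖y - x‖ < h → κ * ‖y - x‖ < inner ℝ e (y - x) → y ∈ Ω

/-- `L²(Ω)`; its norm and inner product are `‖·‖` and `(·,·)`. -/
abbrev L2 (Ω : Opens Plane) : Type := Lp ℝ 2 (volume.restrict (Ω : Set Plane))

/-- Vector fields in `L²(Ω)²`. -/
abbrev L2Vec (Ω : Opens Plane) : Type := Fin 2 → L2 Ω

/-- The classical partial derivative `∂ᵢ f`. -/
def cpd (i : Fin 2) (f : Plane → ℝ) (x : Plane) : ℝ := fderiv ℝ f x (EuclideanSpace.single i 1)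

variable (Ω : Opens Plane)

/-- `w` is the weak derivative `∂ᵢ v` on `Ω`. -/
def IsWeakPD (i : Fin 2) (v w : L2 Ω) : Prop :=
  ∀ χ : TestFunction Ω ℝ ⊤, ∫ x in (Ω : Set Plane), v x * cpd i χ x
    = - ∫ x in (Ω : Set Plane), w x * χ x

/-- `v ∈ H¹(Ω)`. -/
def MemH1 (v : L2 Ω) : Prop := ∀ i, ∃ w : L2 Ω, IsWeakPD Ω i v w

open Classical in
/-- The weak derivative `∂ᵢ v ∈ L²(Ω)` (by convention `0` if there is none; it is only used
for `v ∈ H¹(Ω)`). -/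
def pd (i : Fin 2) (v : L2 Ω) : L2 Ω :=
  if h : ∃ w : L2 Ω, IsWeakPD Ω i v w then h.choose else 0

/-- `v ∈ H¹₀(Ω)`: `v` is an `H¹(Ω)`-limit of test functions. -/
def MemH10 (v : L2 Ω) : Prop :=
  MemH1 Ω v ∧ ∀ ε : ℝ, 0 < ε → ∃ χ : TestFunction Ω ℝ ⊤,
    ∫ x in (Ω : Set Plane), (v x - χ x) ^ 2 < ε ∧
    ∀ i, ∫ x in (Ω : Set Plane), (pd Ω i v x - cpd i χ x) ^ 2 < ε

/-- The divergence `∇·v` of a field with components in `H¹(Ω)`. -/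
def divg (v : L2Vec Ω) : L2 Ω := ∑ i, pd Ω i (v i)

/-- `c` is the (scalar) rotation `∇×v = ∂₁v₂ - ∂₂v₁`, in the weak sense. -/
def IsWeakCurl (v : L2Vec Ω) (c : L2 Ω) : Prop :=
  ∀ χ : TestFunction Ω ℝ ⊤,
    ∫ x in (Ω : Set Plane), (v 0 x * cpd 1 χ x - v 1 x * cpd 0 χ x)
      = ∫ x in (Ω : Set Plane), c x * χ x

/-- The space `H`: fields in `L²(Ω)²` with `∇·v = 0` in `Ω` and `v·n = 0` on `∂Ω`, both in the weak
sense, that is, orthogonal to the gradients of all functions in `H¹(Ω)`. -/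
def MemH (v : L2Vec Ω) : Prop :=
  ∀ χ : L2 Ω, MemH1 Ω χ → ∑ i, inner ℝ (v i) (pd Ω i χ) = 0

/-- `(∇v, ∇w)` for scalar functions. -/
def gradInner (v w : L2 Ω) : ℝ := ∑ i, inner ℝ (pd Ω i v) (pd Ω i w)

/-- `(v, w)` for vector fields. -/
def vecInner (v w : L2Vec Ω) : ℝ := ∑ i, inner ℝ (v i) (w i)

/-- `‖v‖²` for vector fields. -/
def vecNormSq (v : L2Vec Ω) : ℝ := ∑ i, ‖v i‖ ^ 2

/-- `‖∇v‖²` for scalar functions. -/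
def gradNormSq (v : L2 Ω) : ℝ := ∑ i, ‖pd Ω i v‖ ^ 2

/-- `‖∇v‖²` for vector fields. -/
def vecGradNormSq (v : L2Vec Ω) : ℝ := ∑ j, gradNormSq Ω (v j)

/-- `((v·∇)w, z)` for scalar `w`, `z`. -/
def advect (v : L2Vec Ω) (w z : L2 Ω) : ℝ :=
  ∫ x in (Ω : Set Plane), (∑ i, v i x * pd Ω i w x) * z x

/-- The trilinear form `b(v,w,z) = ((v·∇)w, z)` for vector fields. -/
def trilinear (v w z : L2Vec Ω) : ℝ :=
  ∫ x in (Ω : Set Plane), ∑ j, (∑ i, v i x * pd Ω i (w j) x) * z j x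

/-- `(m ∇f, z)` for scalar `m`, `f` and a vector field `z`. -/
def forcing (m f : L2 Ω) (z : L2Vec Ω) : ℝ :=
  ∫ x in (Ω : Set Plane), ∑ i, m x * pd Ω i f x * z i x

/-- The parameters: final time `T`, mobility `M`, viscosity `ν`, the constants `γ` and `δ` of the
splitting and of the auxiliary variable `r`, and the interfacial width `ε`. -/
structure Params where
  T : ℝ
  M : ℝ
  ν : ℝ
  γ : ℝ
  δ : ℝ
  ε : ℝ

/-- `F(s) = (1 - s²)² / (4ε²) - (γ/2) s²`. -/
def potF (P : Params) (s : ℝ) : ℝ := 1 / (4 * P.ε ^ 2) * (1 - s ^ 2) ^ 2 - P.γ / 2 * s ^ 2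

/-- `E₁(φ) = ∫_Ω F(φ) dx`. -/
def E1 (P : Params) (φ : L2 Ω) : ℝ := ∫ x in (Ω : Set Plane), potF P (φ x)

/-- `(F'(φ), z)`. -/
def dFInner (P : Params) (φ z : L2 Ω) : ℝ := ∫ x in (Ω : Set Plane), deriv (potF P) (φ x) * z x

/-- The unknowns `(φ, μ, ũ, u, p, r, q)` at one time level. -/
@[ext]
structure Level where
  φ : L2 Ω
  μ : L2 Ω
  ut : L2Vec Ω
  u : L2Vec Ω
  p : L2 Ω
  r : ℝ
  q : ℝ

/-- Two consecutive levels `a` (older) and `b` (newer) from which the scheme can be advanced: all terms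
that it builds from them make sense. -/
structure Admissible (P : Params) (a b : Level Ω) : Prop where
  φ_old : MemH1 Ω a.φ
  φ_new : MemH1 Ω b.φ
  μ_old : MemH1 Ω a.μ
  μ_new : MemH1 Ω b.μ
  u_old : ∀ i, MemH1 Ω (a.u i)
  u_new : ∀ i, MemH1 Ω (b.u i)
  div_old : MemH Ω a.u
  div_new : MemH Ω b.u
  pos : 0 < E1 Ω P ((2 : ℝ) • b.φ - a.φ) + P.δ

/-- One step of the BDF2 / rotational pressure-correction MSAV scheme, in weak form: the level `c` at
time `t` is a solution of the scheme with time step `dt`, the two preceding levels being `a`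
(the older) and `b`.  The conditions `∂φ/∂n = ∂μ/∂n = 0` are the natural boundary conditions of
`eq_φ` and `eq_μ`. -/
structure Step (P : Params) (dt t : ℝ) (a b c : Level Ω) : Prop where
  φ_mem : MemH1 Ω c.φ
  μ_mem : MemH1 Ω c.μ
  ut_mem : ∀ i, MemH10 Ω (c.ut i)
  u_mem : MemH Ω c.u
  /-- `(3φ - 4φⁿ + φⁿ⁻¹)/(2Δt) + r/√(E₁(φ̄)+δ) (ū·∇)φ̄ = M Δμ`, `∂μ/∂n = 0`. -/
  eq_φ : ∀ χ : L2 Ω, MemH1 Ω χ →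
    inner ℝ ((2 * dt)⁻¹ • ((3 : ℝ) • c.φ - (4 : ℝ) • b.φ + a.φ)) χ
      + c.r / √(E1 Ω P ((2 : ℝ) • b.φ - a.φ) + P.δ)
          * advect Ω ((2 : ℝ) • b.u - a.u) ((2 : ℝ) • b.φ - a.φ) χ
      = - P.M * gradInner Ω c.μ χ
  /-- `μ = -Δφ + γφ + r/√(E₁(φ̄)+δ) F'(φ̄)`, `∂φ/∂n = 0`. -/
  eq_μ : ∀ χ : L2 Ω, MemH1 Ω χ →
    inner ℝ c.μ χ = gradInner Ω c.φ χ + P.γ * inner ℝ c.φ χ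
      + c.r / √(E1 Ω P ((2 : ℝ) • b.φ - a.φ) + P.δ) * dFInner Ω P ((2 : ℝ) • b.φ - a.φ) χ
  /-- The equation for `r`. -/
  eq_r : (3 * c.r - 4 * b.r + a.r) / (2 * dt)
      = 1 / (2 * √(E1 Ω P ((2 : ℝ) • b.φ - a.φ) + P.δ))
        * (dFInner Ω P ((2 : ℝ) • b.φ - a.φ)
              ((2 * dt)⁻¹ • ((3 : ℝ) • c.φ - (4 : ℝ) • b.φ + a.φ))
            + advect Ω ((2 : ℝ) • b.u - a.u) ((2 : ℝ) • b.φ - a.φ) c.μ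
            - forcing Ω ((2 : ℝ) • b.μ - a.μ) ((2 : ℝ) • b.φ - a.φ) c.ut)
  /-- `(3ũ - 4uⁿ + uⁿ⁻¹)/(2Δt) + exp(t/T) q (ū·∇)ū - νΔũ + ∇pⁿ = r/√(E₁(φ̄)+δ) μ̄∇φ̄`. -/
  eq_ut : ∀ w : L2Vec Ω, (∀ i, MemH10 Ω (w i)) →
    vecInner Ω ((2 * dt)⁻¹ • ((3 : ℝ) • c.ut - (4 : ℝ) • b.u + a.u)) w
      + Real.exp (t / P.T) * c.q
          * trilinear Ω ((2 : ℝ) • b.u - a.u) ((2 : ℝ) • b.u - a.u) w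
      + P.ν * ∑ j, gradInner Ω (c.ut j) (w j)
      - inner ℝ b.p (divg Ω w)
      = c.r / √(E1 Ω P ((2 : ℝ) • b.φ - a.φ) + P.δ)
          * forcing Ω ((2 : ℝ) • b.μ - a.μ) ((2 : ℝ) • b.φ - a.φ) w
  /-- `p - pⁿ + ν∇·ũ ∈ H¹(Ω)`, so that its gradient in the next equation makes sense. -/
  ψ_mem : MemH1 Ω (c.p - b.p + P.ν • divg Ω c.ut)
  /-- `(3u - 3ũ)/(2Δt) + ∇(p - pⁿ + ν∇·ũ) = 0`. -/
  eq_u : ∀ i, (2 * dt)⁻¹ • ((3 : ℝ) • c.u i - (3 : ℝ) • c.ut i)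
      + pd Ω i (c.p - b.p + P.ν • divg Ω c.ut) = 0
  /-- The equation for `q`. -/
  eq_q : (3 * c.q - 4 * b.q + a.q) / (2 * dt)
      = - (1 / P.T) * c.q
        + Real.exp (t / P.T) * trilinear Ω ((2 : ℝ) • b.u - a.u) ((2 : ℝ) • b.u - a.u) c.ut

/-- A solution `L 0, …, L N` of the scheme with time step `dt = T/N`, from arbitrary starting
levels `L 0`, `L 1` (the intermediate velocity `ũ¹` is in `H¹₀(Ω)²` and `p¹ + ν∇·ũ¹ ∈ H¹(Ω)`). -/
structure IsSolution (P : Params) (N : ℕ) (L : ℕ → Level Ω) : Prop where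
  ut_one : ∀ i, MemH10 Ω ((L 1).ut i)
  H_one : MemH1 Ω ((L 1).p + P.ν • divg Ω (L 1).ut)
  adm : ∀ n, n + 2 ≤ N → Admissible Ω P (L n) (L (n + 1))
  step : ∀ n, n + 2 ≤ N →
    Step Ω P (P.T / N) (((n + 2 : ℕ) : ℝ) * (P.T / N)) (L n) (L (n + 1)) (L (n + 2))

/-- `g⁰ = 0`, `gⁿ⁺¹ = ν∇·ũⁿ⁺¹ + gⁿ`. -/
def gSeq (P : Params) (L : ℕ → Level Ω) : ℕ → L2 Ω
  | 0 => 0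
  | n + 1 => P.ν • divg Ω (L (n + 1)).ut + gSeq P L n

/-- `Hⁿ = pⁿ + gⁿ`. -/
def HSeq (P : Params) (L : ℕ → Level Ω) (n : ℕ) : L2 Ω := (L n).p + gSeq Ω P L n

/-- The modified energy `Ẽ` at the level `b` that follows the level `a`, with `g` and `H` at
level `b`. -/
def energy (P : Params) (dt : ℝ) (a b : Level Ω) (g H : L2 Ω) : ℝ :=
  1 / 2 * vecNormSq Ω b.u + 1 / 2 * vecNormSq Ω ((2 : ℝ) • b.u - a.u)
    + 2 / 3 * dt ^ 2 * gradNormSq Ω H + P.ν⁻¹ * dt * ‖g‖ ^ 2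
    + 1 / 2 * gradNormSq Ω b.φ + 1 / 2 * gradNormSq Ω ((2 : ℝ) • b.φ - a.φ)
    + P.γ / 2 * ‖b.φ‖ ^ 2 + P.γ / 2 * ‖(2 : ℝ) • b.φ - a.φ‖ ^ 2
    + b.r ^ 2 + (2 * b.r - a.r) ^ 2
    + 1 / 2 * b.q ^ 2 + 1 / 2 * (2 * b.q - a.q) ^ 2

end CHNS

end

/-!
The energy inequality comes from testing the equation for `φ`
with `μ`, the one for `μ` with the BDF2 difference `3φⁿ⁺¹ - 4φⁿ + φⁿ⁻¹`, the one for `r` with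
`2r`, the one for `ũ` with `ũ` and the one for `q` with `q`. All explicitly treated nonlinear
terms then cancel in pairs, whatever the extrapolated fields are, and `bdf2_inner_le` turns the
difference quotients into differences of the energy (`Step.phase_estimate`,
`Step.velocity_estimate`). The pressure is handled through `H = p + g`: as `g` grows by `ν∇·ũ`,
the projection step says that `u - ũ` is `-(2Δt/3)∇(Hⁿ⁺¹ - Hⁿ)`, so `-(pⁿ, ∇·ũ) = (∇Hⁿ, ũ) + (gⁿ,
∇·ũ)` becomes a telescoping difference of `‖∇H‖²` and `‖g‖²` up to `νΔt‖∇·ũ‖²`. This defect is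
paid for by the viscosity, because `‖∇ũ‖² = ‖∇·ũ‖² + ‖∇×ũ‖²` in `H¹₀` (`vecGradNormSq_eq`), and
`∇×u = ∇×ũ` since `u - ũ` is a gradient.

For the unique solvability, the unknowns `(φ, μ, ũ, r, q)` solve a linear system in which the
pressure `pⁿ` is given; `u` and `p` are then recovered from a Neumann problem. The choice of test
functions that gives the energy inequality makes the bilinear form of the system nonnegative for
every time step. It misses only the mean of `μ`, and a small multiple of `-μ` added to the test
function of the second equation makes the form coercive (`CoupledData.isCoercive_form`), so that
the Lax–Milgram theorem applies (`CoupledData.exists_solves`). Hence the bound on `Δt` may be any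
positive number.

What the system needs from the domain is that its coefficients are bounded functionals, which is
Sobolev's embedding `H¹(Ω) ⊆ L⁶(Ω)` (`exists_sobolev`), and what the Neumann problem needs is
Poincaré's inequality (`exists_poincare`). Both rest on `SeesBalls.lintegral_pow_six_le`: the cone
condition lets every point `y` see a ball at a fixed distance from the boundary, and integrating
the gradient along the segments from `y` to this ball bounds `v(y)` by an average of `|v|` over
the ball and an average of `|∇v|` (`segAvg`) that maps `L²` into `L⁶`. Weak derivatives enter by
mollification: the segments from a given `y` form a compact subset of `Ω`, on which mollification
commutes with derivatives for all small parameters, and Fatou's lemma passes to the limit.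
Poincaré's inequality on a ball comes from the same averages, and chaining balls carries it to the
connected set `Ω`.
-/

noncomputable section

namespace CHNS

open scoped ContDiff Distributions

variable {Ω : Opens Plane}

/-! ### Test functions and weak derivatives in `L²(Ω)` -/

/-- The classical partial derivative `∂ᵢχ` of a test function, as a test function. -/
def dtf (i : Fin 2) (χ : TestFunction Ω ℝ ⊤) : TestFunction Ω ℝ ⊤ where
  toFun := cpd i χ
  contDiff' := by
    have h : ContDiff ℝ ∞ (fderiv ℝ χ) := χ.contDiff.fderiv_right (m := ∞) (by simp)
    exact h.clm_apply contDiff_const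
  hasCompactSupport' := χ.hasCompactSupport.fderiv_apply ℝ _
  tsupport_subset' := (tsupport_fderiv_apply_subset ℝ _).trans χ.tsupport_subset

theorem dtf_apply (i : Fin 2) (χ : TestFunction Ω ℝ ⊤) (x : Plane) : dtf i χ x = cpd i χ x := rfl

theorem memLp_testFunction (χ : TestFunction Ω ℝ ⊤) (p : ENNReal) :
    MemLp χ p (volume.restrict (Ω : Set Plane)) :=
  (χ.continuous.memLp_of_hasCompactSupport χ.hasCompactSupport).restrict _

/-- The class of a test function in `L²(Ω)`. -/
def tf (χ : TestFunction Ω ℝ ⊤) : L2 Ω := (memLp_testFunction χ 2).toLp χ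

theorem coeFn_tf (χ : TestFunction Ω ℝ ⊤) :
    tf χ =ᵐ[volume.restrict (Ω : Set Plane)] χ := MemLp.coeFn_toLp _

theorem inner_eq_integral (v w : L2 Ω) :
    inner ℝ v w = ∫ x in (Ω : Set Plane), v x * w x := by
  rw [L2.inner_def]
  exact integral_congr_ae (Filter.Eventually.of_forall fun x => by simp [mul_comm])

theorem inner_tf (v : L2 Ω) (χ : TestFunction Ω ℝ ⊤) :
    inner ℝ v (tf χ) = ∫ x in (Ω : Set Plane), v x * χ x := by
  rw [inner_eq_integral]
  refine integral_congr_ae ?_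
  filter_upwards [coeFn_tf χ] with x hx
  rw [hx]

theorem isWeakPD_iff {i : Fin 2} {v w : L2 Ω} :
    IsWeakPD Ω i v w ↔ ∀ χ, inner ℝ v (tf (dtf i χ)) = - inner ℝ w (tf χ) := by
  simp only [IsWeakPD, inner_tf, dtf_apply]

/-- Test functions are dense in `L²(Ω)`: only `0` is orthogonal to all of them. -/
theorem eq_zero_of_inner_tf {w : L2 Ω} (h : ∀ χ : TestFunction Ω ℝ ⊤, inner ℝ w (tf χ) = 0) :
    w = 0 := by
  have hloc : LocallyIntegrableOn w (Ω : Set Plane) volume :=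
    locallyIntegrableOn_of_locallyIntegrable_restrict
      ((Lp.memLp w).locallyIntegrable (by norm_num))
  have := IsOpen.ae_eq_zero_of_integral_contDiff_smul_eq_zero Ω.isOpen hloc (fun g hg hc hs => by
    have h1 := h ⟨g, by simpa using hg, hc, hs⟩
    rw [inner_tf] at h1
    rw [← setIntegral_eq_integral_of_forall_compl_eq_zero (s := (Ω : Set Plane)), ← h1]
    · refine integral_congr_ae (Filter.Eventually.of_forall fun x => ?_)
      simp only [smul_eq_mul]
      rw [mul_comm]; rfl
    · intro x hx
      rw [image_eq_zero_of_notMem_tsupport (fun h => hx (hs h)), zero_smul])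
  rw [Lp.eq_zero_iff_ae_eq_zero]
  rw [Filter.EventuallyEq, ae_restrict_iff' Ω.isOpen.measurableSet]
  filter_upwards [this] with x hx using hx

theorem IsWeakPD.unique {i : Fin 2} {v w w' : L2 Ω} (h : IsWeakPD Ω i v w)
    (h' : IsWeakPD Ω i v w') : w = w' := by
  rw [isWeakPD_iff] at h h'
  rw [← sub_eq_zero]
  refine eq_zero_of_inner_tf fun χ => ?_
  rw [inner_sub_left]
  linarith [h χ, h' χ]

theorem IsWeakPD.add {i : Fin 2} {v w v' w' : L2 Ω} (h : IsWeakPD Ω i v w)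
    (h' : IsWeakPD Ω i v' w') : IsWeakPD Ω i (v + v') (w + w') := by
  rw [isWeakPD_iff] at *
  intro χ
  rw [inner_add_left, inner_add_left, h, h']; ring

theorem IsWeakPD.smul {i : Fin 2} {v w : L2 Ω} (c : ℝ) (h : IsWeakPD Ω i v w) :
    IsWeakPD Ω i (c • v) (c • w) := by
  rw [isWeakPD_iff] at *
  intro χ
  rw [real_inner_smul_left, real_inner_smul_left, h]; ring

theorem integral_cpd_mul (i : Fin 2) {f g : Plane → ℝ} (hf : ContDiff ℝ 1 f) (hg : ContDiff ℝ 1 g)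
    (hc : HasCompactSupport g) : ∫ x, f x * cpd i g x = - ∫ x, cpd i f x * g x := by
  have hf' : Continuous (cpd i f) := by
    have := hf.continuous_fderiv one_ne_zero
    unfold cpd; fun_prop
  have hg' : Continuous (cpd i g) := by
    have := hg.continuous_fderiv one_ne_zero
    unfold cpd; fun_prop
  refine integral_mul_fderiv_eq_neg_fderiv_mul_of_integrable ?_ ?_ ?_
    (fun x _ => (hf.differentiable one_ne_zero) x) (fun x _ => (hg.differentiable one_ne_zero) x)
  · exact (hf'.mul hg.continuous).integrable_of_hasCompactSupport hc.mul_left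
  · exact (hf.continuous.mul hg').integrable_of_hasCompactSupport
      (HasCompactSupport.mul_left (hc.fderiv_apply ℝ _))
  · exact (hf.continuous.mul hg.continuous).integrable_of_hasCompactSupport hc.mul_left

theorem setIntegral_mul_testFunction (f : Plane → ℝ) (χ : TestFunction Ω ℝ ⊤) :
    ∫ x in (Ω : Set Plane), f x * χ x = ∫ x, f x * χ x := by
  refine setIntegral_eq_integral_of_forall_compl_eq_zero fun x hx => ?_
  rw [image_eq_zero_of_notMem_tsupport (fun h => hx (χ.tsupport_subset h)), mul_zero]

theorem contDiff_one_testFunction (χ : TestFunction Ω ℝ ⊤) : ContDiff ℝ 1 χ :=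
  χ.contDiff.of_le (by exact_mod_cast le_top)

theorem isWeakPD_tf (i : Fin 2) (χ : TestFunction Ω ℝ ⊤) : IsWeakPD Ω i (tf χ) (tf (dtf i χ)) := by
  rw [isWeakPD_iff]
  intro η
  rw [real_inner_comm, real_inner_comm (tf η), inner_tf, inner_tf]
  have e1 : ∫ x in (Ω : Set Plane), (tf (dtf i η)) x * χ x
      = ∫ x in (Ω : Set Plane), cpd i η x * χ x := by
    refine integral_congr_ae ?_
    filter_upwards [coeFn_tf (dtf i η)] with x hx
    rw [hx]; rfl
  have e2 : ∫ x in (Ω : Set Plane), (tf η) x * (dtf i χ) x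
      = ∫ x in (Ω : Set Plane), η x * dtf i χ x := by
    refine integral_congr_ae ?_
    filter_upwards [coeFn_tf η] with x hx
    rw [hx]
  rw [e1, e2, setIntegral_mul_testFunction, setIntegral_mul_testFunction]
  have := integral_cpd_mul i (contDiff_one_testFunction η) (contDiff_one_testFunction χ)
    χ.hasCompactSupport
  simp only [dtf_apply]
  linarith

theorem dtf_comm (χ : TestFunction Ω ℝ ⊤) (i j : Fin 2) : dtf i (dtf j χ) = dtf j (dtf i χ) := by
  ext x
  have hd : DifferentiableAt ℝ (fderiv ℝ χ) x :=
    ((χ.contDiff.fderiv_right (m := 1)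
      (by exact WithTop.coe_le_coe.2 (le_top (a := (2 : ℕ∞))))).differentiable one_ne_zero) x
  have key : ∀ k l : Fin 2, dtf k (dtf l χ) x
      = fderiv ℝ (fderiv ℝ χ) x (EuclideanSpace.single k 1) (EuclideanSpace.single l 1) := by
    intro k l
    change fderiv ℝ (fun y => fderiv ℝ χ y (EuclideanSpace.single l 1)) x _ = _
    rw [fderiv_clm_apply hd (differentiableAt_const _)]
    simp
  rw [key, key]
  have hs : IsSymmSndFDerivAt ℝ χ x :=
    (χ.contDiff.contDiffAt).isSymmSndFDerivAt (by
      rw [minSmoothness_of_isRCLikeNormedField]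
      exact WithTop.coe_le_coe.2 (le_top (a := (2 : ℕ∞))))
  exact hs _ _

theorem MemH1.pd_spec {v : L2 Ω} (h : MemH1 Ω v) (i : Fin 2) : IsWeakPD Ω i v (pd Ω i v) := by
  have := h i
  rw [pd, dif_pos this]
  exact this.choose_spec

theorem IsWeakPD.pd_eq {i : Fin 2} {v w : L2 Ω} (h : IsWeakPD Ω i v w) : pd Ω i v = w := by
  have h' : ∃ w, IsWeakPD Ω i v w := ⟨w, h⟩
  rw [pd, dif_pos h']
  exact h'.choose_spec.unique h

theorem memH1_of_isWeakPD {v : L2 Ω} {w : Fin 2 → L2 Ω} (h : ∀ i, IsWeakPD Ω i v (w i)) :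
    MemH1 Ω v := fun i => ⟨w i, h i⟩

theorem MemH1.add {v w : L2 Ω} (hv : MemH1 Ω v) (hw : MemH1 Ω w) : MemH1 Ω (v + w) :=
  memH1_of_isWeakPD fun i => (hv.pd_spec i).add (hw.pd_spec i)

theorem MemH1.smul {v : L2 Ω} (c : ℝ) (hv : MemH1 Ω v) : MemH1 Ω (c • v) :=
  memH1_of_isWeakPD fun i => (hv.pd_spec i).smul c

theorem MemH1.sub {v w : L2 Ω} (hv : MemH1 Ω v) (hw : MemH1 Ω w) : MemH1 Ω (v - w) := by
  simpa [sub_eq_add_neg] using hv.add (hw.smul (-1))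

theorem pd_add {v w : L2 Ω} (hv : MemH1 Ω v) (hw : MemH1 Ω w) (i : Fin 2) :
    pd Ω i (v + w) = pd Ω i v + pd Ω i w := ((hv.pd_spec i).add (hw.pd_spec i)).pd_eq

theorem pd_smul {v : L2 Ω} (c : ℝ) (hv : MemH1 Ω v) (i : Fin 2) :
    pd Ω i (c • v) = c • pd Ω i v := ((hv.pd_spec i).smul c).pd_eq

theorem pd_sub {v w : L2 Ω} (hv : MemH1 Ω v) (hw : MemH1 Ω w) (i : Fin 2) :
    pd Ω i (v - w) = pd Ω i v - pd Ω i w := by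
  have := ((hv.pd_spec i).add ((hw.pd_spec i).smul (-1))).pd_eq
  simpa [sub_eq_add_neg] using this

theorem pd_tf (i : Fin 2) (χ : TestFunction Ω ℝ ⊤) : pd Ω i (tf χ) = tf (dtf i χ) :=
  (isWeakPD_tf i χ).pd_eq

theorem memH1_tf (χ : TestFunction Ω ℝ ⊤) : MemH1 Ω (tf χ) :=
  memH1_of_isWeakPD fun i => isWeakPD_tf i χ

/-! ### Functions vanishing on the boundary -/

theorem norm_sub_tf_sq (v : L2 Ω) (χ : TestFunction Ω ℝ ⊤) :
    ∫ x in (Ω : Set Plane), (v x - χ x) ^ 2 = ‖v - tf χ‖ ^ 2 := by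
  rw [← real_inner_self_eq_norm_sq, inner_eq_integral]
  refine integral_congr_ae ?_
  filter_upwards [Lp.coeFn_sub v (tf χ), coeFn_tf χ] with x h1 h2
  rw [h1, Pi.sub_apply, h2, sq]

theorem memH10_iff {v : L2 Ω} : MemH10 Ω v ↔ MemH1 Ω v ∧ ∀ ε : ℝ, 0 < ε →
    ∃ χ : TestFunction Ω ℝ ⊤, ‖v - tf χ‖ < ε ∧ ∀ i, ‖pd Ω i v - tf (dtf i χ)‖ < ε := by
  refine and_congr_right fun _ => ⟨fun h ε hε => ?_, fun h ε hε => ?_⟩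
  · obtain ⟨χ, h1, h2⟩ := h (ε ^ 2) (by positivity)
    refine ⟨χ, ?_, fun i => ?_⟩
    · rw [norm_sub_tf_sq] at h1
      exact lt_of_pow_lt_pow_left₀ 2 hε.le h1
    · have h3 := h2 i
      have e := norm_sub_tf_sq (pd Ω i v) (dtf i χ)
      simp only [dtf_apply] at e
      rw [e] at h3
      exact lt_of_pow_lt_pow_left₀ 2 hε.le h3
  · obtain ⟨χ, h1, h2⟩ := h (√ε) (by positivity)
    refine ⟨χ, ?_, fun i => ?_⟩
    · rw [norm_sub_tf_sq, ← Real.sq_sqrt hε.le]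
      exact pow_lt_pow_left₀ h1 (norm_nonneg _) two_ne_zero
    · have e := norm_sub_tf_sq (pd Ω i v) (dtf i χ)
      simp only [dtf_apply] at e
      rw [e, ← Real.sq_sqrt hε.le]
      exact pow_lt_pow_left₀ (h2 i) (norm_nonneg _) two_ne_zero

theorem MemH10.exists_seq {v : L2 Ω} (h : MemH10 Ω v) : ∃ χ : ℕ → TestFunction Ω ℝ ⊤,
    Filter.Tendsto (fun n => tf (χ n)) Filter.atTop (nhds v) ∧
    ∀ i, Filter.Tendsto (fun n => tf (dtf i (χ n))) Filter.atTop (nhds (pd Ω i v)) := by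
  rw [memH10_iff] at h
  choose χ h1 h2 using fun n : ℕ => h.2 (1 / ((n : ℝ) + 1)) (by positivity)
  refine ⟨χ, ?_, fun i => ?_⟩ <;> rw [tendsto_iff_norm_sub_tendsto_zero] <;>
    refine squeeze_zero (fun _ => norm_nonneg _) (fun n => ?_)
      (tendsto_one_div_add_atTop_nhds_zero_nat (𝕜 := ℝ))
  · rw [norm_sub_rev]; exact (h1 n).le
  · rw [norm_sub_rev]; exact (h2 n i).le

/-- Integration by parts, by density of the test functions in `H¹₀(Ω)`. -/
theorem MemH10.inner_pd {f g : L2 Ω} (hg : MemH10 Ω g) (hf : MemH1 Ω f) (i : Fin 2) :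
    inner ℝ f (pd Ω i g) = - inner ℝ (pd Ω i f) g := by
  obtain ⟨χ, h1, h2⟩ := hg.exists_seq
  have e := isWeakPD_iff.1 (hf.pd_spec i)
  refine tendsto_nhds_unique ((tendsto_const_nhds (x := f)).inner (𝕜 := ℝ) (h2 i)) ?_
  simp only [e]
  exact ((tendsto_const_nhds (x := pd Ω i f)).inner (𝕜 := ℝ) h1).neg

theorem inner_pd_dtf_comm {f : L2 Ω} (hf : MemH1 Ω f) (χ : TestFunction Ω ℝ ⊤) (i j : Fin 2) :
    inner ℝ (pd Ω i f) (tf (dtf j χ)) = inner ℝ (pd Ω j f) (tf (dtf i χ)) := by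
  have h1 := isWeakPD_iff.1 (hf.pd_spec i) (dtf j χ)
  have h2 := isWeakPD_iff.1 (hf.pd_spec j) (dtf i χ)
  rw [dtf_comm] at h1
  linarith

theorem MemH10.inner_pd_comm {f g : L2 Ω} (hg : MemH10 Ω g) (hf : MemH1 Ω f) (i j : Fin 2) :
    inner ℝ (pd Ω i f) (pd Ω j g) = inner ℝ (pd Ω j f) (pd Ω i g) := by
  obtain ⟨χ, -, h2⟩ := hg.exists_seq
  refine tendsto_nhds_unique ((tendsto_const_nhds (x := pd Ω i f)).inner (𝕜 := ℝ) (h2 j)) ?_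
  simp only [inner_pd_dtf_comm hf _ i j]
  exact (tendsto_const_nhds (x := pd Ω j f)).inner (𝕜 := ℝ) (h2 i)

theorem MemH10.memH1 {v : L2 Ω} (h : MemH10 Ω v) : MemH1 Ω v := h.1

/-- The scalar rotation `∂₀v₁ - ∂₁v₀` of a field with components in `H¹(Ω)`. -/
def rot (v : L2Vec Ω) : L2 Ω := pd Ω 0 (v 1) - pd Ω 1 (v 0)

theorem isWeakCurl_iff {v : L2Vec Ω} {c : L2 Ω} : IsWeakCurl Ω v c ↔ ∀ χ,
    inner ℝ (v 0) (tf (dtf 1 χ)) - inner ℝ (v 1) (tf (dtf 0 χ)) = inner ℝ c (tf χ) := by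
  refine forall_congr' fun χ => ?_
  rw [inner_tf, inner_tf, inner_tf, ← integral_sub]
  · rfl
  · exact (Lp.memLp (v 0)).integrable_mul (memLp_testFunction _ 2)
  · exact (Lp.memLp (v 1)).integrable_mul (memLp_testFunction _ 2)

theorem isWeakCurl_rot {v : L2Vec Ω} (hv : ∀ i, MemH1 Ω (v i)) : IsWeakCurl Ω v (rot v) := by
  rw [isWeakCurl_iff]
  intro χ
  have h0 := isWeakPD_iff.1 ((hv 1).pd_spec 0) χ
  have h1 := isWeakPD_iff.1 ((hv 0).pd_spec 1) χ
  rw [rot, inner_sub_left]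
  linarith

/-- A gradient is irrotational, so adding one does not change the weak rotation. -/
theorem IsWeakCurl.sub_smul_grad {v u : L2Vec Ω} {c ψ : L2 Ω} (h : IsWeakCurl Ω v c)
    (hψ : MemH1 Ω ψ) (a : ℝ) (hu : ∀ i, u i = v i - a • pd Ω i ψ) : IsWeakCurl Ω u c := by
  rw [isWeakCurl_iff] at h ⊢
  intro χ
  rw [hu, hu, inner_sub_left, inner_sub_left, real_inner_smul_left, real_inner_smul_left,
    ← h χ, inner_pd_dtf_comm hψ χ 0 1]
  ring

/-- `‖∇v‖² = ‖∇·v‖² + ‖∇×v‖²` for fields vanishing on the boundary. -/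
theorem vecGradNormSq_eq {v : L2Vec Ω} (hv : ∀ i, MemH10 Ω (v i)) :
    vecGradNormSq Ω v = ‖divg Ω v‖ ^ 2 + ‖rot v‖ ^ 2 := by
  have h := (hv 1).inner_pd_comm (hv 0).memH1 0 1
  simp only [vecGradNormSq, gradNormSq, divg, rot, Fin.sum_univ_two, norm_sub_sq_real,
    norm_add_sq_real]
  rw [real_inner_comm (pd Ω 1 (v 0))]
  linarith

/-! ### The energy inequality -/

section Energy

/-- The telescoping inequality behind the G-stability of BDF2; the defect is `‖x - 2y + z‖²`. -/
theorem bdf2_inner_le {E : Type*} [NormedAddCommGroup E] [InnerProductSpace ℝ E] (x y z : E) :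
    ‖x‖ ^ 2 + ‖(2 : ℝ) • x - y‖ ^ 2 - ‖y‖ ^ 2 - ‖(2 : ℝ) • y - z‖ ^ 2
      ≤ 2 * inner ℝ ((3 : ℝ) • x - (4 : ℝ) • y + z) x := by
  have h : 0 ≤ ‖x - (2 : ℝ) • y + z‖ ^ 2 := by positivity
  simp only [← real_inner_self_eq_norm_sq, inner_add_left, inner_sub_left, inner_add_right,
    inner_sub_right, real_inner_smul_left, real_inner_smul_right] at h ⊢
  rw [real_inner_comm x y, real_inner_comm x z, real_inner_comm y z] at *
  linarith

theorem dFInner_smul (P : Params) (φ z : L2 Ω) (c : ℝ) :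
    dFInner Ω P φ (c • z) = c * dFInner Ω P φ z := by
  rw [dFInner, dFInner, ← integral_const_mul]
  refine integral_congr_ae ?_
  filter_upwards [Lp.coeFn_smul c z] with x hx
  rw [hx, Pi.smul_apply, smul_eq_mul]; ring

theorem gradInner_self (v : L2 Ω) : gradInner Ω v v = gradNormSq Ω v := by
  simp [gradInner, gradNormSq]

variable {P : Params} {dt t : ℝ} {a b c : Level Ω}

theorem Step.u_eq (h : Step Ω P dt t a b c) (hdt : 0 < dt) (i : Fin 2) :
    c.u i = c.ut i - (2 * dt / 3) • pd Ω i (c.p - b.p + P.ν • divg Ω c.ut) := by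
  have h1 : c.u i = c.ut i
      + (2 * dt / 3) • ((2 * dt)⁻¹ • ((3 : ℝ) • c.u i - (3 : ℝ) • c.ut i)) := by
    rw [smul_smul, ← smul_sub, smul_smul]
    have : 2 * dt / 3 * (2 * dt)⁻¹ * 3 = 1 := by field_simp
    rw [this, one_smul]; abel
  rw [h1, eq_neg_of_add_eq_zero_left (h.eq_u i), smul_neg, ← sub_eq_add_neg]

/-- The phase field part of the energy estimate; the coupling terms `advect` cancel between the
equations for `φ` and `r`, and the terms `dFInner` between those for `μ` and `r`. -/
theorem Step.phase_estimate (h : Step Ω P dt t a b c) (hadm : Admissible Ω P a b) (hdt : 0 < dt)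
    (hγ : 0 < P.γ) :
    1 / 2 * gradNormSq Ω c.φ + 1 / 2 * gradNormSq Ω ((2 : ℝ) • c.φ - b.φ)
      + P.γ / 2 * ‖c.φ‖ ^ 2 + P.γ / 2 * ‖(2 : ℝ) • c.φ - b.φ‖ ^ 2 + c.r ^ 2 + (2 * c.r - b.r) ^ 2
    - (1 / 2 * gradNormSq Ω b.φ + 1 / 2 * gradNormSq Ω ((2 : ℝ) • b.φ - a.φ)
      + P.γ / 2 * ‖b.φ‖ ^ 2 + P.γ / 2 * ‖(2 : ℝ) • b.φ - a.φ‖ ^ 2 + b.r ^ 2 + (2 * b.r - a.r) ^ 2)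
    ≤ - 2 * P.M * dt * gradNormSq Ω c.μ
      - 2 * dt * (c.r / √(E1 Ω P ((2 : ℝ) • b.φ - a.φ) + P.δ)
          * forcing Ω ((2 : ℝ) • b.μ - a.μ) ((2 : ℝ) • b.φ - a.φ) c.ut) := by
  have hφ := h.eq_φ c.μ h.μ_mem
  have hZ : MemH1 Ω ((3 : ℝ) • c.φ - (4 : ℝ) • b.φ + a.φ) :=
    ((h.φ_mem.smul 3).sub (hadm.φ_new.smul 4)).add hadm.φ_old
  have hμ := h.eq_μ _ hZ
  have hr := h.eq_r
  rw [dFInner_smul] at hr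
  rw [gradInner_self, real_inner_smul_left, real_inner_comm] at hφ
  have hG : gradNormSq Ω c.φ + gradNormSq Ω ((2 : ℝ) • c.φ - b.φ) - gradNormSq Ω b.φ
      - gradNormSq Ω ((2 : ℝ) • b.φ - a.φ)
      ≤ 2 * gradInner Ω c.φ ((3 : ℝ) • c.φ - (4 : ℝ) • b.φ + a.φ) := by
    simp only [gradNormSq, gradInner, ← Finset.sum_add_distrib, ← Finset.sum_sub_distrib,
      Finset.mul_sum]
    refine Finset.sum_le_sum fun i _ => ?_
    rw [pd_add ((h.φ_mem.smul 3).sub (hadm.φ_new.smul 4)) hadm.φ_old,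
      pd_sub (h.φ_mem.smul 3) (hadm.φ_new.smul 4), pd_sub (h.φ_mem.smul 2) hadm.φ_new,
      pd_sub (hadm.φ_new.smul 2) hadm.φ_old, pd_smul _ h.φ_mem, pd_smul _ h.φ_mem,
      pd_smul _ hadm.φ_new, pd_smul _ hadm.φ_new, real_inner_comm]
    exact bdf2_inner_le _ _ _
  have hL := bdf2_inner_le c.φ b.φ a.φ
  rw [real_inner_comm] at hL
  generalize √(E1 Ω P ((2 : ℝ) • b.φ - a.φ) + P.δ) = k at *
  generalize (3 : ℝ) • c.φ - (4 : ℝ) • b.φ + a.φ = Z at *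
  generalize dFInner Ω P ((2 : ℝ) • b.φ - a.φ) Z = DZ at *
  generalize advect Ω ((2 : ℝ) • b.u - a.u) ((2 : ℝ) • b.φ - a.φ) c.μ = A at *
  generalize forcing Ω ((2 : ℝ) • b.μ - a.μ) ((2 : ℝ) • b.φ - a.φ) c.ut = Fo at *
  have hr' : 2 * c.r * (3 * c.r - 4 * b.r + a.r)
      = c.r / k * DZ + 2 * dt * (c.r / k * A) - 2 * dt * (c.r / k * Fo) := by
    have e : 3 * c.r - 4 * b.r + a.r = 2 * dt * (1 / (2 * k) * ((2 * dt)⁻¹ * DZ + A - Fo)) := by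
      rw [← hr]; field_simp
    have e2 : 2 * dt * (2 * dt)⁻¹ = 1 := by field_simp
    rw [e]
    linear_combination (c.r / k * DZ) * e2
  have hφ' : inner ℝ c.μ Z + 2 * dt * (c.r / k * A) = - 2 * dt * P.M * gradNormSq Ω c.μ := by
    have e2 : 2 * dt * (2 * dt)⁻¹ = 1 := by field_simp
    linear_combination (2 * dt) * hφ - inner ℝ c.μ Z * e2
  have hL' := mul_le_mul_of_nonneg_left hL hγ.le
  nlinarith [sq_nonneg (c.r - 2 * b.r + a.r)]

/-- The pressure splitting `H = p + g` increases by `p - pⁿ + ν∇·ũ` in one step. -/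
theorem Step.memH1_H (h : Step Ω P dt t a b c) {g : L2 Ω} (hH : MemH1 Ω (b.p + g)) :
    MemH1 Ω (c.p + (P.ν • divg Ω c.ut + g)) := by
  have := hH.add h.ψ_mem
  rwa [show b.p + g + (c.p - b.p + P.ν • divg Ω c.ut) = c.p + (P.ν • divg Ω c.ut + g) by abel]
    at this

/-- The velocity part of the energy estimate: the projection equation makes the pressure terms
telescope, and half of the viscous dissipation pays for the growth of `‖g‖`. -/
theorem Step.velocity_estimate (h : Step Ω P dt t a b c) (hadm : Admissible Ω P a b)
    (hdt : 0 < dt) (hν : 0 < P.ν) {g : L2 Ω} (hH : MemH1 Ω (b.p + g)) :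
    1 / 2 * vecNormSq Ω c.u + 1 / 2 * vecNormSq Ω ((2 : ℝ) • c.u - b.u)
      + 2 / 3 * dt ^ 2 * gradNormSq Ω (c.p + (P.ν • divg Ω c.ut + g))
      + P.ν⁻¹ * dt * ‖P.ν • divg Ω c.ut + g‖ ^ 2
    - (1 / 2 * vecNormSq Ω b.u + 1 / 2 * vecNormSq Ω ((2 : ℝ) • b.u - a.u)
      + 2 / 3 * dt ^ 2 * gradNormSq Ω (b.p + g) + P.ν⁻¹ * dt * ‖g‖ ^ 2)
    ≤ - P.ν * dt * vecGradNormSq Ω c.ut - P.ν * dt * ‖rot c.ut‖ ^ 2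
      + 2 * dt * (c.r / √(E1 Ω P ((2 : ℝ) • b.φ - a.φ) + P.δ)
          * forcing Ω ((2 : ℝ) • b.μ - a.μ) ((2 : ℝ) • b.φ - a.φ) c.ut)
      - 2 * dt * (Real.exp (t / P.T) * c.q
          * trilinear Ω ((2 : ℝ) • b.u - a.u) ((2 : ℝ) • b.u - a.u) c.ut) := by
  have hut := h.eq_ut c.ut h.ut_mem
  have hu := h.u_eq hdt
  have hψ := h.ψ_mem
  have hH' : gradNormSq Ω (c.p + (P.ν • divg Ω c.ut + g)) = gradNormSq Ω (b.p + g)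
      + (2 * ∑ i, inner ℝ (pd Ω i (b.p + g)) (pd Ω i (c.p - b.p + P.ν • divg Ω c.ut))
        + gradNormSq Ω (c.p - b.p + P.ν • divg Ω c.ut)) := by
    rw [show c.p + (P.ν • divg Ω c.ut + g) = b.p + g + (c.p - b.p + P.ν • divg Ω c.ut) by abel]
    simp only [gradNormSq, Finset.mul_sum, ← Finset.sum_add_distrib]
    refine Finset.sum_congr rfl fun i _ => ?_
    rw [pd_add hH hψ, norm_add_sq_real]; ring
  have oc := h.u_mem _ hψ
  have ob := hadm.div_new _ hψ
  have oa := hadm.div_old _ hψ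
  have ocH := h.u_mem _ hH
  have hbp : inner ℝ b.p (divg Ω c.ut)
      = - ∑ i, inner ℝ (pd Ω i (b.p + g)) (c.ut i) - inner ℝ g (divg Ω c.ut) := by
    have e : inner ℝ (b.p + g) (divg Ω c.ut) = - ∑ i, inner ℝ (pd Ω i (b.p + g)) (c.ut i) := by
      rw [divg, inner_sum, ← Finset.sum_neg_distrib]
      exact Finset.sum_congr rfl fun i _ => (h.ut_mem i).inner_pd hH i
    rw [inner_add_left] at e
    linarith
  have hg : P.ν⁻¹ * dt * ‖P.ν • divg Ω c.ut + g‖ ^ 2 = P.ν⁻¹ * dt * ‖g‖ ^ 2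
      + 2 * dt * inner ℝ g (divg Ω c.ut) + P.ν * dt * ‖divg Ω c.ut‖ ^ 2 := by
    rw [norm_add_sq_real, norm_smul, real_inner_smul_left, real_inner_comm, Real.norm_eq_abs,
      mul_pow, sq_abs]
    field_simp; ring
  have hgrad : ∑ j, gradInner Ω (c.ut j) (c.ut j) = vecGradNormSq Ω c.ut := by
    simp only [gradInner_self, vecGradNormSq]
  have hdr := vecGradNormSq_eq h.ut_mem
  have hbdf : vecNormSq Ω c.u + vecNormSq Ω ((2 : ℝ) • c.u - b.u) - vecNormSq Ω b.u
      - vecNormSq Ω ((2 : ℝ) • b.u - a.u)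
      ≤ 2 * ∑ i, inner ℝ ((3 : ℝ) • c.u i - (4 : ℝ) • b.u i + a.u i) (c.u i) := by
    simp only [vecNormSq, ← Finset.sum_add_distrib, ← Finset.sum_sub_distrib, Finset.mul_sum]
    exact Finset.sum_le_sum fun i _ => bdf2_inner_le _ _ _
  rw [hgrad, hbp] at hut
  generalize c.p - b.p + P.ν • divg Ω c.ut = ψ at *
  have e1 : vecInner Ω ((2 * dt)⁻¹ • ((3 : ℝ) • c.ut - (4 : ℝ) • b.u + a.u)) c.ut
      = (2 * dt)⁻¹ * (∑ i, inner ℝ ((3 : ℝ) • c.u i - (4 : ℝ) • b.u i + a.u i) (c.u i)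
        + 3 * (2 * dt / 3) ^ 2 * gradNormSq Ω ψ) := by
    have hut' : ∀ i, c.ut i = c.u i + (2 * dt / 3) • pd Ω i ψ := fun i => by rw [hu i]; abel
    simp only [vecInner, gradNormSq, Fin.sum_univ_two, Pi.smul_apply, Pi.add_apply, Pi.sub_apply,
      hut', ← real_inner_self_eq_norm_sq, inner_add_left, inner_sub_left, inner_add_right,
      real_inner_smul_left, real_inner_smul_right] at oc ob oa ⊢
    rw [real_inner_comm (c.u 0) (pd Ω 0 ψ), real_inner_comm (c.u 1) (pd Ω 1 ψ)]
    linear_combination ((2 * dt)⁻¹ * (2 * dt / 3) * 6) * oc - 4 * ((2 * dt)⁻¹ * (2 * dt / 3)) * ob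
      + ((2 * dt)⁻¹ * (2 * dt / 3)) * oa
  have e2 : ∑ i, inner ℝ (pd Ω i (b.p + g)) (c.ut i)
      = 2 * dt / 3 * ∑ i, inner ℝ (pd Ω i (b.p + g)) (pd Ω i ψ) := by
    have hut' : ∀ i, c.ut i = c.u i + (2 * dt / 3) • pd Ω i ψ := fun i => by rw [hu i]; abel
    simp only [Fin.sum_univ_two, hut', inner_add_right, real_inner_smul_right] at ocH ⊢
    rw [real_inner_comm (c.u 0), real_inner_comm (c.u 1)]
    linear_combination ocH
  rw [e1, e2] at hut
  rw [hH', hg]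
  have hpos : 0 ≤ gradNormSq Ω ψ := Finset.sum_nonneg fun i _ => by positivity
  generalize c.r / √(E1 Ω P ((2 : ℝ) • b.φ - a.φ) + P.δ)
          * forcing Ω ((2 : ℝ) • b.μ - a.μ) ((2 : ℝ) • b.φ - a.φ) c.ut = X at *
  generalize Real.exp (t / P.T) * c.q
          * trilinear Ω ((2 : ℝ) • b.u - a.u) ((2 : ℝ) • b.u - a.u) c.ut = Y at *
  generalize ∑ i, inner ℝ ((3 : ℝ) • c.u i - (4 : ℝ) • b.u i + a.u i) (c.u i) = S at *
  generalize ∑ i, inner ℝ (pd Ω i (b.p + g)) (pd Ω i ψ) = R at *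
  have e3 : 2 * dt * (2 * dt)⁻¹ = 1 := by field_simp
  have key : S + 4 / 3 * dt ^ 2 * gradNormSq Ω ψ + 2 * dt * Y + 2 * dt * P.ν * vecGradNormSq Ω c.ut
      + 4 / 3 * dt ^ 2 * R + 2 * dt * inner ℝ g (divg Ω c.ut) = 2 * dt * X := by
    linear_combination (2 * dt) * hut
      - (S + 4 / 3 * dt ^ 2 * gradNormSq Ω ψ) * e3
  have hν' : P.ν * dt * vecGradNormSq Ω c.ut
      = P.ν * dt * ‖divg Ω c.ut‖ ^ 2 + P.ν * dt * ‖rot c.ut‖ ^ 2 := by rw [hdr]; ring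
  nlinarith [mul_nonneg (sq_nonneg dt) hpos]

theorem Step.energy_estimate (h : Step Ω P dt t a b c) (hadm : Admissible Ω P a b)
    (hdt : 0 < dt) (hν : 0 < P.ν) (hγ : 0 < P.γ) {g : L2 Ω} (hH : MemH1 Ω (b.p + g)) :
    energy Ω P dt b c (P.ν • divg Ω c.ut + g) (c.p + (P.ν • divg Ω c.ut + g))
        - energy Ω P dt a b g (b.p + g)
      ≤ - P.ν * dt * vecGradNormSq Ω c.ut - P.ν * dt * ‖rot c.ut‖ ^ 2
        - 2 * dt / P.T * |c.q| ^ 2 - 2 * P.M * dt * gradNormSq Ω c.μ := by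
  have h1 := h.phase_estimate hadm hdt hγ
  have h2 := h.velocity_estimate hadm hdt hν hH
  have hq : 3 * c.q - 4 * b.q + a.q = 2 * dt * (- (1 / P.T) * c.q
        + Real.exp (t / P.T) * trilinear Ω ((2 : ℝ) • b.u - a.u) ((2 : ℝ) • b.u - a.u) c.ut) := by
    rw [← h.eq_q]; field_simp
  have h3 : c.q * (3 * c.q - 4 * b.q + a.q) = - (2 * dt / P.T * |c.q| ^ 2)
      + 2 * dt * (Real.exp (t / P.T) * c.q
        * trilinear Ω ((2 : ℝ) • b.u - a.u) ((2 : ℝ) • b.u - a.u) c.ut) := by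
    rw [hq, sq_abs]; ring
  unfold energy
  nlinarith [sq_nonneg (c.q - 2 * b.q + a.q)]

theorem IsSolution.memH1_HSeq {N : ℕ} {L : ℕ → Level Ω} (h : IsSolution Ω P N L) :
    ∀ n, n + 1 ≤ N → MemH1 Ω (HSeq Ω P L (n + 1)) := by
  intro n
  induction n with
  | zero => intro _; simpa [HSeq, gSeq] using h.H_one
  | succ n ih => intro hn; exact (h.step n hn).memH1_H (ih (by omega))

end Energy

open scoped ENNReal
open Set Filter

/-! ### An averaging operator along contracted segments -/

theorem ennreal_add_pow_le (a b : ℝ≥0∞) (n : ℕ) : (a + b) ^ n ≤ 2 ^ n * (a ^ n + b ^ n) := by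
  rcases le_total a b with h | h
  · calc (a + b) ^ n ≤ (2 * b) ^ n := by gcongr; rw [two_mul]; gcongr
      _ = 2 ^ n * b ^ n := mul_pow _ _ _
      _ ≤ _ := by gcongr; exact le_add_self
  · calc (a + b) ^ n ≤ (2 * a) ^ n := by gcongr; rw [two_mul]; gcongr
      _ = 2 ^ n * a ^ n := mul_pow _ _ _
      _ ≤ _ := by gcongr; exact le_self_add

theorem lintegral_pow_le_measure_univ_pow_mul {α : Type*} [MeasurableSpace α] (μ : Measure α)
    {f : α → ℝ≥0∞} (hf : AEMeasurable f μ) {n : ℕ} (hn : 1 < n) :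
    (∫⁻ x, f x ∂μ) ^ n ≤ μ univ ^ (n - 1) * ∫⁻ x, f x ^ n ∂μ := by
  have hn' : (1 : ℝ) < n := by exact_mod_cast hn
  have hn0 : (n : ℝ) ≠ 0 := by positivity
  have h := ENNReal.lintegral_mul_le_Lp_mul_Lq μ (Real.HolderConjugate.conjExponent hn') hf
    (aemeasurable_const (b := (1 : ℝ≥0∞)))
  simp only [Pi.mul_apply, mul_one, ENNReal.one_rpow, lintegral_const, one_mul] at h
  calc (∫⁻ x, f x ∂μ) ^ n ≤ _ := pow_le_pow_left' h n
    _ = _ := by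
      rw [mul_pow, ← ENNReal.rpow_natCast, ← ENNReal.rpow_mul, one_div_mul_cancel hn0,
        ENNReal.rpow_one, ← ENNReal.rpow_natCast (_ ^ _), ← ENNReal.rpow_mul, mul_comm]
      congr 1
      · rw [← ENNReal.rpow_natCast]
        congr 1
        rw [Real.conjExponent, Nat.cast_sub hn.le]
        field_simp
        simp
      · simp only [ENNReal.rpow_natCast]

theorem lintegral_comp_add_smul (G : Plane → ℝ≥0∞) (hG : Measurable G) (y : Plane) {r : ℝ}
    (hr : 0 < r) : ∫⁻ w, G (y + r • w) = ENNReal.ofReal (r ^ 2)⁻¹ * ∫⁻ w, G w := by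
  have h1 : ∫⁻ w, G (y + r • w)
      = ∫⁻ w, G (y + w) ∂(Measure.map (fun x : Plane => r • x) volume) := by
    rw [lintegral_map (by fun_prop) (by fun_prop)]
  rw [h1, Measure.map_addHaar_smul _ hr.ne', lintegral_smul_measure, lintegral_add_left_eq_self]
  simp [abs_of_pos hr]

/-- A weighted average of `G` over the balls `ball y (s³ h)`, `0 < s < 1`: it bounds what a function
with `|∇f| ≤ G` gains along the segments that join `y` to a ball. The segments are run through with
parameter `s³`, so that the weight `3s²` tames the concentration of the small balls in `L⁶`. -/
def segAvg (h : ℝ) (G : Plane → ℝ≥0∞) (y : Plane) : ℝ≥0∞ :=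
  ∫⁻ s in Ioo (0 : ℝ) 1, ENNReal.ofReal (3 * s ^ 2) *
    ∫⁻ w in Metric.ball (0 : Plane) h, G (y + s ^ 3 • w)

theorem measurable_inner_avg (h : ℝ) {G : Plane → ℝ≥0∞} (hG : Measurable G) :
    Measurable fun p : Plane × ℝ => ∫⁻ w in Metric.ball (0 : Plane) h, G (p.1 + p.2 ^ 3 • w) := by
  refine Measurable.lintegral_prod_right' (f := fun q : (Plane × ℝ) × Plane =>
    G (q.1.1 + q.1.2 ^ 3 • q.2)) ?_
  fun_prop

theorem measurable_segAvg (h : ℝ) {G : Plane → ℝ≥0∞} (hG : Measurable G) :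
    Measurable (segAvg h G) := by
  refine Measurable.lintegral_prod_right' (f := fun q : Plane × ℝ => ENNReal.ofReal (3 * q.2 ^ 2) *
    ∫⁻ w in Metric.ball (0 : Plane) h, G (q.1 + q.2 ^ 3 • w)) ?_
  exact Measurable.mul (by fun_prop) (measurable_inner_avg h hG)

/-- The averaging operator maps `L²` into `L⁶`. -/
theorem lintegral_segAvg_pow_six_le (h : ℝ) {G : Plane → ℝ≥0∞} (hG : Measurable G) :
    ∫⁻ y, segAvg h G y ^ 6
      ≤ 729 * volume (Metric.ball (0 : Plane) h) ^ 4 * (∫⁻ y, G y ^ 2) ^ 3 := by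
  set B := volume (Metric.ball (0 : Plane) h) with hB
  set N := ∫⁻ y, G y ^ 2 with hN
  have hm2 : Measurable fun p : Plane × ℝ =>
      ∫⁻ w in Metric.ball (0 : Plane) h, G (p.1 + p.2 ^ 3 • w) ^ 2 :=
    measurable_inner_avg h (G := fun z => G z ^ 2) (by fun_prop)
  have step1 : ∀ y, ∀ s ∈ Ioo (0 : ℝ) 1, (ENNReal.ofReal (3 * s ^ 2) *
      ∫⁻ w in Metric.ball (0 : Plane) h, G (y + s ^ 3 • w)) ^ 6
      ≤ 729 * B ^ 3 * N ^ 2 * ∫⁻ w in Metric.ball (0 : Plane) h, G (y + s ^ 3 • w) ^ 2 := by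
    intro y s hs
    have hs3 : 0 < s ^ 3 := pow_pos hs.1 3
    set I := ∫⁻ w in Metric.ball (0 : Plane) h, G (y + s ^ 3 • w) with hI
    set J := ∫⁻ w in Metric.ball (0 : Plane) h, G (y + s ^ 3 • w) ^ 2 with hJ
    have h1 : I ^ 2 ≤ B * J := by
      have := lintegral_pow_le_measure_univ_pow_mul (volume.restrict (Metric.ball (0 : Plane) h))
        (f := fun w => G (y + s ^ 3 • w)) (by fun_prop) (n := 2) (by norm_num)
      simpa [hB] using this
    have h2 : J ≤ ENNReal.ofReal ((s ^ 3) ^ 2)⁻¹ * N := by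
      rw [hN, ← lintegral_comp_add_smul (fun z => G z ^ 2) (by fun_prop) y hs3]
      exact setLIntegral_le_lintegral _ _
    calc (ENNReal.ofReal (3 * s ^ 2) * I) ^ 6
        = ENNReal.ofReal (3 * s ^ 2) ^ 6 * (I ^ 2) ^ 3 := by ring
      _ ≤ ENNReal.ofReal (3 * s ^ 2) ^ 6 * (B * J) ^ 3 := by gcongr
      _ = ENNReal.ofReal (3 * s ^ 2) ^ 6 * B ^ 3 * J ^ 2 * J := by ring
      _ ≤ ENNReal.ofReal (3 * s ^ 2) ^ 6 * B ^ 3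
            * (ENNReal.ofReal ((s ^ 3) ^ 2)⁻¹ * N) ^ 2 * J := by gcongr
      _ = (ENNReal.ofReal (3 * s ^ 2) ^ 6 * ENNReal.ofReal ((s ^ 3) ^ 2)⁻¹ ^ 2)
            * B ^ 3 * N ^ 2 * J := by ring
      _ = 729 * B ^ 3 * N ^ 2 * J := by
        congr 3
        have hs0 := hs.1
        rw [← ENNReal.ofReal_pow (by positivity), ← ENNReal.ofReal_pow (by positivity),
          ← ENNReal.ofReal_mul (by positivity)]
        have : (3 * s ^ 2) ^ 6 * ((s ^ 3) ^ 2)⁻¹ ^ 2 = 729 := by field_simp; norm_num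
        rw [this]; norm_num
  calc ∫⁻ y, segAvg h G y ^ 6
      ≤ ∫⁻ y, ∫⁻ s in Ioo (0 : ℝ) 1, (ENNReal.ofReal (3 * s ^ 2) *
          ∫⁻ w in Metric.ball (0 : Plane) h, G (y + s ^ 3 • w)) ^ 6 := by
        refine lintegral_mono fun y => ?_
        have := lintegral_pow_le_measure_univ_pow_mul (volume.restrict (Ioo (0 : ℝ) 1))
          (f := fun s => ENNReal.ofReal (3 * s ^ 2) *
            ∫⁻ w in Metric.ball (0 : Plane) h, G (y + s ^ 3 • w)) (n := 6) ?_ (by norm_num)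
        · simpa [segAvg] using this
        · exact (Measurable.mul (by fun_prop)
            ((measurable_inner_avg h hG).comp (measurable_const.prodMk measurable_id))).aemeasurable
    _ ≤ ∫⁻ y, ∫⁻ s in Ioo (0 : ℝ) 1, 729 * B ^ 3 * N ^ 2
          * ∫⁻ w in Metric.ball (0 : Plane) h, G (y + s ^ 3 • w) ^ 2 :=
        lintegral_mono fun y => setLIntegral_mono' measurableSet_Ioo (step1 y)
    _ = ∫⁻ s in Ioo (0 : ℝ) 1, ∫⁻ y, 729 * B ^ 3 * N ^ 2
          * ∫⁻ w in Metric.ball (0 : Plane) h, G (y + s ^ 3 • w) ^ 2 :=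
        lintegral_lintegral_swap (Measurable.const_mul hm2 _).aemeasurable
    _ = ∫⁻ s in Ioo (0 : ℝ) 1, 729 * B ^ 3 * N ^ 2 * (N * B) := by
        refine setLIntegral_congr_fun measurableSet_Ioo fun s _ => ?_
        have hms : Measurable fun y : Plane =>
            ∫⁻ w in Metric.ball (0 : Plane) h, G (y + s ^ 3 • w) ^ 2 :=
          hm2.comp (measurable_id.prodMk measurable_const)
        rw [lintegral_const_mul _ hms,
          lintegral_lintegral_swap (by fun_prop)]
        congr 1
        calc ∫⁻ w in Metric.ball (0 : Plane) h, ∫⁻ y, G (y + s ^ 3 • w) ^ 2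
            = ∫⁻ w in Metric.ball (0 : Plane) h, N := by
              refine lintegral_congr fun w => ?_
              exact lintegral_add_right_eq_self (fun z => G z ^ 2) _
          _ = N * B := by simp [hB]
    _ = 729 * B ^ 4 * N ^ 3 := by simp; ring

/-- A function with `|∇f| ≤ G` on the cone spanned by `y` and `ball z ρ` oscillates between `y` and
the ball by no more than the average of `G` along the segments from `y`. -/
theorem lintegral_enorm_sub_le {f : Plane → ℝ} (hf : ContDiff ℝ 1 f) {G : Plane → ℝ≥0∞}
    (hG : Measurable G) {y z : Plane} {ρ h : ℝ}
    (hball : Metric.ball z ρ ⊆ Metric.ball y h)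
    (hgrad : ∀ w ∈ Metric.ball z ρ, ∀ s ∈ Ioo (0 : ℝ) 1,
      ‖fderiv ℝ f (y + s ^ 3 • (w - y))‖ₑ ≤ G (y + s ^ 3 • (w - y))) :
    ∫⁻ w in Metric.ball z ρ, ‖f w - f y‖ₑ ≤ ENNReal.ofReal h * segAvg h G y := by
  have hf' : Continuous (fderiv ℝ f) := hf.continuous_fderiv one_ne_zero
  have hseg : ∀ w ∈ Metric.ball z ρ, ‖f w - f y‖ₑ ≤ ENNReal.ofReal h *
      ∫⁻ s in Ioo (0 : ℝ) 1, ENNReal.ofReal (3 * s ^ 2) * G (y + s ^ 3 • (w - y)) := by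
    intro w hw
    have hderiv : ∀ s : ℝ, HasDerivAt (fun s : ℝ => f (y + s ^ 3 • (w - y)))
        (fderiv ℝ f (y + s ^ 3 • (w - y)) ((3 * s ^ 2) • (w - y))) s := by
      intro s
      have h1 : HasDerivAt (fun s : ℝ => y + s ^ 3 • (w - y)) ((3 * s ^ 2) • (w - y)) s := by
        have := ((hasDerivAt_pow 3 s).smul_const (w - y)).const_add y
        simpa using this
      exact ((hf.differentiable one_ne_zero) _).hasFDerivAt.comp_hasDerivAt s h1
    have hc : Continuous fun s : ℝ => fderiv ℝ f (y + s ^ 3 • (w - y)) ((3 * s ^ 2) • (w - y)) := by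
      fun_prop
    have hftc := intervalIntegral.integral_eq_sub_of_hasDerivAt (a := 0) (b := 1)
      (fun s _ => hderiv s) (hc.intervalIntegrable _ _)
    simp only [one_pow, one_smul, add_sub_cancel, ne_eq, OfNat.ofNat_ne_zero, not_false_eq_true,
      zero_pow, zero_smul, add_zero] at hftc
    rw [← hftc]
    rw [intervalIntegral.integral_of_le zero_le_one, integral_Ioc_eq_integral_Ioo]
    refine (enorm_integral_le_lintegral_enorm _).trans ?_
    rw [← lintegral_const_mul' _ _ ENNReal.ofReal_ne_top]
    refine setLIntegral_mono' measurableSet_Ioo fun s hs => ?_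
    have hwy : ‖w - y‖ₑ ≤ ENNReal.ofReal h := by
      rw [← ofReal_norm]
      exact ENNReal.ofReal_le_ofReal (by simpa [dist_eq_norm] using (hball hw).le)
    calc ‖fderiv ℝ f (y + s ^ 3 • (w - y)) ((3 * s ^ 2) • (w - y))‖ₑ
        ≤ ‖fderiv ℝ f (y + s ^ 3 • (w - y))‖ₑ * ‖(3 * s ^ 2) • (w - y)‖ₑ :=
          ContinuousLinearMap.le_opENorm _ _
      _ ≤ G (y + s ^ 3 • (w - y)) * (ENNReal.ofReal (3 * s ^ 2) * ENNReal.ofReal h) := by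
          gcongr
          · exact hgrad w hw s hs
          · rw [enorm_smul]
            gcongr
            rw [Real.enorm_eq_ofReal (by positivity)]
      _ = _ := by ring
  calc ∫⁻ w in Metric.ball z ρ, ‖f w - f y‖ₑ
      ≤ ∫⁻ w in Metric.ball z ρ, ENNReal.ofReal h *
      ∫⁻ s in Ioo (0 : ℝ) 1, ENNReal.ofReal (3 * s ^ 2) * G (y + s ^ 3 • (w - y)) :=
        setLIntegral_mono' measurableSet_ball hseg
    _ ≤ _ := by
        rw [lintegral_const_mul' _ _ ENNReal.ofReal_ne_top]
        gcongr
        have hm : Measurable (Function.uncurry fun (w : Plane) (s : ℝ) =>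
            ENNReal.ofReal (3 * s ^ 2) * G (y + s ^ 3 • (w - y))) := by
          unfold Function.uncurry; fun_prop
        rw [lintegral_lintegral_swap hm.aemeasurable]
        refine lintegral_mono fun s => ?_
        dsimp only
        rw [lintegral_const_mul' _ _ ENNReal.ofReal_ne_top]
        refine mul_le_mul' le_rfl ?_
        -- translation by `y`
        calc ∫⁻ w in Metric.ball z ρ, G (y + s ^ 3 • (w - y))
            ≤ ∫⁻ w in Metric.ball y h, G (y + s ^ 3 • (w - y)) := lintegral_mono_set hball
          _ = ∫⁻ w, (Metric.ball (0 : Plane) h).indicator (fun w => G (y + s ^ 3 • w)) (w - y) := by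
              rw [← lintegral_indicator measurableSet_ball]
              refine lintegral_congr fun w => ?_
              by_cases hw : w ∈ Metric.ball y h
              · rw [indicator_of_mem hw, indicator_of_mem]
                simpa [dist_eq_norm] using hw
              · rw [indicator_of_notMem hw, indicator_of_notMem]
                simpa [dist_eq_norm] using hw
          _ = ∫⁻ w in Metric.ball (0 : Plane) h, G (y + s ^ 3 • w) := by
              rw [lintegral_sub_right_eq_self
                (fun x => (Metric.ball (0 : Plane) h).indicator (fun w => G (y + s ^ 3 • w)) x),
                lintegral_indicator measurableSet_ball]

theorem volume_ball_mul_enorm_le {f : Plane → ℝ} (hf : ContDiff ℝ 1 f) {G : Plane → ℝ≥0∞}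
    (hG : Measurable G) {y z : Plane} {ρ h : ℝ}
    (hball : Metric.ball z ρ ⊆ Metric.ball y h)
    (hgrad : ∀ w ∈ Metric.ball z ρ, ∀ s ∈ Ioo (0 : ℝ) 1,
      ‖fderiv ℝ f (y + s ^ 3 • (w - y))‖ₑ ≤ G (y + s ^ 3 • (w - y))) :
    volume (Metric.ball z ρ) * ‖f y‖ₑ
      ≤ (∫⁻ w in Metric.ball z ρ, ‖f w‖ₑ) + ENNReal.ofReal h * segAvg h G y := by
  have hfc := hf.continuous
  calc volume (Metric.ball z ρ) * ‖f y‖ₑ = ∫⁻ w in Metric.ball z ρ, ‖f y‖ₑ := by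
        simp [mul_comm]
    _ ≤ ∫⁻ w in Metric.ball z ρ, (‖f w‖ₑ + ‖f w - f y‖ₑ) := by
        refine lintegral_mono fun w => ?_
        calc ‖f y‖ₑ = ‖f w - (f w - f y)‖ₑ := by rw [sub_sub_cancel]
          _ ≤ _ := enorm_sub_le
    _ = (∫⁻ w in Metric.ball z ρ, ‖f w‖ₑ) + ∫⁻ w in Metric.ball z ρ, ‖f w - f y‖ₑ :=
        lintegral_add_left (by fun_prop) _
    _ ≤ _ := by gcongr; exact lintegral_enorm_sub_le hf hG hball hgrad

open scoped Convolution

/-! ### Mollification of functions with weak derivatives -/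

/-- The mollification of `f` by the normalized bump `φ`. -/
def moll (φ : ContDiffBump (0 : Plane)) (f : Plane → ℝ) : Plane → ℝ :=
  φ.normed volume ⋆[ContinuousLinearMap.lsmul ℝ ℝ, volume] f

theorem moll_apply_swap (φ : ContDiffBump (0 : Plane)) (f : Plane → ℝ) (x : Plane) :
    moll φ f x = ∫ y, φ.normed volume (x - y) * f y := convolution_eq_swap _

theorem contDiff_moll (φ : ContDiffBump (0 : Plane)) {f : Plane → ℝ} (hf : LocallyIntegrable f) :
    ContDiff ℝ ∞ (moll φ f) :=
  φ.hasCompactSupport_normed.contDiff_convolution_left _ φ.contDiff_normed hf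

/-- Mollification is a contraction of `L²`. -/
theorem lintegral_enorm_moll_sq_le (φ : ContDiffBump (0 : Plane)) {f : Plane → ℝ}
    (hf : Measurable f) : ∫⁻ x, ‖moll φ f x‖ₑ ^ 2 ≤ ∫⁻ x, ‖f x‖ₑ ^ 2 := by
  set ρ : Plane → ℝ≥0∞ := fun t => ENNReal.ofReal (φ.normed volume t) with hρ
  have hρm : Measurable ρ := by
    have : Continuous (φ.normed volume) := φ.continuous_normed
    exact ENNReal.measurable_ofReal.comp this.measurable
  have hmass : ∫⁻ t, ρ t = 1 := by
    rw [hρ, ← ofReal_integral_eq_lintegral_ofReal φ.integrable_normed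
      (Eventually.of_forall fun t => φ.nonneg_normed t), φ.integral_normed, ENNReal.ofReal_one]
  have hpt : ∀ x, ‖moll φ f x‖ₑ ^ 2 ≤ ∫⁻ t, ρ t * ‖f (x - t)‖ₑ ^ 2 := by
    intro x
    have h1 : ‖moll φ f x‖ₑ ≤ ∫⁻ t, ‖f (x - t)‖ₑ ∂(volume.withDensity ρ) := by
      rw [lintegral_withDensity_eq_lintegral_mul _ hρm (by fun_prop)]
      refine (enorm_integral_le_lintegral_enorm _).trans (lintegral_mono fun t => ?_)
      simp only [Pi.mul_apply, hρ, ContinuousLinearMap.lsmul_apply, smul_eq_mul, enorm_mul]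
      rw [Real.enorm_eq_ofReal (φ.nonneg_normed t)]
    refine (pow_le_pow_left' h1 2).trans ?_
    refine (lintegral_pow_le_measure_univ_pow_mul _ (f := fun t => ‖f (x - t)‖ₑ)
      (by fun_prop) (n := 2) (by norm_num)).trans ?_
    rw [withDensity_apply _ MeasurableSet.univ, Measure.restrict_univ, hmass, one_pow, one_mul,
      lintegral_withDensity_eq_lintegral_mul _ hρm (by fun_prop)]
    rfl
  calc ∫⁻ x, ‖moll φ f x‖ₑ ^ 2 ≤ ∫⁻ x, ∫⁻ t, ρ t * ‖f (x - t)‖ₑ ^ 2 := lintegral_mono hpt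
    _ = ∫⁻ t, ∫⁻ x, ρ t * ‖f (x - t)‖ₑ ^ 2 := lintegral_lintegral_swap (by
        unfold Function.uncurry; fun_prop)
    _ = ∫⁻ t, ρ t * ∫⁻ x, ‖f x‖ₑ ^ 2 := by
        refine lintegral_congr fun t => ?_
        rw [lintegral_const_mul _ (by fun_prop),
          lintegral_sub_right_eq_self (fun x => ‖f x‖ₑ ^ 2)]
    _ = ∫⁻ x, ‖f x‖ₑ ^ 2 := by rw [lintegral_mul_const _ hρm, hmass, one_mul]

theorem normed_bump_eq_zero (φ : ContDiffBump (0 : Plane)) {t : Plane} (ht : φ.rOut ≤ ‖t‖) :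
    φ.normed volume t = 0 := by
  have : t ∉ Function.support (φ.normed volume) := by
    rw [φ.support_normed_eq]; simpa using ht
  simpa using this

theorem moll_congr (φ : ContDiffBump (0 : Plane)) {f g : Plane → ℝ} {x : Plane}
    (h : ∀ y ∈ Metric.ball x φ.rOut, f y = g y) : moll φ f x = moll φ g x := by
  rw [moll_apply_swap, moll_apply_swap]
  refine integral_congr_ae (Eventually.of_forall fun y => ?_)
  by_cases hy : y ∈ Metric.ball x φ.rOut
  · simp only [h y hy]
  · have : φ.normed volume (x - y) = 0 := normed_bump_eq_zero φ (by
      simpa [dist_eq_norm, norm_sub_rev] using hy)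
    simp only [this, zero_mul]

theorem measurable_coeFn (v : L2 Ω) : Measurable (v : Plane → ℝ) :=
  (Lp.stronglyMeasurable v).measurable

theorem memLp_indicator (v : L2 Ω) : MemLp ((Ω : Set Plane).indicator v) 2 volume :=
  (memLp_indicator_iff_restrict Ω.isOpen.measurableSet).2 (Lp.memLp v)

theorem locallyIntegrable_indicator (v : L2 Ω) :
    LocallyIntegrable ((Ω : Set Plane).indicator v) volume :=
  (memLp_indicator v).locallyIntegrable (by norm_num)

/-- Mollification commutes with weak derivatives away from the boundary. -/
theorem cpd_moll (φ : ContDiffBump (0 : Plane)) {i : Fin 2} {v w : L2 Ω} (h : IsWeakPD Ω i v w)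
    {x : Plane} (hx : Metric.closedBall x φ.rOut ⊆ Ω) :
    cpd i (moll φ ((Ω : Set Plane).indicator v)) x = moll φ ((Ω : Set Plane).indicator w) x := by
  set e : Plane := EuclideanSpace.single i 1
  set ρ : Plane → ℝ := φ.normed volume with hρ
  have hρd : ContDiff ℝ ∞ ρ := φ.contDiff_normed
  have hρ1 : ContDiff ℝ 1 ρ := hρd.of_le (by exact_mod_cast le_top)
  have hρc : HasCompactSupport ρ := φ.hasCompactSupport_normed
  have hρ' : Continuous (fderiv ℝ ρ) := hρ1.continuous_fderiv one_ne_zero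
  have hV := locallyIntegrable_indicator v
  -- the derivative of the mollification falls on the bump
  have h1 : cpd i (moll φ ((Ω : Set Plane).indicator v)) x
      = ∫ y in (Ω : Set Plane), fderiv ℝ ρ (x - y) e * v y := by
    have key : ∀ V : Plane → ℝ, LocallyIntegrable V →
        cpd i (moll φ V) x = ∫ y, fderiv ℝ ρ (x - y) e * V y := by
      intro V hV
      have hd := (hρc.hasFDerivAt_convolution_left (ContinuousLinearMap.lsmul ℝ ℝ) hρ1 hV x).fderiv
      have hex : ConvolutionExistsAt (fderiv ℝ ρ) V x
          (ContinuousLinearMap.precompL Plane (ContinuousLinearMap.lsmul ℝ ℝ)) volume :=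
        (hρc.fderiv ℝ).convolutionExists_left _ hρ' hV x
      have hd' : cpd i (moll φ V) x = (fderiv ℝ ρ ⋆[ContinuousLinearMap.precompL Plane
          (ContinuousLinearMap.lsmul ℝ ℝ), volume] V) x e := congrArg (fun L => L e) hd
      rw [hd', convolution_def, ContinuousLinearMap.integral_apply hex,
        ← integral_sub_left_eq_self _ volume x]
      refine integral_congr_ae (Eventually.of_forall fun y => ?_)
      simp
    rw [key _ hV, ← integral_indicator Ω.isOpen.measurableSet]
    refine integral_congr_ae (Eventually.of_forall fun y => ?_)
    by_cases hy : y ∈ (Ω : Set Plane)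
    · simp [hy]
    · simp [hy]
  -- the translated and reflected bump is a test function on `Ω`
  have hsupp : tsupport (fun y => ρ (x - y)) ⊆ Metric.closedBall x φ.rOut := by
    refine closure_minimal (fun y hy => ?_) Metric.isClosed_closedBall
    by_contra hy'
    refine hy (normed_bump_eq_zero φ ?_)
    rw [Metric.mem_closedBall, not_le, dist_eq_norm, norm_sub_rev] at hy'
    exact hy'.le
  let χ : TestFunction Ω ℝ ⊤ := ⟨fun y => ρ (x - y),
    hρd.comp (contDiff_const.sub contDiff_id),
    HasCompactSupport.of_support_subset_isCompact (isCompact_closedBall x φ.rOut)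
      ((subset_tsupport _).trans hsupp),
    hsupp.trans hx⟩
  have hχ : ∀ y, cpd i χ y = - fderiv ℝ ρ (x - y) e := by
    intro y
    have := ((hρ1.differentiable one_ne_zero) (x - y)).hasFDerivAt.comp y
      ((hasFDerivAt_const x y).sub (hasFDerivAt_id y))
    change fderiv ℝ (fun y => ρ (x - y)) y e = _
    have h2 : HasFDerivAt (fun y => ρ (x - y))
      ((fderiv ℝ ρ (x - y)).comp (0 - ContinuousLinearMap.id ℝ Plane)) y := this
    rw [h2.fderiv]; simp
  have h2 := h χ
  simp only [hχ] at h2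
  have h3 : ∫ y in (Ω : Set Plane), fderiv ℝ ρ (x - y) e * v y
      = ∫ y in (Ω : Set Plane), w y * χ y := by
    rw [← neg_inj, ← h2, ← integral_neg]
    refine integral_congr_ae (Eventually.of_forall fun y => ?_)
    simp only; ring
  rw [h1, h3, moll_apply_swap, ← integral_indicator Ω.isOpen.measurableSet]
  refine integral_congr_ae (Eventually.of_forall fun y => ?_)
  by_cases hy : y ∈ (Ω : Set Plane)
  · simp only [indicator_of_mem hy]; rw [mul_comm]; rfl
  · simp [hy]

theorem enorm_fderiv_le (f : Plane → ℝ) (x : Plane) :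
    ‖fderiv ℝ f x‖ₑ ≤ ∑ i, ‖cpd i f x‖ₑ := by
  have h : ‖fderiv ℝ f x‖ ≤ ∑ i, ‖cpd i f x‖ := by
    refine ContinuousLinearMap.opNorm_le_bound _ (by positivity) fun u => ?_
    have hu : u = ∑ i, u i • EuclideanSpace.single i (1 : ℝ) := by
      ext j; fin_cases j <;> simp
    conv_lhs => rw [hu]
    rw [map_sum, Finset.sum_mul]
    refine (norm_sum_le _ _).trans (Finset.sum_le_sum fun i _ => ?_)
    rw [map_smul, norm_smul, mul_comm, cpd]
    gcongr
    exact PiLp.norm_apply_le u i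
  simp only [← ofReal_norm]
  rw [← ENNReal.ofReal_sum_of_nonneg (fun _ _ => norm_nonneg _)]
  exact ENNReal.ofReal_le_ofReal h

/-- A sequence of bumps shrinking to the origin. -/
def bump (n : ℕ) : ContDiffBump (0 : Plane) where
  rIn := 1 / ((n : ℝ) + 1)
  rOut := 2 * (1 / ((n : ℝ) + 1))
  rIn_pos := by positivity
  rIn_lt_rOut := by
    have : 0 < 1 / ((n : ℝ) + 1) := by positivity
    linarith

theorem tendsto_bump_rOut : Tendsto (fun n => (bump n).rOut) atTop (nhds 0) := by
  have := (tendsto_one_div_add_atTop_nhds_zero_nat (𝕜 := ℝ)).const_mul 2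
  simpa [bump] using this

theorem ae_tendsto_moll {f : Plane → ℝ} (hf : LocallyIntegrable f) :
    ∀ᵐ x, Tendsto (fun n => moll (bump n) f x) atTop (nhds (f x)) :=
  ContDiffBump.ae_convolution_tendsto_right_of_locallyIntegrable (K := 2) tendsto_bump_rOut
    (Eventually.of_forall fun _ => le_rfl) hf

/-- The sum of the absolute values of the mollified components `w₀`, `w₁` of a gradient. -/
def gradMoll (n : ℕ) (w₀ w₁ : L2 Ω) (x : Plane) : ℝ≥0∞ :=
  ‖moll (bump n) ((Ω : Set Plane).indicator w₀) x‖ₑ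
    + ‖moll (bump n) ((Ω : Set Plane).indicator w₁) x‖ₑ

theorem continuous_moll (n : ℕ) (v : L2 Ω) :
    Continuous (moll (bump n) ((Ω : Set Plane).indicator v)) :=
  (contDiff_moll _ (locallyIntegrable_indicator v)).continuous

theorem measurable_gradMoll (n : ℕ) (w₀ w₁ : L2 Ω) : Measurable (gradMoll n w₀ w₁) :=
  ((continuous_moll n w₀).enorm.measurable).add ((continuous_moll n w₁).enorm.measurable)

theorem lintegral_indicator_sq {S : Set Plane} (hS : MeasurableSet S) (f : L2 Ω) :
    ∫⁻ x, ‖S.indicator f x‖ₑ ^ 2 = ∫⁻ x in S, ‖f x‖ₑ ^ 2 := by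
  rw [← lintegral_indicator hS]
  refine lintegral_congr fun x => ?_
  by_cases hx : x ∈ S <;> simp [hx]

theorem lintegral_gradMoll_sq_le (n : ℕ) (w₀ w₁ : L2 Ω) :
    ∫⁻ x, gradMoll n w₀ w₁ x ^ 2 ≤ 4 * ((∫⁻ x in (Ω : Set Plane), ‖w₀ x‖ₑ ^ 2)
      + ∫⁻ x in (Ω : Set Plane), ‖w₁ x‖ₑ ^ 2) := by
  calc ∫⁻ x, gradMoll n w₀ w₁ x ^ 2
      ≤ ∫⁻ x, 2 ^ 2 * (‖moll (bump n) ((Ω : Set Plane).indicator w₀) x‖ₑ ^ 2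
        + ‖moll (bump n) ((Ω : Set Plane).indicator w₁) x‖ₑ ^ 2) :=
        lintegral_mono fun x => ennreal_add_pow_le _ _ 2
    _ = 2 ^ 2 * ((∫⁻ x, ‖moll (bump n) ((Ω : Set Plane).indicator w₀) x‖ₑ ^ 2)
        + ∫⁻ x, ‖moll (bump n) ((Ω : Set Plane).indicator w₁) x‖ₑ ^ 2) := by
        have m0 := (continuous_moll n w₀).enorm.measurable
        have m1 := (continuous_moll n w₁).enorm.measurable
        rw [lintegral_const_mul _ (by fun_prop), lintegral_add_left (by fun_prop)]
    _ ≤ _ := by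
        rw [← lintegral_indicator_sq Ω.isOpen.measurableSet,
          ← lintegral_indicator_sq Ω.isOpen.measurableSet]
        exact mul_le_mul' (by norm_num) (add_le_add
          (lintegral_enorm_moll_sq_le _ ((measurable_coeFn w₀).indicator
            Ω.isOpen.measurableSet))
          (lintegral_enorm_moll_sq_le _ ((measurable_coeFn w₁).indicator
            Ω.isOpen.measurableSet)))

theorem enorm_fderiv_moll_le {v w₀ w₁ : L2 Ω} (h₀ : IsWeakPD Ω 0 v w₀) (h₁ : IsWeakPD Ω 1 v w₁)
    {n : ℕ} {x : Plane} (hx : Metric.closedBall x (bump n).rOut ⊆ Ω) :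
    ‖fderiv ℝ (moll (bump n) ((Ω : Set Plane).indicator v)) x‖ₑ ≤ gradMoll n w₀ w₁ x := by
  refine (enorm_fderiv_le _ _).trans ?_
  rw [Fin.sum_univ_two, cpd_moll _ h₀ hx, cpd_moll _ h₁ hx, gradMoll]

/-! ### A Sobolev inequality on sets that see balls -/

/-- Every point `y` of `A` sees a ball of radius `ρ` whose double is contained in `K`, at distance
less than `h`: the cone spanned by `y` and the closed ball lies in `Ω`. -/
def SeesBalls (Ω : Opens Plane) (A K : Set Plane) (ρ h : ℝ) : Prop :=
  ∀ y ∈ A, ∃ z, Metric.ball z (2 * ρ) ⊆ K ∧ Metric.ball z ρ ⊆ Metric.ball y h ∧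
    ∀ w ∈ Metric.closedBall z ρ, ∀ s ∈ Icc (0 : ℝ) 1, y + s • (w - y) ∈ Ω

/-- The constant `C` depends only on the geometry; the proof compares, for small mollification
parameters, the mollifications of `v` and of its derivatives and concludes with Fatou's lemma. -/
theorem SeesBalls.lintegral_pow_six_le {A K : Set Plane} {ρ h : ℝ} (hs : SeesBalls Ω A K ρ h)
    (hρ : 0 < ρ) (hA : MeasurableSet A) (hAΩ : A ⊆ Ω) (hAfin : volume A ≠ ⊤)
    (hK : MeasurableSet K) (hKΩ : K ⊆ Ω) :
    ∃ C : ℝ≥0∞, C ≠ ⊤ ∧ ∀ v w₀ w₁ : L2 Ω, IsWeakPD Ω 0 v w₀ → IsWeakPD Ω 1 v w₁ →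
      ∫⁻ x in A, ‖v x‖ₑ ^ 6 ≤ C * ((∫⁻ x in K, ‖v x‖ₑ ^ 2)
        + (∫⁻ x in (Ω : Set Plane), ‖w₀ x‖ₑ ^ 2) + ∫⁻ x in (Ω : Set Plane), ‖w₁ x‖ₑ ^ 2) ^ 3 := by
  set b := volume (Metric.ball (0 : Plane) ρ) with hb
  set B := volume (Metric.ball (0 : Plane) h) with hB
  have hb0 : b ≠ 0 := (Metric.measure_ball_pos volume _ hρ).ne'
  have hbt : b ≠ ⊤ := measure_ball_lt_top.ne
  have hBt : B ≠ ⊤ := measure_ball_lt_top.ne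
  have hbz : ∀ z : Plane, volume (Metric.ball z ρ) = b := fun z => by
    rw [hb, Measure.addHaar_ball_center]
  refine ⟨(b ^ 6)⁻¹ * (64 * (b ^ 3 * volume A + ENNReal.ofReal h ^ 6 * (729 * B ^ 4 * 64))),
    ENNReal.mul_ne_top (ENNReal.inv_ne_top.2 (pow_ne_zero 6 hb0)) (by finiteness), ?_⟩
  intro v w₀ w₁ h₀ h₁
  set NK := ∫⁻ x in K, ‖v x‖ₑ ^ 2 with hNK
  set N₀ := ∫⁻ x in (Ω : Set Plane), ‖w₀ x‖ₑ ^ 2 with hN₀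
  set N₁ := ∫⁻ x in (Ω : Set Plane), ‖w₁ x‖ₑ ^ 2 with hN₁
  let G : ℕ → Plane → ℝ≥0∞ := fun n => gradMoll n w₀ w₁
  let V : ℕ → Plane → ℝ := fun n => moll (bump n) ((Ω : Set Plane).indicator v)
  let VK : ℕ → Plane → ℝ := fun n => moll (bump n) (K.indicator v)
  have hGm : ∀ n, Measurable (G n) := fun n => measurable_gradMoll n w₀ w₁
  have hG2 : ∀ n, ∫⁻ x, G n x ^ 2 ≤ 4 * (N₀ + N₁) := fun n => lintegral_gradMoll_sq_le n w₀ w₁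
  -- the truncated sixth power is bounded for every mollification parameter
  let bound : ℕ → Plane → ℝ≥0∞ := fun n y =>
    64 * ((b * NK) ^ 3 + (ENNReal.ofReal h * segAvg h (G n) y) ^ 6)
  let U : ℕ → Plane → ℝ≥0∞ := fun n y => min ((b * ‖V n y‖ₑ) ^ 6) (bound n y)
  have hpt : ∀ y ∈ A, ∀ᶠ n in atTop, (b * ‖V n y‖ₑ) ^ 6 ≤ bound n y := by
    intro y hy
    obtain ⟨z, hzK, hzy, hcone⟩ := hs y hy
    have hcomp : IsCompact ((fun p : Plane × ℝ => y + p.2 • (p.1 - y)) ''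
        (Metric.closedBall z ρ ×ˢ Icc (0 : ℝ) 1)) :=
      ((isCompact_closedBall z ρ).prod isCompact_Icc).image (by fun_prop)
    obtain ⟨δ, hδ, hδs⟩ := hcomp.exists_cthickening_subset_open Ω.isOpen (by
      rintro _ ⟨⟨w, s⟩, ⟨hw, hs⟩, rfl⟩
      exact hcone w hw s hs)
    have hev : ∀ᶠ n in atTop, (bump n).rOut < min δ ρ :=
      tendsto_bump_rOut.eventually_lt_const (lt_min hδ hρ)
    filter_upwards [hev] with n hn
    have hnδ := (hn.trans_le (min_le_left _ _)).le
    have hnρ := (hn.trans_le (min_le_right _ _)).le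
    have hgrad : ∀ w ∈ Metric.ball z ρ, ∀ s ∈ Ioo (0 : ℝ) 1,
        ‖fderiv ℝ (V n) (y + s ^ 3 • (w - y))‖ₑ ≤ G n (y + s ^ 3 • (w - y)) := by
      intro w hw s hs
      refine enorm_fderiv_moll_le h₀ h₁ (Subset.trans (fun x hx => ?_) hδs)
      refine Metric.mem_cthickening_of_dist_le x (y + s ^ 3 • (w - y)) _ _ ?_
        ((Metric.mem_closedBall.1 hx).trans hnδ)
      exact ⟨(w, s ^ 3), ⟨Metric.ball_subset_closedBall hw,
        ⟨pow_nonneg hs.1.le 3, pow_le_one₀ hs.1.le hs.2.le⟩⟩, rfl⟩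
    have h1 := volume_ball_mul_enorm_le ((contDiff_moll (bump n)
      (locallyIntegrable_indicator v)).of_le (by exact_mod_cast le_top)) (hGm n) hzy hgrad
    rw [hbz] at h1
    have h2 : (∫⁻ w in Metric.ball z ρ, ‖V n w‖ₑ) ^ 2 ≤ b * NK := by
      have hVm : Measurable (V n) := (continuous_moll n v).measurable
      have e1 := lintegral_pow_le_measure_univ_pow_mul (volume.restrict (Metric.ball z ρ))
        (f := fun w => ‖V n w‖ₑ) (by fun_prop) (n := 2) (by norm_num)
      refine e1.trans ?_
      simp only [Measure.restrict_apply_univ, hbz]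
      norm_num
      gcongr
      calc ∫⁻ w in Metric.ball z ρ, ‖V n w‖ₑ ^ 2 = ∫⁻ w in Metric.ball z ρ, ‖VK n w‖ₑ ^ 2 := by
            refine setLIntegral_congr_fun measurableSet_ball fun w hw => ?_
            have : V n w = VK n w := by
              refine moll_congr _ fun x hx => ?_
              have hxK : x ∈ K := hzK (by
                rw [Metric.mem_ball] at hx hw ⊢
                linarith [dist_triangle x w z])
              rw [indicator_of_mem hxK, indicator_of_mem (hKΩ hxK)]
            rw [this]
        _ ≤ ∫⁻ w, ‖VK n w‖ₑ ^ 2 := setLIntegral_le_lintegral _ _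
        _ ≤ NK := by
            rw [hNK, ← lintegral_indicator_sq hK]
            exact lintegral_enorm_moll_sq_le _ ((measurable_coeFn v).indicator hK)
    calc (b * ‖V n y‖ₑ) ^ 6 ≤ _ := pow_le_pow_left' h1 6
      _ ≤ 2 ^ 6 * ((∫⁻ w in Metric.ball z ρ, ‖V n w‖ₑ) ^ 6
          + (ENNReal.ofReal h * segAvg h (G n) y) ^ 6) := ennreal_add_pow_le _ _ 6
      _ ≤ bound n y := by
          refine mul_le_mul' (by norm_num) (add_le_add ?_ le_rfl)
          calc (∫⁻ w in Metric.ball z ρ, ‖V n w‖ₑ) ^ 6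
              = ((∫⁻ w in Metric.ball z ρ, ‖V n w‖ₑ) ^ 2) ^ 3 := by ring
            _ ≤ _ := by gcongr
  have hUm : ∀ n, Measurable (U n) := fun n => by
    have m0 := (continuous_moll n v).enorm.measurable
    have m1 := measurable_segAvg h (hGm n)
    exact Measurable.min (by fun_prop) (by fun_prop)
  have hlim : ∀ᵐ y ∂(volume.restrict A), (b * ‖v y‖ₑ) ^ 6 ≤ liminf (fun n => U n y) atTop := by
    rw [ae_restrict_iff' hA]
    filter_upwards [ae_tendsto_moll (locallyIntegrable_indicator v)] with y hy hyA
    have e1 : (fun n => U n y) =ᶠ[atTop] fun n => (b * ‖V n y‖ₑ) ^ 6 := by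
      filter_upwards [hpt y hyA] with n hn using min_eq_left hn
    rw [liminf_congr e1]
    rw [indicator_of_mem (hAΩ hyA)] at hy
    have e2 : Tendsto (fun n => (b * ‖V n y‖ₑ) ^ 6) atTop (nhds ((b * ‖v y‖ₑ) ^ 6)) :=
      (ENNReal.continuous_pow 6).continuousAt.tendsto.comp
        (ENNReal.Tendsto.const_mul hy.enorm (Or.inr hbt))
    rw [e2.liminf_eq]
  have hUint : ∀ n, ∫⁻ y in A, U n y ≤ 64 * (b ^ 3 * volume A
      + ENNReal.ofReal h ^ 6 * (729 * B ^ 4 * 64)) * (NK + N₀ + N₁) ^ 3 := by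
    intro n
    calc ∫⁻ y in A, U n y ≤ ∫⁻ y in A, bound n y := lintegral_mono fun y => min_le_right _ _
      _ = 64 * ((b * NK) ^ 3 * volume A
          + ENNReal.ofReal h ^ 6 * ∫⁻ y in A, segAvg h (G n) y ^ 6) := by
          have m1 := measurable_segAvg h (hGm n)
          have e : ∫⁻ y in A, (ENNReal.ofReal h * segAvg h (G n) y) ^ 6
              = ENNReal.ofReal h ^ 6 * ∫⁻ y in A, segAvg h (G n) y ^ 6 := by
            simp only [mul_pow]
            exact lintegral_const_mul _ (by fun_prop)
          rw [lintegral_const_mul _ (by fun_prop), lintegral_add_left (by fun_prop), e,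
            lintegral_const, Measure.restrict_apply_univ]
      _ ≤ 64 * ((b * NK) ^ 3 * volume A
          + ENNReal.ofReal h ^ 6 * (729 * B ^ 4 * (4 * (N₀ + N₁)) ^ 3)) := by
          gcongr
          refine (setLIntegral_le_lintegral _ _).trans
            ((lintegral_segAvg_pow_six_le h (hGm n)).trans ?_)
          gcongr
          exact hG2 n
      _ = 64 * (b ^ 3 * volume A * NK ^ 3
          + ENNReal.ofReal h ^ 6 * (729 * B ^ 4 * 64) * (N₀ + N₁) ^ 3) := by ring
      _ ≤ 64 * (b ^ 3 * volume A * (NK + N₀ + N₁) ^ 3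
          + ENNReal.ofReal h ^ 6 * (729 * B ^ 4 * 64) * (NK + N₀ + N₁) ^ 3) := by
          gcongr
          · rw [add_assoc]; exact le_self_add
          · exact le_add_self
      _ = _ := by ring
  have hfatou : ∫⁻ y in A, (b * ‖v y‖ₑ) ^ 6 ≤ 64 * (b ^ 3 * volume A
      + ENNReal.ofReal h ^ 6 * (729 * B ^ 4 * 64)) * (NK + N₀ + N₁) ^ 3 :=
    calc ∫⁻ y in A, (b * ‖v y‖ₑ) ^ 6 ≤ ∫⁻ y in A, liminf (fun n => U n y) atTop :=
          lintegral_mono_ae hlim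
      _ ≤ liminf (fun n => ∫⁻ y in A, U n y) atTop := lintegral_liminf_le hUm
      _ ≤ _ := by
          refine liminf_le_of_le (by isBoundedDefault) fun c hc => ?_
          obtain ⟨n, hn⟩ := hc.exists
          exact hn.trans (hUint n)
  have hvm := measurable_coeFn v
  simp only [mul_pow] at hfatou
  rw [lintegral_const_mul _ (by fun_prop)] at hfatou
  have hb6 : b ^ 6 ≠ 0 := pow_ne_zero 6 hb0
  have hb6t : b ^ 6 ≠ ⊤ := ENNReal.pow_ne_top hbt
  calc ∫⁻ x in A, ‖v x‖ₑ ^ 6 = (b ^ 6)⁻¹ * (b ^ 6 * ∫⁻ x in A, ‖v x‖ₑ ^ 6) := by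
        rw [← mul_assoc, ENNReal.inv_mul_cancel hb6 hb6t, one_mul]
    _ ≤ _ := mul_le_mul' le_rfl hfatou
    _ = _ := by rw [← mul_assoc]

/-! ### Poincaré's inequality -/

/-- `∫_S v²`, as an extended nonnegative number. -/
def nsq (S : Set Plane) (v : L2 Ω) : ℝ≥0∞ := ∫⁻ x in S, ‖v x‖ₑ ^ 2

/-- `‖∇v‖²`, as an extended nonnegative number. -/
def gsq (v : L2 Ω) : ℝ≥0∞ := nsq (Ω : Set Plane) (pd Ω 0 v) + nsq (Ω : Set Plane) (pd Ω 1 v)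

theorem nsq_eq (v : L2 Ω) : nsq (Ω : Set Plane) v = ENNReal.ofReal (‖v‖ ^ 2) := by
  have h := ofReal_integral_eq_lintegral_ofReal
    (f := fun x => v x ^ 2) (μ := volume.restrict (Ω : Set Plane)) (Lp.memLp v).integrable_sq
    (Eventually.of_forall fun x => sq_nonneg _)
  rw [nsq, ← real_inner_self_eq_norm_sq, inner_eq_integral]
  simp only [← sq]
  rw [h]
  refine lintegral_congr fun x => ?_
  rw [← ofReal_norm, ← ENNReal.ofReal_pow (norm_nonneg _), Real.norm_eq_abs, sq_abs]

theorem gsq_eq (v : L2 Ω) : gsq v = ENNReal.ofReal (gradNormSq Ω v) := by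
  rw [gsq, nsq_eq, nsq_eq, ← ENNReal.ofReal_add (by positivity) (by positivity), gradNormSq,
    Fin.sum_univ_two]

theorem nsq_mono {S S' : Set Plane} (h : S ⊆ S') (v : L2 Ω) : nsq S v ≤ nsq S' v :=
  lintegral_mono_set h

/-- On functions in `H¹(Ω)`, the `L²`-norm on `A` is controlled by the `L²`-norm on `K` and by the
norm of the gradient. -/
def Controls (Ω : Opens Plane) (K A : Set Plane) : Prop :=
  ∃ C : ℝ≥0∞, C ≠ ⊤ ∧ ∀ v : L2 Ω, MemH1 Ω v → nsq A v ≤ C * (nsq K v + gsq v)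

theorem Controls.mono {K K' A A' : Set Plane} (h : Controls Ω K A) (hK : K ⊆ K') (hA : A' ⊆ A) :
    Controls Ω K' A' := by
  obtain ⟨C, hC, h⟩ := h
  refine ⟨C, hC, fun v hv => (nsq_mono hA v).trans ((h v hv).trans ?_)⟩
  gcongr
  exact nsq_mono hK v

theorem Controls.trans {K L A : Set Plane} (h : Controls Ω K L) (h' : Controls Ω L A) :
    Controls Ω K A := by
  obtain ⟨C, hC, h⟩ := h
  obtain ⟨C', hC', h'⟩ := h'
  refine ⟨C' * (C + 1), by finiteness, fun v hv => (h' v hv).trans ?_⟩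
  rw [mul_assoc]
  gcongr
  calc nsq L v + gsq v ≤ C * (nsq K v + gsq v) + (nsq K v + gsq v) :=
        add_le_add (h v hv) le_add_self
    _ = _ := by ring

theorem Controls.union {K A A' : Set Plane} (h : Controls Ω K A) (h' : Controls Ω K A') :
    Controls Ω K (A ∪ A') := by
  obtain ⟨C, hC, h⟩ := h
  obtain ⟨C', hC', h'⟩ := h'
  refine ⟨C + C', by finiteness, fun v hv => ?_⟩
  rw [add_mul]
  exact (lintegral_union_le _ _ _).trans (add_le_add (h v hv) (h' v hv))

theorem ennreal_le_of_pow_three_le {a b D : ℝ≥0∞} (h : a ^ 3 ≤ D * b ^ 3) : a ≤ (D + 1) * b := by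
  by_contra! hlt
  have h1 : ((D + 1) * b) ^ 3 < a ^ 3 := ENNReal.pow_lt_pow_left (by norm_num) hlt
  refine absurd h (not_le.2 (lt_of_le_of_lt ?_ h1))
  rw [mul_pow]
  gcongr
  calc D ≤ D + 1 := le_self_add
    _ ≤ (D + 1) ^ 3 := le_self_pow₀ le_add_self (by norm_num)

theorem lintegral_sq_le_of_pow_six_le {A : Set Plane} {f : Plane → ℝ≥0∞} (hf : Measurable f)
    {C b : ℝ≥0∞} (h : ∫⁻ x in A, f x ^ 6 ≤ C * b ^ 3) :
    ∫⁻ x in A, f x ^ 2 ≤ (volume A ^ 2 * C + 1) * b := by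
  refine ennreal_le_of_pow_three_le ?_
  have := lintegral_pow_le_measure_univ_pow_mul (volume.restrict A) (f := fun x => f x ^ 2)
    (by fun_prop) (n := 3) (by norm_num)
  refine this.trans ?_
  simp only [← pow_mul, Measure.restrict_apply_univ]
  norm_num
  rw [mul_assoc]
  gcongr

theorem SeesBalls.controls {A K : Set Plane} {ρ h : ℝ} (hs : SeesBalls Ω A K ρ h)
    (hρ : 0 < ρ) (hA : MeasurableSet A) (hAΩ : A ⊆ Ω) (hAfin : volume A ≠ ⊤)
    (hK : MeasurableSet K) (hKΩ : K ⊆ Ω) : Controls Ω K A := by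
  obtain ⟨C, hC, h⟩ := hs.lintegral_pow_six_le hρ hA hAΩ hAfin hK hKΩ
  refine ⟨volume A ^ 2 * C + 1, by finiteness, fun v hv => ?_⟩
  have hv' := measurable_coeFn v
  exact lintegral_sq_le_of_pow_six_le (by fun_prop) (by
    have := h v _ _ (hv.pd_spec 0) (hv.pd_spec 1)
    rwa [add_assoc] at this)

theorem seesBalls_ball {x x' : Plane} {R ρ : ℝ} (hx : Metric.ball x R ⊆ Ω) (hρ : 0 < ρ)
    (hx' : Metric.ball x' (2 * ρ) ⊆ Metric.ball x R) :
    SeesBalls Ω (Metric.ball x R) (Metric.ball x' (2 * ρ)) ρ (2 * R) := by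
  intro y hy
  refine ⟨x', subset_rfl, fun w hw => ?_, fun w hw s hs => ?_⟩
  · have h1 := hx' (Metric.ball_subset_ball (by linarith) hw)
    rw [Metric.mem_ball] at *
    have := dist_triangle_right w y x
    linarith
  · have h1 := hx' (Metric.closedBall_subset_ball (by linarith) hw)
    refine hx ?_
    have := (convex_ball x R).add_smul_sub_mem hy h1 hs
    exact this

theorem controls_ball {x x' : Plane} {R r : ℝ} (hx : Metric.ball x R ⊆ Ω) (hr : 0 < r)
    (hx' : x' ∈ Metric.ball x R) : Controls Ω (Metric.ball x' r) (Metric.ball x R) := by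
  have hd : 0 < R - dist x' x := by simpa using hx'
  set ρ := min r (R - dist x' x) / 2 with hρ
  have hρ0 : 0 < ρ := by have := lt_min hr hd; positivity
  have h2 : 2 * ρ = min r (R - dist x' x) := by rw [hρ]; ring
  have hsub : Metric.ball x' (2 * ρ) ⊆ Metric.ball x R := by
    refine Metric.ball_subset_ball' ?_
    have : 2 * ρ ≤ R - dist x' x := h2 ▸ min_le_right _ _
    linarith
  refine ((seesBalls_ball hx hρ0 hsub).controls hρ0 measurableSet_ball hx
    measure_ball_lt_top.ne measurableSet_ball (hsub.trans hx)).mono ?_ subset_rfl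
  exact Metric.ball_subset_ball (h2 ▸ min_le_left _ _)

/-- In a connected open set, a ball controls a neighbourhood of every point: the set of points
with this property is open and closed. -/
theorem exists_controls_ball (hconn : IsPreconnected (Ω : Set Plane)) {x₀ : Plane} {r₀ : ℝ}
    (hr₀ : 0 < r₀) (h₀ : Metric.ball x₀ r₀ ⊆ Ω) : ∀ x ∈ Ω, ∃ r, 0 < r ∧ Metric.ball x r ⊆ Ω ∧
      Controls Ω (Metric.ball x₀ r₀) (Metric.ball x r) := by
  set S : Set Plane := {x | ∃ r, 0 < r ∧ Metric.ball x r ⊆ Ω ∧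
      Controls Ω (Metric.ball x₀ r₀) (Metric.ball x r)} with hS
  have hx₀ : x₀ ∈ Ω := h₀ (Metric.mem_ball_self hr₀)
  have hSo : IsOpen S := by
    rw [Metric.isOpen_iff]
    rintro x ⟨r, hr, hsub, hc⟩
    refine ⟨r, hr, fun y hy => ?_⟩
    have hd : 0 < r - dist y x := by simpa using hy
    have hyx : Metric.ball y (r - dist y x) ⊆ Metric.ball x r :=
      Metric.ball_subset_ball' (by linarith)
    exact ⟨r - dist y x, hd, hyx.trans hsub, hc.mono subset_rfl hyx⟩
  have hne : ((Ω : Set Plane) ∩ S).Nonempty :=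
    ⟨x₀, hx₀, r₀, hr₀, h₀, controls_ball h₀ hr₀ (Metric.mem_ball_self hr₀)⟩
  refine fun x hx => hconn.subset_of_closure_inter_subset hSo hne ?_ hx
  rintro x ⟨hxc, hxΩ⟩
  obtain ⟨R, hR, hRΩ⟩ := Metric.isOpen_iff.1 Ω.isOpen x hxΩ
  obtain ⟨x', ⟨r, hr, -, hc⟩, hxx'⟩ := Metric.mem_closure_iff.1 hxc R hR
  refine ⟨R, hR, hRΩ, hc.trans (controls_ball hRΩ hr ?_)⟩
  rwa [Metric.mem_ball, dist_comm]

theorem controls_isCompact (hconn : IsPreconnected (Ω : Set Plane)) {x₀ : Plane} {r₀ : ℝ}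
    (hr₀ : 0 < r₀) (h₀ : Metric.ball x₀ r₀ ⊆ Ω) {K : Set Plane} (hK : IsCompact K)
    (hKΩ : K ⊆ Ω) : Controls Ω (Metric.ball x₀ r₀) K := by
  refine hK.induction_on (p := fun s => Controls Ω (Metric.ball x₀ r₀) s) ?_ ?_ ?_ ?_
  · exact ⟨0, by simp, fun v _ => by simp [nsq]⟩
  · exact fun s t hst ht => ht.mono subset_rfl hst
  · exact fun s t hs ht => hs.union ht
  · intro x hx
    obtain ⟨r, hr, -, hc⟩ := exists_controls_ball hconn hr₀ h₀ x (hKΩ hx)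
    exact ⟨_, mem_nhdsWithin_of_mem_nhds (Metric.ball_mem_nhds x hr), hc⟩

/-- In a domain with the cone condition, every point sees a ball that stays away from the
boundary: take a ball centred on the axis of the cone, at half its height. -/
theorem ConeCondition.seesBalls (h : ConeCondition Ω) : ∃ ρ h : ℝ, 0 < ρ ∧
    SeesBalls Ω Ω {y | Metric.ball y ρ ⊆ Ω} ρ h := by
  obtain ⟨h, hh, κ, hκ, hκ1, hcone⟩ := h
  set ρ := (1 - κ) * h / 12 with hρ
  have hρ0 : 0 < ρ := by have : 0 < 1 - κ := by linarith
                         positivity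
  refine ⟨ρ, h, hρ0, fun y hy => ?_⟩
  obtain ⟨e, he, hy'⟩ := hcone y hy
  set z := y + (h / 2) • e with hz
  have hρh : 3 * ρ ≤ h / 4 := by rw [hρ]; nlinarith
  -- points of the tripled ball lie in the cone, and so do the segments from the vertex to them
  have key : ∀ w, dist w z < 3 * ρ → ‖w - y‖ < h ∧ κ * ‖w - y‖ < inner ℝ e (w - y) := by
    intro w hw
    rw [dist_eq_norm] at hw
    have e1 : w - y = (h / 2) • e + (w - z) := by rw [hz]; abel
    have e2 : ‖w - y‖ < h / 2 + 3 * ρ := by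
      rw [e1]
      refine (norm_add_le _ _).trans_lt ?_
      rw [norm_smul, he, Real.norm_of_nonneg (by positivity)]
      linarith
    have e3 : h / 2 - 3 * ρ < inner ℝ e (w - y) := by
      rw [e1, inner_add_right, real_inner_smul_right, real_inner_self_eq_norm_sq, he]
      have := abs_real_inner_le_norm e (w - z)
      rw [he, one_mul] at this
      have := (abs_le.1 this).1
      linarith
    refine ⟨by linarith, ?_⟩
    have e4 : κ * ‖w - y‖ ≤ κ * (h / 2 + 3 * ρ) := by gcongr
    have e5 : 3 * ρ = (1 - κ) * h / 4 := by rw [hρ]; ring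
    have e6 : κ * (h / 2 + 3 * ρ) ≤ h / 2 - 3 * ρ := by
      rw [e5]; nlinarith [mul_pos (sub_pos.2 hκ1) hh]
    linarith
  have hmem : ∀ w, dist w z < 3 * ρ → ∀ s ∈ Ioc (0 : ℝ) 1, y + s • (w - y) ∈ Ω := by
    intro w hw s hs
    obtain ⟨k1, k2⟩ := key w hw
    have e1 : y + s • (w - y) - y = s • (w - y) := by abel
    refine hy' _ ?_ ?_
    · rw [e1, norm_smul, Real.norm_of_nonneg hs.1.le]
      calc s * ‖w - y‖ ≤ 1 * ‖w - y‖ := by gcongr; exact hs.2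
        _ < h := by linarith
    · rw [e1, norm_smul, Real.norm_of_nonneg hs.1.le, real_inner_smul_right]
      nlinarith [hs.1]
  refine ⟨z, fun w hw x hx => ?_, fun w hw => ?_, fun w hw s hs => ?_⟩
  · have := hmem x (by
      rw [Metric.mem_ball] at hw hx
      linarith [dist_triangle x w z]) 1 ⟨one_pos, le_rfl⟩
    simpa using this
  · rw [Metric.mem_ball, dist_eq_norm]
    exact (key w (by rw [Metric.mem_ball] at hw; linarith)).1
  · rcases hs.1.eq_or_lt with h0 | h0
    · rw [← h0]; simpa using hy
    · exact hmem w (by rw [Metric.mem_closedBall] at hw; linarith) s ⟨h0, hs.2⟩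

theorem isClosed_ball_subset (ρ : ℝ) : IsClosed {y | Metric.ball y ρ ⊆ (Ω : Set Plane)} := by
  rw [← isOpen_compl_iff, Metric.isOpen_iff]
  intro y hy
  obtain ⟨x, hx, hxΩ⟩ := Set.not_subset.1 hy
  rw [Metric.mem_ball] at hx
  refine ⟨ρ - dist x y, by linarith, fun y' hy' h => hxΩ (h ?_)⟩
  rw [Metric.mem_ball] at *
  linarith [dist_triangle x y y', dist_comm y y']

theorem volume_ne_top (hbdd : Bornology.IsBounded (Ω : Set Plane)) :
    volume (Ω : Set Plane) ≠ ⊤ := hbdd.measure_lt_top.ne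

/-- **Sobolev's embedding** `H¹(Ω) ⊆ L⁶(Ω)`. -/
theorem exists_sobolev (hbdd : Bornology.IsBounded (Ω : Set Plane)) (hcone : ConeCondition Ω) :
    ∃ C : ℝ≥0∞, C ≠ ⊤ ∧ ∀ v : L2 Ω, MemH1 Ω v →
      ∫⁻ x in (Ω : Set Plane), ‖v x‖ₑ ^ 6 ≤ C * (nsq (Ω : Set Plane) v + gsq v) ^ 3 := by
  obtain ⟨ρ, h, hρ, hs⟩ := hcone.seesBalls
  have hKΩ : {y | Metric.ball y ρ ⊆ (Ω : Set Plane)} ⊆ Ω :=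
    fun y hy => hy (Metric.mem_ball_self hρ)
  obtain ⟨C, hC, hC'⟩ := hs.lintegral_pow_six_le hρ Ω.isOpen.measurableSet subset_rfl
    (volume_ne_top hbdd) (isClosed_ball_subset ρ).measurableSet hKΩ
  refine ⟨C, hC, fun v hv => (hC' v _ _ (hv.pd_spec 0) (hv.pd_spec 1)).trans ?_⟩
  rw [add_assoc]
  gcongr
  · exact nsq_mono hKΩ v
  · exact le_rfl

theorem controls_domain (hconn : IsConnected (Ω : Set Plane))
    (hbdd : Bornology.IsBounded (Ω : Set Plane)) (hcone : ConeCondition Ω) {x₀ : Plane} {r₀ : ℝ}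
    (hr₀ : 0 < r₀) (h₀ : Metric.ball x₀ r₀ ⊆ Ω) : Controls Ω (Metric.ball x₀ r₀) Ω := by
  obtain ⟨ρ, h, hρ, hs⟩ := hcone.seesBalls
  have hKΩ : {y | Metric.ball y ρ ⊆ (Ω : Set Plane)} ⊆ Ω :=
    fun y hy => hy (Metric.mem_ball_self hρ)
  have hKc : IsCompact {y | Metric.ball y ρ ⊆ (Ω : Set Plane)} :=
    Metric.isCompact_of_isClosed_isBounded (isClosed_ball_subset ρ) (hbdd.subset hKΩ)
  exact (controls_isCompact hconn.isPreconnected hr₀ h₀ hKc hKΩ).trans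
    (hs.controls hρ Ω.isOpen.measurableSet subset_rfl (volume_ne_top hbdd)
      hKc.isClosed.measurableSet hKΩ)

/-- Poincaré's inequality on a ball that is compactly contained in `Ω`. -/
theorem exists_nsq_ball_sub_le {z : Plane} {ρ : ℝ} (hρ : 0 < ρ)
    (hz : Metric.closedBall z ρ ⊆ Ω) : ∃ C : ℝ≥0∞, C ≠ ⊤ ∧ ∀ v : L2 Ω, MemH1 Ω v →
      ∃ c : ℝ, ∫⁻ x in Metric.ball z ρ, ‖v x - c‖ₑ ^ 2 ≤ C * gsq v := by
  set b := volume (Metric.ball z ρ) with hb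
  have hb0 : b ≠ 0 := (Metric.measure_ball_pos volume _ hρ).ne'
  have hbt : b ≠ ⊤ := measure_ball_lt_top.ne
  set B := volume (Metric.ball (0 : Plane) (2 * ρ)) with hB
  have hBt : B ≠ ⊤ := measure_ball_lt_top.ne
  set D := ENNReal.ofReal (2 * ρ) ^ 6 * (729 * B ^ 4 * 64) with hD
  refine ⟨(b ^ 2)⁻¹ * (b ^ 2 * D + 1), ENNReal.mul_ne_top
    (ENNReal.inv_ne_top.2 (pow_ne_zero 2 hb0)) (by finiteness), ?_⟩
  intro v hv
  have h₀ := hv.pd_spec 0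
  have h₁ := hv.pd_spec 1
  let G : ℕ → Plane → ℝ≥0∞ := fun n => gradMoll n (pd Ω 0 v) (pd Ω 1 v)
  let V : ℕ → Plane → ℝ := fun n => moll (bump n) ((Ω : Set Plane).indicator v)
  have hGm : ∀ n, Measurable (G n) := fun n => measurable_gradMoll n _ _
  have hVc : ∀ n, Continuous (V n) := fun n => continuous_moll n v
  obtain ⟨δ, hδ, hδs⟩ := (isCompact_closedBall z ρ).exists_cthickening_subset_open Ω.isOpen hz
  have hev : ∀ᶠ n in atTop, ∀ y ∈ Metric.ball z ρ, (∫⁻ w in Metric.ball z ρ, ‖V n w - V n y‖ₑ)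
      ≤ ENNReal.ofReal (2 * ρ) * segAvg (2 * ρ) (G n) y := by
    filter_upwards [tendsto_bump_rOut.eventually_lt_const hδ] with n hn y hy
    refine lintegral_enorm_sub_le ((contDiff_moll (bump n)
      (locallyIntegrable_indicator v)).of_le (by exact_mod_cast le_top)) (hGm n) ?_ ?_
    · intro w hw
      rw [Metric.mem_ball] at *
      linarith [dist_triangle_right w y z]
    · intro w hw s hs
      refine enorm_fderiv_moll_le h₀ h₁ (Subset.trans (fun x hx => ?_) hδs)
      refine Metric.mem_cthickening_of_dist_le x (y + s ^ 3 • (w - y)) _ _ ?_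
        ((Metric.mem_closedBall.1 hx).trans hn.le)
      exact (convex_closedBall z ρ).add_smul_sub_mem (Metric.ball_subset_closedBall hy)
        (Metric.ball_subset_closedBall hw)
        ⟨pow_nonneg hs.1.le 3, pow_le_one₀ hs.1.le hs.2.le⟩
  have hint : ∀ᶠ n in atTop, ∫⁻ y in Metric.ball z ρ,
      (∫⁻ w in Metric.ball z ρ, ‖V n w - V n y‖ₑ) ^ 6 ≤ D * gsq v ^ 3 := by
    filter_upwards [hev] with n hn
    calc ∫⁻ y in Metric.ball z ρ, (∫⁻ w in Metric.ball z ρ, ‖V n w - V n y‖ₑ) ^ 6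
        ≤ ∫⁻ y in Metric.ball z ρ, (ENNReal.ofReal (2 * ρ) * segAvg (2 * ρ) (G n) y) ^ 6 :=
          setLIntegral_mono' measurableSet_ball fun y hy => pow_le_pow_left' (hn y hy) 6
      _ ≤ ∫⁻ y, (ENNReal.ofReal (2 * ρ) * segAvg (2 * ρ) (G n) y) ^ 6 :=
          setLIntegral_le_lintegral _ _
      _ = ENNReal.ofReal (2 * ρ) ^ 6 * ∫⁻ y, segAvg (2 * ρ) (G n) y ^ 6 := by
          have m1 := measurable_segAvg (2 * ρ) (hGm n)
          simp only [mul_pow]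
          rw [lintegral_const_mul _ (by fun_prop)]
      _ ≤ ENNReal.ofReal (2 * ρ) ^ 6 * (729 * B ^ 4 * (4 * gsq v) ^ 3) := by
          gcongr
          refine (lintegral_segAvg_pow_six_le (2 * ρ) (hGm n)).trans ?_
          gcongr
          exact lintegral_gradMoll_sq_le n _ _
      _ = _ := by rw [hD]; ring
  have hBΩ : Metric.ball z ρ ⊆ (Ω : Set Plane) := Metric.ball_subset_closedBall.trans hz
  have hae : ∀ᵐ x ∂(volume.restrict (Metric.ball z ρ)),
      Tendsto (fun n => V n x) atTop (nhds (v x)) := by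
    rw [ae_restrict_iff' measurableSet_ball]
    filter_upwards [ae_tendsto_moll (locallyIntegrable_indicator v)] with x hx hxB
    rwa [indicator_of_mem (hBΩ hxB)] at hx
  have hfin : ∫⁻ y in Metric.ball z ρ, (∫⁻ w in Metric.ball z ρ, ‖v w - v y‖ₑ) ^ 6
      ≤ D * gsq v ^ 3 := by
    have hm : ∀ n, Measurable fun y => (∫⁻ w in Metric.ball z ρ, ‖V n w - V n y‖ₑ) ^ 6 := by
      intro n
      have hVc' := hVc n
      refine Measurable.pow_const (Measurable.lintegral_prod_right'
        (f := fun p : Plane × Plane => ‖V n p.2 - V n p.1‖ₑ) ?_) 6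
      fun_prop
    calc ∫⁻ y in Metric.ball z ρ, (∫⁻ w in Metric.ball z ρ, ‖v w - v y‖ₑ) ^ 6
        ≤ ∫⁻ y in Metric.ball z ρ, liminf (fun n =>
            (∫⁻ w in Metric.ball z ρ, ‖V n w - V n y‖ₑ) ^ 6) atTop := by
          refine lintegral_mono_ae ?_
          filter_upwards [hae] with y hy
          have e1 : (∫⁻ w in Metric.ball z ρ, ‖v w - v y‖ₑ)
              ≤ liminf (fun n => ∫⁻ w in Metric.ball z ρ, ‖V n w - V n y‖ₑ) atTop :=
            calc (∫⁻ w in Metric.ball z ρ, ‖v w - v y‖ₑ)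
                ≤ ∫⁻ w in Metric.ball z ρ, liminf (fun n => ‖V n w - V n y‖ₑ) atTop := by
                  refine lintegral_mono_ae ?_
                  filter_upwards [hae] with w hw
                  rw [((hw.sub hy).enorm).liminf_eq]
              _ ≤ _ := lintegral_liminf_le fun n => by
                  have hVc' := hVc n
                  fun_prop
          refine (pow_le_pow_left' e1 6).trans (le_of_eq ?_)
          have hmono : Monotone fun x : ℝ≥0∞ => x ^ 6 := fun a b hab => pow_le_pow_left' hab 6
          exact hmono.map_liminf_of_continuousAt _ (ENNReal.continuous_pow 6).continuousAt
      _ ≤ liminf (fun n => ∫⁻ y in Metric.ball z ρ,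
            (∫⁻ w in Metric.ball z ρ, ‖V n w - V n y‖ₑ) ^ 6) atTop := lintegral_liminf_le hm
      _ ≤ _ := by
          refine liminf_le_of_le (by isBoundedDefault) fun c hc => ?_
          obtain ⟨n, hn1, hn2⟩ := (hc.and hint).exists
          exact hn1.trans hn2
  have hvm := measurable_coeFn v
  have hvint : IntegrableOn v (Metric.ball z ρ) := by
    have h2 : MemLp v 2 (volume.restrict (Metric.ball z ρ)) :=
      (Lp.memLp v).mono_measure (Measure.restrict_mono hBΩ le_rfl)
    have : IsFiniteMeasure (volume.restrict (Metric.ball z ρ)) :=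
      ⟨by rw [Measure.restrict_apply_univ]; exact measure_ball_lt_top⟩
    exact h2.integrable (by norm_num)
  set c := (b.toReal)⁻¹ * ∫ w in Metric.ball z ρ, v w with hc
  have hbr : b.toReal ≠ 0 := ENNReal.toReal_ne_zero.2 ⟨hb0, hbt⟩
  have hpt : ∀ y, b * ‖v y - c‖ₑ ≤ ∫⁻ w in Metric.ball z ρ, ‖v w - v y‖ₑ := by
    intro y
    have e1 : ∫ w in Metric.ball z ρ, (v w - v y) = - (b.toReal * (v y - c)) := by
      rw [integral_sub hvint (integrableOn_const hbt), integral_const, hc, smul_eq_mul,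
        measureReal_restrict_apply_univ, Measure.real, ← hb]
      field_simp
      ring
    calc b * ‖v y - c‖ₑ = ‖∫ w in Metric.ball z ρ, (v w - v y)‖ₑ := by
          rw [e1, enorm_neg, enorm_mul, Real.enorm_eq_ofReal ENNReal.toReal_nonneg,
            ENNReal.ofReal_toReal hbt]
      _ ≤ _ := enorm_integral_le_lintegral_enorm _
  refine ⟨c, ?_⟩
  have h6 : ∫⁻ y in Metric.ball z ρ, (b * ‖v y - c‖ₑ) ^ 6 ≤ D * gsq v ^ 3 :=
    (lintegral_mono fun y => pow_le_pow_left' (hpt y) 6).trans hfin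
  have h2 := lintegral_sq_le_of_pow_six_le (f := fun y => b * ‖v y - c‖ₑ) (by fun_prop) h6
  simp only [mul_pow] at h2
  rw [lintegral_const_mul _ (by fun_prop), ← hb] at h2
  calc ∫⁻ x in Metric.ball z ρ, ‖v x - c‖ₑ ^ 2
      = (b ^ 2)⁻¹ * (b ^ 2 * ∫⁻ x in Metric.ball z ρ, ‖v x - c‖ₑ ^ 2) := by
        rw [← mul_assoc, ENNReal.inv_mul_cancel (pow_ne_zero 2 hb0) (ENNReal.pow_ne_top hbt),
          one_mul]
    _ ≤ _ := mul_le_mul' le_rfl h2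
    _ = _ := by rw [← mul_assoc]

/-- The constant function `c` as an element of `L²(Ω)`. -/
def constL2 (hbdd : Bornology.IsBounded (Ω : Set Plane)) (c : ℝ) : L2 Ω :=
  haveI : IsFiniteMeasure (volume.restrict (Ω : Set Plane)) :=
    ⟨by rw [Measure.restrict_apply_univ]; exact hbdd.measure_lt_top⟩
  (memLp_const c).toLp (fun _ => c)

theorem coeFn_constL2 (hbdd : Bornology.IsBounded (Ω : Set Plane)) (c : ℝ) :
    constL2 hbdd c =ᵐ[volume.restrict (Ω : Set Plane)] fun _ => c := MemLp.coeFn_toLp _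

theorem isWeakPD_constL2 (hbdd : Bornology.IsBounded (Ω : Set Plane)) (c : ℝ) (i : Fin 2) :
    IsWeakPD Ω i (constL2 hbdd c) 0 := by
  rw [isWeakPD_iff]
  intro χ
  rw [inner_tf, inner_zero_left, neg_zero]
  calc ∫ x in (Ω : Set Plane), constL2 hbdd c x * dtf i χ x
      = ∫ x in (Ω : Set Plane), c * dtf i χ x := by
        refine integral_congr_ae ?_
        filter_upwards [coeFn_constL2 hbdd c] with x hx
        rw [hx]
    _ = ∫ x, c * cpd i χ x := setIntegral_mul_testFunction (fun _ => c) (dtf i χ)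
    _ = 0 := by
        rw [integral_cpd_mul i contDiff_const (contDiff_one_testFunction χ) χ.hasCompactSupport]
        simp [cpd]

theorem memH1_constL2 (hbdd : Bornology.IsBounded (Ω : Set Plane)) (c : ℝ) :
    MemH1 Ω (constL2 hbdd c) := fun i => ⟨0, isWeakPD_constL2 hbdd c i⟩

theorem pd_constL2 (hbdd : Bornology.IsBounded (Ω : Set Plane)) (c : ℝ) (i : Fin 2) :
    pd Ω i (constL2 hbdd c) = 0 := (isWeakPD_constL2 hbdd c i).pd_eq

theorem inner_constL2 (hbdd : Bornology.IsBounded (Ω : Set Plane)) (v : L2 Ω) (c : ℝ) :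
    inner ℝ v (constL2 hbdd c) = c * ∫ x in (Ω : Set Plane), v x := by
  rw [inner_eq_integral, ← integral_const_mul]
  refine integral_congr_ae ?_
  filter_upwards [coeFn_constL2 hbdd c] with x hx
  rw [hx, mul_comm]

/-- **Poincaré's inequality** for functions of mean zero. -/
theorem exists_poincare (hconn : IsConnected (Ω : Set Plane))
    (hbdd : Bornology.IsBounded (Ω : Set Plane)) (hcone : ConeCondition Ω) :
    ∃ C : ℝ, 0 ≤ C ∧ ∀ v : L2 Ω, MemH1 Ω v → ∫ x in (Ω : Set Plane), v x = 0 →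
      ‖v‖ ^ 2 ≤ C * gradNormSq Ω v := by
  obtain ⟨z, hz⟩ := hconn.nonempty
  obtain ⟨r, hr, hrΩ⟩ := Metric.isOpen_iff.1 Ω.isOpen z hz
  have hcb : Metric.closedBall z (r / 2) ⊆ (Ω : Set Plane) :=
    (Metric.closedBall_subset_ball (by linarith)).trans hrΩ
  have hr2 : 0 < r / 2 := by positivity
  obtain ⟨C₁, hC₁, h₁⟩ := exists_nsq_ball_sub_le hr2 hcb
  obtain ⟨C₂, hC₂, h₂⟩ := controls_domain hconn hbdd hcone hr2
    (Metric.ball_subset_closedBall.trans hcb)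
  refine ⟨(C₂ * (C₁ + 1)).toReal, ENNReal.toReal_nonneg, fun v hv hmean => ?_⟩
  obtain ⟨c, hc⟩ := h₁ v hv
  set u := v - constL2 hbdd c with hu
  have hu1 : MemH1 Ω u := hv.sub (memH1_constL2 hbdd c)
  have hpd : ∀ i, pd Ω i u = pd Ω i v := fun i => by
    rw [hu, pd_sub hv (memH1_constL2 hbdd c), pd_constL2, sub_zero]
  have hg : gsq u = gsq v := by rw [gsq, gsq, hpd, hpd]
  have hub : nsq (Metric.ball z (r / 2)) u ≤ C₁ * gsq v := by
    refine le_trans (le_of_eq ?_) hc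
    refine lintegral_congr_ae ?_
    have hsub : Metric.ball z (r / 2) ⊆ (Ω : Set Plane) := Metric.ball_subset_closedBall.trans hcb
    refine ae_mono (Measure.restrict_mono hsub le_rfl) ?_
    filter_upwards [Lp.coeFn_sub v (constL2 hbdd c), coeFn_constL2 hbdd c] with x h1 h2
    rw [h1, Pi.sub_apply, h2]
  have h3 : nsq (Ω : Set Plane) u ≤ C₂ * (C₁ + 1) * gsq v := by
    refine (h₂ u hu1).trans ?_
    rw [mul_assoc, hg, add_mul, one_mul]
    gcongr
  have h4 : ‖u‖ ^ 2 ≤ (C₂ * (C₁ + 1)).toReal * gradNormSq Ω v := by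
    rw [nsq_eq, gsq_eq, ← ENNReal.ofReal_toReal (a := C₂ * (C₁ + 1)) (by finiteness),
      ← ENNReal.ofReal_mul ENNReal.toReal_nonneg] at h3
    refine (ENNReal.ofReal_le_ofReal_iff ?_).1 h3
    exact mul_nonneg ENNReal.toReal_nonneg (Finset.sum_nonneg fun i _ => by positivity)
  -- subtracting a constant from a function of mean zero increases the norm
  refine le_trans ?_ h4
  rw [hu, norm_sub_sq_real, inner_constL2, hmean]
  nlinarith [sq_nonneg ‖constL2 hbdd c‖]

/-! ### An abstract coupled variational problem -/

section Coupled

variable {V W : Type*} [NormedAddCommGroup V] [InnerProductSpace ℝ V]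
  [NormedAddCommGroup W] [InnerProductSpace ℝ W]

variable (V W) in
/-- The Hilbert space of the unknowns `(φ, μ, w, r, q)` of the coupled problem. -/
abbrev CoupledSpace : Type _ :=
  WithLp 2 (V × WithLp 2 (V × WithLp 2 (W × WithLp 2 (ℝ × ℝ))))

namespace CoupledSpace

variable (V W) in
/-- The component `φ`. -/
def pφ : CoupledSpace V W →L[ℝ] V := WithLp.fstL 2 ℝ _ _

variable (V W) in
/-- The component `μ`. -/
def pμ : CoupledSpace V W →L[ℝ] V := (WithLp.fstL 2 ℝ _ _).comp (WithLp.sndL 2 ℝ _ _)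

variable (V W) in
/-- The component `w`. -/
def pw : CoupledSpace V W →L[ℝ] W :=
  (WithLp.fstL 2 ℝ _ _).comp ((WithLp.sndL 2 ℝ _ _).comp (WithLp.sndL 2 ℝ _ _))

variable (V W) in
/-- The component `r`. -/
def pr : CoupledSpace V W →L[ℝ] ℝ := (WithLp.fstL 2 ℝ _ _).comp
  ((WithLp.sndL 2 ℝ _ _).comp ((WithLp.sndL 2 ℝ _ _).comp (WithLp.sndL 2 ℝ _ _)))

variable (V W) in
/-- The component `q`. -/
def pq : CoupledSpace V W →L[ℝ] ℝ := (WithLp.sndL 2 ℝ _ _).comp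
  ((WithLp.sndL 2 ℝ _ _).comp ((WithLp.sndL 2 ℝ _ _).comp (WithLp.sndL 2 ℝ _ _)))

/-- The element of the coupled space with the given components. -/
def tuple (φ μ : V) (w : W) (r q : ℝ) : CoupledSpace V W :=
  WithLp.toLp 2 (φ, WithLp.toLp 2 (μ, WithLp.toLp 2 (w, WithLp.toLp 2 (r, q))))

variable (φ μ : V) (w : W) (r q : ℝ)

@[simp] theorem pφ_tuple : pφ V W (tuple φ μ w r q) = φ := rfl
@[simp] theorem pμ_tuple : pμ V W (tuple φ μ w r q) = μ := rfl
@[simp] theorem pw_tuple : pw V W (tuple φ μ w r q) = w := rfl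
@[simp] theorem pr_tuple : pr V W (tuple φ μ w r q) = r := rfl
@[simp] theorem pq_tuple : pq V W (tuple φ μ w r q) = q := rfl

theorem norm_sq (x : CoupledSpace V W) : ‖x‖ ^ 2 = ‖pφ V W x‖ ^ 2 + ‖pμ V W x‖ ^ 2
    + ‖pw V W x‖ ^ 2 + pr V W x ^ 2 + pq V W x ^ 2 := by
  rw [WithLp.prod_norm_sq_eq_of_L2, WithLp.prod_norm_sq_eq_of_L2, WithLp.prod_norm_sq_eq_of_L2,
    WithLp.prod_norm_sq_eq_of_L2, Real.norm_eq_abs, Real.norm_eq_abs, sq_abs, sq_abs]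
  simp only [← add_assoc]
  rfl

end CoupledSpace

open CoupledSpace

/-- The coefficients of the coupled problem: the forms `m` and `g` stand for `(·,·)` and `(∇·,∇·)`,
the form `a` for the elliptic operator of the velocity equation, and the functionals `A`, `D`, `Fo`,
`Tr` for advection of the phase, `F'`, capillary force and convection, all at extrapolated fields.
The numbers `κ` and `e` stand for the factors `1 / √(E₁ + δ)` and `exp (t / T)`. -/
structure CoupledData (V W : Type*) [NormedAddCommGroup V] [InnerProductSpace ℝ V]
    [NormedAddCommGroup W] [InnerProductSpace ℝ W] where
  m : V →L[ℝ] V →L[ℝ] ℝ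
  g : V →L[ℝ] V →L[ℝ] ℝ
  a : W →L[ℝ] W →L[ℝ] ℝ
  A : V →L[ℝ] ℝ
  D : V →L[ℝ] ℝ
  Fo : W →L[ℝ] ℝ
  Tr : W →L[ℝ] ℝ
  α : ℝ
  γ : ℝ
  M : ℝ
  τ : ℝ
  κ : ℝ
  e : ℝ
  c : ℝ
  m_symm : ∀ v w, m v w = m w v
  m_nonneg : ∀ v, 0 ≤ m v v
  g_nonneg : ∀ v, 0 ≤ g v v
  norm_sq_le : ∀ v, ‖v‖ ^ 2 ≤ m v v + g v v
  a_coercive : ∀ w, c * ‖w‖ ^ 2 ≤ a w w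
  α_pos : 0 < α
  γ_pos : 0 < γ
  M_pos : 0 < M
  τ_pos : 0 < τ
  c_pos : 0 < c

namespace CoupledData

variable (d : CoupledData V W)

/-- The bilinear form of the coupled problem. The equation for `φ` is tested with `χ`, the one for
`μ` with `αψ - βχ`, the scalar ones with `2s` and `p`; for `β = 0` all coupling terms cancel on the
diagonal, and a small `β > 0` adds control of the mean of `μ`. -/
def form (β : ℝ) : CoupledSpace V W →L[ℝ] CoupledSpace V W →L[ℝ] ℝ :=
  d.α • d.m.bilinearComp (pφ V W) (pμ V W) + d.κ • (pr V W).smulRight (d.A.comp (pμ V W))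
    + d.M • d.g.bilinearComp (pμ V W) (pμ V W)
    + (d.g.bilinearComp (pφ V W) (d.α • pφ V W - β • pμ V W)
      + d.γ • d.m.bilinearComp (pφ V W) (d.α • pφ V W - β • pμ V W)
      + d.κ • (pr V W).smulRight (d.D.comp (d.α • pφ V W - β • pμ V W))
      - d.m.bilinearComp (pμ V W) (d.α • pφ V W - β • pμ V W))
    + (d.α • pr V W - (d.κ / 2) • (d.α • d.D.comp (pφ V W) + d.A.comp (pμ V W)
        - d.Fo.comp (pw V W))).smulRight ((2 : ℝ) • pr V W)
    + (d.a.bilinearComp (pw V W) (pw V W) + d.e • (pq V W).smulRight (d.Tr.comp (pw V W))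
      - d.κ • (pr V W).smulRight (d.Fo.comp (pw V W)))
    + (d.τ • pq V W - d.e • d.Tr.comp (pw V W)).smulRight (pq V W)

theorem form_apply (β : ℝ) (x y : CoupledSpace V W) : d.form β x y =
    (d.α * d.m (pφ V W x) (pμ V W y) + pr V W x * d.κ * d.A (pμ V W y)
      + d.M * d.g (pμ V W x) (pμ V W y))
    + (d.g (pφ V W x) (d.α • pφ V W y - β • pμ V W y)
      + d.γ * d.m (pφ V W x) (d.α • pφ V W y - β • pμ V W y)
      + pr V W x * d.κ * d.D (d.α • pφ V W y - β • pμ V W y)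
      - d.m (pμ V W x) (d.α • pφ V W y - β • pμ V W y))
    + 2 * pr V W y * (d.α * pr V W x - d.κ / 2 * (d.α * d.D (pφ V W x) + d.A (pμ V W x)
        - d.Fo (pw V W x)))
    + (d.a (pw V W x) (pw V W y) + d.e * pq V W x * d.Tr (pw V W y)
      - pr V W x * d.κ * d.Fo (pw V W y))
    + pq V W y * (d.τ * pq V W x - d.e * d.Tr (pw V W x)) := by
  simp only [form, add_apply, sub_apply,
    smul_apply, ContinuousLinearMap.bilinearComp_apply,
    ContinuousLinearMap.smulRight_apply, ContinuousLinearMap.comp_apply, smul_eq_mul]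
  ring

/-- A bound for the terms that the perturbation by `β` leaves uncancelled. -/
def L : ℝ := ‖d.g‖ + d.γ * ‖d.m‖ + |d.κ| * ‖d.D‖

/-- A perturbation parameter for which the form is coercive. -/
def β : ℝ := min d.M (min (d.α * min 1 d.γ / 2) d.α / (d.L ^ 2 + 1))

theorem β_pos : 0 < d.β := by
  have h1 := d.M_pos
  have h2 := d.α_pos
  have h3 := lt_min one_pos d.γ_pos
  have h4 : 0 < min (d.α * min 1 d.γ / 2) d.α := lt_min (by positivity) h2
  exact lt_min h1 (by positivity)

theorem β_mul_le : d.β * d.L ^ 2 ≤ min (d.α * min 1 d.γ / 2) d.α := by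
  have h0 := d.β_pos
  have h1 : d.β ≤ min (d.α * min 1 d.γ / 2) d.α / (d.L ^ 2 + 1) := min_le_right _ _
  rw [le_div_iff₀ (by positivity)] at h1
  nlinarith

theorem isCoercive_form : IsCoercive (d.form d.β) := by
  have hβ := d.β_pos
  have hα := d.α_pos
  have hγ1 := lt_min one_pos d.γ_pos
  set a₁ := d.α * min 1 d.γ / 2 with ha₁
  have ha₁0 : 0 < a₁ := by positivity
  set C := min (d.β / 2) (min a₁ (min d.α (min d.c d.τ))) with hC
  have hC0 : 0 < C := lt_min (by positivity) (lt_min ha₁0 (lt_min hα (lt_min d.c_pos d.τ_pos)))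
  have c1 : C ≤ d.β / 2 := min_le_left _ _
  have c2 : C ≤ a₁ := (min_le_right _ _).trans (min_le_left _ _)
  have c3 : C ≤ d.α := (min_le_right _ _).trans ((min_le_right _ _).trans (min_le_left _ _))
  have c4 : C ≤ d.c := (min_le_right _ _).trans
    ((min_le_right _ _).trans ((min_le_right _ _).trans (min_le_left _ _)))
  have c5 : C ≤ d.τ := (min_le_right _ _).trans
    ((min_le_right _ _).trans ((min_le_right _ _).trans (min_le_right _ _)))
  refine ⟨C, hC0, fun x => ?_⟩
  rw [mul_assoc, ← sq, norm_sq, form_apply]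
  generalize pφ V W x = φ
  generalize pμ V W x = μ
  generalize pw V W x = w
  generalize pr V W x = r
  generalize pq V W x = q
  simp only [map_sub, map_smul, smul_eq_mul]
  have hL1 : d.β * (d.g φ μ + d.γ * d.m φ μ + r * d.κ * d.D μ)
      ≤ d.β * (‖μ‖ ^ 2 / 2 + d.L ^ 2 * (‖φ‖ ^ 2 + r ^ 2)) := by
    refine mul_le_mul_of_nonneg_left ?_ hβ.le
    have b1 : d.g φ μ ≤ ‖d.g‖ * ‖φ‖ * ‖μ‖ := (le_abs_self _).trans (d.g.le_opNorm₂ φ μ)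
    have b2 : d.m φ μ ≤ ‖d.m‖ * ‖φ‖ * ‖μ‖ := (le_abs_self _).trans (d.m.le_opNorm₂ φ μ)
    have b3 : r * d.κ * d.D μ ≤ |r| * |d.κ| * (‖d.D‖ * ‖μ‖) := by
      refine (le_abs_self _).trans ?_
      rw [abs_mul, abs_mul]
      gcongr
      exact d.D.le_opNorm μ
    have hγ := d.γ_pos
    have b4 : d.γ * d.m φ μ ≤ d.γ * (‖d.m‖ * ‖φ‖ * ‖μ‖) := by gcongr
    have b5 : ‖d.g‖ * ‖φ‖ * ‖μ‖ + d.γ * (‖d.m‖ * ‖φ‖ * ‖μ‖) + |r| * |d.κ| * (‖d.D‖ * ‖μ‖)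
        ≤ d.L * (‖φ‖ * ‖μ‖) + d.L * (|r| * ‖μ‖) := by
      have n1 : 0 ≤ |d.κ| * ‖d.D‖ * (‖φ‖ * ‖μ‖) := by positivity
      have n2 : 0 ≤ (‖d.g‖ + d.γ * ‖d.m‖) * (|r| * ‖μ‖) := by positivity
      unfold L
      linarith
    have s1 := sq_nonneg (‖μ‖ / 2 - d.L * ‖φ‖)
    have s2 := sq_nonneg (‖μ‖ / 2 - d.L * |r|)
    rw [← sq_abs r]
    linarith
  have hL2 := d.β_mul_le
  have hL3 : d.β * d.L ^ 2 ≤ a₁ := hL2.trans (min_le_left _ _)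
  have hL4 : d.β * d.L ^ 2 ≤ d.α := hL2.trans (min_le_right _ _)
  have hμ : d.β * ‖μ‖ ^ 2 ≤ d.M * d.g μ μ + d.β * d.m μ μ := by
    have h1 : d.β ≤ d.M := min_le_left _ _
    have := mul_le_mul_of_nonneg_left (d.norm_sq_le μ) hβ.le
    have := mul_le_mul_of_nonneg_right h1 (d.g_nonneg μ)
    linarith
  have hφ : 2 * a₁ * ‖φ‖ ^ 2 ≤ d.α * (d.g φ φ + d.γ * d.m φ φ) := by
    have e : 2 * a₁ = d.α * min 1 d.γ := by rw [ha₁]; ring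
    rw [e, mul_assoc]
    refine mul_le_mul_of_nonneg_left ?_ hα.le
    have h1 := mul_le_mul_of_nonneg_left (d.norm_sq_le φ) hγ1.le
    have h2 := mul_le_mul_of_nonneg_right (min_le_left 1 d.γ) (d.g_nonneg φ)
    have h3 := mul_le_mul_of_nonneg_right (min_le_right 1 d.γ) (d.m_nonneg φ)
    linarith
  have hw := d.a_coercive w
  have f1 := mul_le_mul_of_nonneg_right c1 (sq_nonneg ‖μ‖)
  have f2 := mul_le_mul_of_nonneg_right c2 (sq_nonneg ‖φ‖)
  have f3 := mul_le_mul_of_nonneg_right c3 (sq_nonneg r)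
  have f4 := mul_le_mul_of_nonneg_right c4 (sq_nonneg ‖w‖)
  have f5 := mul_le_mul_of_nonneg_right c5 (sq_nonneg q)
  have f6 := mul_le_mul_of_nonneg_right hL3 (sq_nonneg ‖φ‖)
  have f7 := mul_le_mul_of_nonneg_right hL4 (sq_nonneg r)
  have hs := d.m_symm μ φ
  rw [hs]
  linarith

/-- `(φ, μ, w, r, q)` solves the coupled problem with right-hand sides `ℓ`, `c₃`, `f`, `c₅`. -/
structure Solves (ℓ : V →L[ℝ] ℝ) (f : W →L[ℝ] ℝ) (c₃ c₅ : ℝ) (φ μ : V) (w : W) (r q : ℝ) :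
    Prop where
  eq_φ : ∀ χ, d.α * d.m φ χ + r * d.κ * d.A χ + d.M * d.g μ χ = ℓ χ
  eq_μ : ∀ ψ, d.m μ ψ = d.g φ ψ + d.γ * d.m φ ψ + r * d.κ * d.D ψ
  eq_r : d.α * r - d.κ / 2 * (d.α * d.D φ + d.A μ - d.Fo w) = c₃
  eq_w : ∀ z, d.a w z + d.e * q * d.Tr z - r * d.κ * d.Fo z = f z
  eq_q : d.τ * q - d.e * d.Tr w = c₅

/-- The right-hand side of the coupled problem as a functional on the coupled space. -/
def rhs (ℓ : V →L[ℝ] ℝ) (f : W →L[ℝ] ℝ) (c₃ c₅ : ℝ) : CoupledSpace V W →L[ℝ] ℝ :=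
  ℓ.comp (pμ V W) + (2 * c₃) • pr V W + f.comp (pw V W) + c₅ • pq V W

variable {d} {ℓ : V →L[ℝ] ℝ} {f : W →L[ℝ] ℝ} {c₃ c₅ : ℝ} {φ μ : V} {w : W} {r q : ℝ}

theorem solves_iff : d.Solves ℓ f c₃ c₅ φ μ w r q ↔
    ∀ y, d.form d.β (tuple φ μ w r q) y = rhs ℓ f c₃ c₅ y := by
  have hrhs : ∀ y : CoupledSpace V W, rhs ℓ f c₃ c₅ y
      = ℓ (pμ V W y) + 2 * c₃ * pr V W y + f (pw V W y) + c₅ * pq V W y := fun y => rfl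
  constructor
  · intro h y
    rw [form_apply, hrhs]
    simp only [pφ_tuple, pμ_tuple, pw_tuple, pr_tuple, pq_tuple]
    rw [h.eq_φ, h.eq_r, h.eq_w, h.eq_q, h.eq_μ]
    ring
  · intro h
    have hα := d.α_pos.ne'
    refine ⟨fun χ => ?_, fun ψ => ?_, ?_, fun z => ?_, ?_⟩
    -- this choice makes the test function of the equation for `μ` vanish
    · have := h (tuple ((d.β / d.α) • χ) χ 0 0 0)
      rw [form_apply, hrhs] at this
      have e : d.α • (d.β / d.α) • χ - d.β • χ = 0 := by
        rw [smul_smul, mul_div_cancel₀ _ hα, sub_self]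
      simpa [e] using this
    · have := h (tuple (d.α⁻¹ • ψ) 0 0 0 0)
      rw [form_apply, hrhs] at this
      have e : d.α • d.α⁻¹ • ψ - d.β • (0 : V) = ψ := by
        rw [smul_smul, mul_inv_cancel₀ hα, one_smul, smul_zero, sub_zero]
      simp only [pφ_tuple, pμ_tuple, pw_tuple, pr_tuple, pq_tuple, e, map_zero, mul_zero] at this
      linarith
    · have := h (tuple 0 0 0 1 0)
      rw [form_apply, hrhs] at this
      simp only [pφ_tuple, pμ_tuple, pw_tuple, pr_tuple, pq_tuple, smul_zero, sub_zero,
        map_zero, mul_zero] at this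
      linarith
    · have := h (tuple 0 0 z 0 0)
      rw [form_apply, hrhs] at this
      simpa using this
    · have := h (tuple 0 0 0 0 1)
      rw [form_apply, hrhs] at this
      simpa using this

variable [CompleteSpace V] [CompleteSpace W]

variable (d ℓ f c₃ c₅) in
theorem exists_solves : ∃ φ μ w r q, d.Solves ℓ f c₃ c₅ φ μ w r q := by
  set T := d.isCoercive_form.continuousLinearEquivOfBilin
  set x := T.symm ((InnerProductSpace.toDual ℝ (CoupledSpace V W)).symm (rhs ℓ f c₃ c₅))
  refine ⟨pφ V W x, pμ V W x, pw V W x, pr V W x, pq V W x, solves_iff.2 fun y => ?_⟩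
  have h : d.form d.β x y = rhs ℓ f c₃ c₅ y := by
    rw [← d.isCoercive_form.continuousLinearEquivOfBilin_apply]
    change inner ℝ (T x) y = _
    rw [T.apply_symm_apply, InnerProductSpace.toDual_symm_apply]
  exact h

theorem Solves.unique (h : d.Solves ℓ f c₃ c₅ φ μ w r q) {φ' μ' : V} {w' : W} {r' q' : ℝ}
    (h' : d.Solves ℓ f c₃ c₅ φ' μ' w' r' q') :
    φ = φ' ∧ μ = μ' ∧ w = w' ∧ r = r' ∧ q = q' := by
  have e : tuple φ μ w r q = tuple φ' μ' w' r' q' := by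
    refine d.isCoercive_form.continuousLinearEquivOfBilin.injective ?_
    refine ext_inner_right ℝ fun y => ?_
    rw [IsCoercive.continuousLinearEquivOfBilin_apply,
      IsCoercive.continuousLinearEquivOfBilin_apply, solves_iff.1 h, solves_iff.1 h']
  exact ⟨congrArg (pφ V W) e, congrArg (pμ V W) e, congrArg (pw V W) e, congrArg (pr V W) e,
    congrArg (pq V W) e⟩

end CoupledData

end Coupled

/-! ### The Hilbert spaces `H¹(Ω)` and `H¹₀(Ω)` -/

/-- `L²(Ω) × L²(Ω)²` with its Hilbert norm, where `H¹(Ω)` sits as the graph of the gradient. -/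
abbrev GraphSpace (Ω : Opens Plane) : Type := WithLp 2 (L2 Ω × PiLp 2 (fun _ : Fin 2 => L2 Ω))

/-- `H¹(Ω)` as the space of pairs `(v, ∇v)`. -/
def graphH1 (Ω : Opens Plane) : Submodule ℝ (GraphSpace Ω) where
  carrier := {x | ∀ i, IsWeakPD Ω i x.fst (x.snd i)}
  add_mem' := fun hx hy i => (hx i).add (hy i)
  zero_mem' := fun i => by rw [isWeakPD_iff]; simp
  smul_mem' := fun c _ hx i => (hx i).smul c

theorem isClosed_graphH1 : IsClosed (graphH1 Ω : Set (GraphSpace Ω)) := by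
  have h : (graphH1 Ω : Set (GraphSpace Ω)) = ⋂ i : Fin 2, ⋂ χ : TestFunction Ω ℝ ⊤,
      {x | inner ℝ x.fst (tf (dtf i χ)) = - inner ℝ (x.snd i) (tf χ)} := by
    ext x
    simp only [mem_iInter, mem_ofPred_eq, ← isWeakPD_iff]
    rfl
  rw [h]
  refine isClosed_iInter fun i => isClosed_iInter fun χ => isClosed_eq ?_ ?_ <;> fun_prop

/-- The Hilbert space `H¹(Ω)`. -/
def H1 (Ω : Opens Plane) : Type := graphH1 Ω

instance : NormedAddCommGroup (H1 Ω) := inferInstanceAs (NormedAddCommGroup (graphH1 Ω))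

instance : InnerProductSpace ℝ (H1 Ω) := inferInstanceAs (InnerProductSpace ℝ (graphH1 Ω))

instance : CompleteSpace (H1 Ω) := isClosed_graphH1.completeSpace_coe

/-- The inclusion of `H¹(Ω)` into `L²(Ω) × L²(Ω)²`. -/
def inclH1 : H1 Ω →L[ℝ] GraphSpace Ω := (graphH1 Ω).subtypeL

/-- The inclusion of `H¹(Ω)` into `L²(Ω)`. -/
def val : H1 Ω →L[ℝ] L2 Ω := (WithLp.fstL 2 ℝ _ _).comp inclH1

/-- The partial derivative `∂ᵢ` on `H¹(Ω)`. -/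
def grad (i : Fin 2) : H1 Ω →L[ℝ] L2 Ω :=
  (PiLp.proj 2 (fun _ : Fin 2 => L2 Ω) i).comp ((WithLp.sndL 2 ℝ _ _).comp inclH1)

theorem isWeakPD_val (x : H1 Ω) (i : Fin 2) : IsWeakPD Ω i (val x) (grad i x) := x.2 i

theorem memH1_val (x : H1 Ω) : MemH1 Ω (val x) := fun i => ⟨_, isWeakPD_val x i⟩

theorem pd_val (x : H1 Ω) (i : Fin 2) : pd Ω i (val x) = grad i x := (isWeakPD_val x i).pd_eq

/-- A function in `H¹(Ω)` as an element of the Hilbert space. -/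
def MemH1.toH1 {v : L2 Ω} (hv : MemH1 Ω v) : H1 Ω :=
  ⟨WithLp.toLp 2 (v, WithLp.toLp 2 fun i => pd Ω i v), fun i => hv.pd_spec i⟩

@[simp] theorem val_toH1 {v : L2 Ω} (hv : MemH1 Ω v) : val hv.toH1 = v := rfl

@[simp] theorem grad_toH1 {v : L2 Ω} (hv : MemH1 Ω v) (i : Fin 2) :
    grad i hv.toH1 = pd Ω i v := rfl

theorem val_injective : Function.Injective (val : H1 Ω → L2 Ω) := by
  intro x y h
  have hg : ∀ i, grad i x = grad i y := fun i => by rw [← pd_val, ← pd_val, h]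
  refine Subtype.ext (WithLp.ofLp_injective 2 (Prod.ext h ?_))
  exact PiLp.ext hg

theorem norm_sq_H1 (x : H1 Ω) : ‖x‖ ^ 2 = ‖val x‖ ^ 2 + ∑ i, ‖grad i x‖ ^ 2 := by
  have h : ‖x‖ = ‖inclH1 x‖ := rfl
  rw [h, WithLp.prod_norm_sq_eq_of_L2, PiLp.norm_sq_eq_of_L2]
  rfl

theorem tf_add (χ η : TestFunction Ω ℝ ⊤) : tf (χ + η) = tf χ + tf η := rfl

theorem tf_smul (c : ℝ) (χ : TestFunction Ω ℝ ⊤) : tf (c • χ) = c • tf χ := rfl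

variable (Ω) in
/-- The inclusion of the test functions into `H¹(Ω)`. -/
def tfH1 : TestFunction Ω ℝ ⊤ →ₗ[ℝ] H1 Ω where
  toFun χ := (memH1_tf χ).toH1
  map_add' χ η := val_injective (by simp [tf_add])
  map_smul' c χ := val_injective (by simp [tf_smul])

/-- `H¹₀(Ω)`, the closure of the test functions in `H¹(Ω)`. -/
def closureH10 (Ω : Opens Plane) : Submodule ℝ (H1 Ω) :=
  (LinearMap.range (tfH1 Ω)).topologicalClosure

/-- The Hilbert space `H¹₀(Ω)`. -/
def H10 (Ω : Opens Plane) : Type := closureH10 Ω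

instance : NormedAddCommGroup (H10 Ω) := inferInstanceAs (NormedAddCommGroup (closureH10 Ω))

instance : InnerProductSpace ℝ (H10 Ω) := inferInstanceAs (InnerProductSpace ℝ (closureH10 Ω))

instance : CompleteSpace (H10 Ω) :=
  (Submodule.isClosed_topologicalClosure _).completeSpace_coe

theorem mem_closureH10_iff {x : H1 Ω} : x ∈ closureH10 Ω ↔ MemH10 Ω (val x) := by
  have hval : ∀ χ, val (tfH1 Ω χ) = tf χ := fun χ => rfl
  have hgrad : ∀ χ i, grad i (tfH1 Ω χ) = tf (dtf i χ) := fun χ i => pd_tf i χ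
  have hcl : x ∈ closureH10 Ω ↔ x ∈ closure (Set.range (tfH1 Ω)) := Iff.rfl
  rw [hcl, Metric.mem_closure_iff, memH10_iff]
  simp only [Set.exists_range_iff, dist_eq_norm]
  constructor
  · refine fun h => ⟨memH1_val x, fun ε hε => ?_⟩
    obtain ⟨χ, hχ⟩ := h ε hε
    have h1 := norm_sq_H1 (x - tfH1 Ω χ)
    simp only [map_sub, hval, hgrad] at h1
    have h2 : ∀ i, 0 ≤ ‖grad i x - tf (dtf i χ)‖ ^ 2 := fun i => sq_nonneg _
    have h3 : ‖x - tfH1 Ω χ‖ ^ 2 < ε ^ 2 := pow_lt_pow_left₀ hχ (norm_nonneg _) two_ne_zero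
    refine ⟨χ, lt_of_pow_lt_pow_left₀ 2 hε.le ?_, fun i => lt_of_pow_lt_pow_left₀ 2 hε.le ?_⟩
    · have := Finset.sum_nonneg fun i (_ : i ∈ Finset.univ) => h2 i
      linarith
    · rw [pd_val]
      have := Finset.single_le_sum (fun i _ => h2 i) (Finset.mem_univ i)
      have := sq_nonneg ‖val x - tf χ‖
      linarith
  · rintro ⟨-, h⟩ ε hε
    obtain ⟨χ, h1, h2⟩ := h (ε / 2) (by positivity)
    refine ⟨χ, lt_of_pow_lt_pow_left₀ 2 hε.le ?_⟩
    rw [norm_sq_H1]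
    simp only [map_sub, hval, hgrad, Fin.sum_univ_two]
    have e0 := pow_lt_pow_left₀ h1 (norm_nonneg _) two_ne_zero
    have e1 := pow_lt_pow_left₀ (h2 0) (norm_nonneg _) two_ne_zero
    have e2 := pow_lt_pow_left₀ (h2 1) (norm_nonneg _) two_ne_zero
    rw [pd_val] at e1 e2
    nlinarith

/-- `H¹₀(Ω)²`. -/
abbrev H10Vec (Ω : Opens Plane) : Type := PiLp 2 (fun _ : Fin 2 => H10 Ω)

/-- The inclusion of `H¹₀(Ω)` into `H¹(Ω)`. -/
def inclH10 : H10 Ω →L[ℝ] H1 Ω := (closureH10 Ω).subtypeL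

/-- The `j`-th component of a field in `H¹₀(Ω)²`, as an element of `H¹(Ω)`. -/
def comp (j : Fin 2) : H10Vec Ω →L[ℝ] H1 Ω :=
  inclH10.comp (PiLp.proj 2 (fun _ : Fin 2 => H10 Ω) j)

/-- The field of the values of an element of `H¹₀(Ω)²`. -/
def valVec (w : H10Vec Ω) : L2Vec Ω := fun j => val (comp j w)

theorem memH10_valVec (w : H10Vec Ω) (j : Fin 2) : MemH10 Ω (valVec w j) :=
  mem_closureH10_iff.1 (w j).2

/-- A field with components in `H¹₀(Ω)` as an element of the Hilbert space. -/
def toH10Vec {w : L2Vec Ω} (hw : ∀ j, MemH10 Ω (w j)) : H10Vec Ω :=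
  WithLp.toLp 2 fun j => ⟨(hw j).memH1.toH1, mem_closureH10_iff.2 (hw j)⟩

@[simp] theorem valVec_toH10Vec {w : L2Vec Ω} (hw : ∀ j, MemH10 Ω (w j)) :
    valVec (toH10Vec hw) = w := rfl

theorem norm_sq_H10Vec (w : H10Vec Ω) : ‖w‖ ^ 2 = ∑ j, ‖comp j w‖ ^ 2 := by
  rw [PiLp.norm_sq_eq_of_L2]; rfl

/-- The `L²` inner product on `H¹(Ω)`. -/
def massForm (Ω : Opens Plane) : H1 Ω →L[ℝ] H1 Ω →L[ℝ] ℝ := (innerSL ℝ).bilinearComp val val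

/-- The form `(∇v, ∇w)` on `H¹(Ω)`. -/
def gradForm (Ω : Opens Plane) : H1 Ω →L[ℝ] H1 Ω →L[ℝ] ℝ :=
  ∑ i, (innerSL ℝ).bilinearComp (grad i) (grad i)

theorem massForm_apply (x y : H1 Ω) : massForm Ω x y = inner ℝ (val x) (val y) := rfl

theorem gradForm_apply (x y : H1 Ω) : gradForm Ω x y = gradInner Ω (val x) (val y) := by
  simp only [gradForm, gradInner, pd_val, Fin.sum_univ_two]
  rfl

theorem gradForm_self (x : H1 Ω) : gradForm Ω x x = ∑ i, ‖grad i x‖ ^ 2 := by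
  rw [gradForm_apply, gradInner_self]
  simp only [gradNormSq, pd_val]

/-- The elliptic form `α (v, w) + ν (∇v, ∇w)` on `H¹₀(Ω)²`. -/
def ellipticForm (Ω : Opens Plane) (α ν : ℝ) : H10Vec Ω →L[ℝ] H10Vec Ω →L[ℝ] ℝ :=
  ∑ j, (α • massForm Ω + ν • gradForm Ω).bilinearComp (comp j) (comp j)

theorem ellipticForm_apply (α ν : ℝ) (w z : H10Vec Ω) :
    ellipticForm Ω α ν w z = α * vecInner Ω (valVec w) (valVec z)
      + ν * ∑ j, gradInner Ω (valVec w j) (valVec z j) := by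
  have h : ∀ j, (α • massForm Ω + ν • gradForm Ω) (comp j w) (comp j z)
      = α * inner ℝ (valVec w j) (valVec z j) + ν * gradInner Ω (valVec w j) (valVec z j) := by
    intro j
    simp only [add_apply, smul_apply, smul_eq_mul, massForm_apply, gradForm_apply]
    rfl
  simp only [ellipticForm, Fin.sum_univ_two, add_apply, vecInner]
  rw [ContinuousLinearMap.bilinearComp_apply, ContinuousLinearMap.bilinearComp_apply, h, h]
  ring

theorem ellipticForm_coercive (α ν : ℝ) (w : H10Vec Ω) :
    min α ν * ‖w‖ ^ 2 ≤ ellipticForm Ω α ν w w := by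
  rw [norm_sq_H10Vec, Finset.mul_sum]
  simp only [ellipticForm, Fin.sum_univ_two]
  have h : ∀ j, min α ν * ‖comp j w‖ ^ 2
      ≤ (α • massForm Ω + ν • gradForm Ω) (comp j w) (comp j w) := by
    intro j
    simp only [add_apply, smul_apply, smul_eq_mul, massForm_apply, gradForm_self,
      real_inner_self_eq_norm_sq, norm_sq_H1]
    rw [mul_add]
    have : 0 ≤ ∑ i, ‖grad i (comp j w)‖ ^ 2 := Finset.sum_nonneg fun i _ => sq_nonneg _
    gcongr
    · exact min_le_left _ _
    · exact min_le_right _ _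
  exact add_le_add (h 0) (h 1)

/-! ### The explicit terms as continuous functionals -/

instance fact_one_le_four : Fact ((1 : ℝ≥0∞) ≤ 4) := ⟨by norm_num⟩

instance holderTriple_four_four_two : ENNReal.HolderTriple 4 4 2 :=
  ⟨(ENNReal.toReal_eq_toReal_iff' (by finiteness) (by finiteness)).1 (by
    rw [ENNReal.toReal_add (by finiteness) (by finiteness)]
    norm_num [ENNReal.toReal_inv])⟩

theorem isFiniteMeasure_restrict (hbdd : Bornology.IsBounded (Ω : Set Plane)) :
    IsFiniteMeasure (volume.restrict (Ω : Set Plane)) :=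
  ⟨by rw [Measure.restrict_apply_univ]; exact hbdd.measure_lt_top⟩

theorem exists_eLpNorm_six_le (hbdd : Bornology.IsBounded (Ω : Set Plane))
    (hcone : ConeCondition Ω) : ∃ C : ℝ≥0∞, C ≠ ⊤ ∧ ∀ x : H1 Ω,
    eLpNorm (val x) 6 (volume.restrict (Ω : Set Plane)) ≤ C * ‖x‖ₑ := by
  obtain ⟨C, hC, h⟩ := exists_sobolev hbdd hcone
  refine ⟨C ^ (1 / 6 : ℝ), ENNReal.rpow_ne_top_of_nonneg (by norm_num) hC, fun x => ?_⟩
  have h1 := h _ (memH1_val x)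
  have e : nsq (Ω : Set Plane) (val x) + gsq (val x) = ‖x‖ₑ ^ 2 := by
    have hp : 0 ≤ ∑ i, ‖grad i x‖ ^ 2 := Finset.sum_nonneg fun i _ => sq_nonneg _
    have hg : gradNormSq Ω (val x) = ∑ i, ‖grad i x‖ ^ 2 := by simp only [gradNormSq, pd_val]
    rw [nsq_eq, gsq_eq, hg, ← ENNReal.ofReal_add (by positivity) hp, ← norm_sq_H1,
      ENNReal.ofReal_pow (norm_nonneg _), ofReal_norm]
  rw [e] at h1
  rw [eLpNorm_eq_lintegral_rpow_enorm_toReal (by norm_num) (by norm_num)]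
  have e6 : (6 : ℝ≥0∞).toReal = (6 : ℕ) := by norm_num
  simp only [e6, ENNReal.rpow_natCast]
  calc (∫⁻ y in (Ω : Set Plane), ‖val x y‖ₑ ^ 6) ^ (1 / ((6 : ℕ) : ℝ))
      ≤ (C * (‖x‖ₑ ^ 2) ^ 3) ^ (1 / ((6 : ℕ) : ℝ)) := by gcongr
    _ = _ := by
      rw [ENNReal.mul_rpow_of_nonneg _ _ (by norm_num), ← pow_mul, ← ENNReal.rpow_natCast,
        ← ENNReal.rpow_mul]
      norm_num

/-- The embedding `H¹(Ω) ⊆ L⁴(Ω)`. -/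
theorem exists_embedding_L4 (hbdd : Bornology.IsBounded (Ω : Set Plane))
    (hcone : ConeCondition Ω) : ∃ E : H1 Ω →L[ℝ] Lp ℝ 4 (volume.restrict (Ω : Set Plane)),
    ∀ x, E x =ᵐ[volume.restrict (Ω : Set Plane)] val x := by
  have := isFiniteMeasure_restrict hbdd
  obtain ⟨C, hC, h⟩ := exists_eLpNorm_six_le hbdd hcone
  have hm : ∀ x : H1 Ω, AEStronglyMeasurable (val x) (volume.restrict (Ω : Set Plane)) :=
    fun x => (Lp.memLp (val x)).1
  set m := (volume.restrict (Ω : Set Plane)) univ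
    ^ (1 / (4 : ℝ≥0∞).toReal - 1 / (6 : ℝ≥0∞).toReal) with hmdef
  have hmt : m ≠ ⊤ := ENNReal.rpow_ne_top_of_nonneg (by norm_num) (measure_ne_top _ _)
  have h4 : ∀ x : H1 Ω, eLpNorm (val x) 4 (volume.restrict (Ω : Set Plane)) ≤ C * m * ‖x‖ₑ := by
    intro x
    refine (eLpNorm_le_eLpNorm_mul_rpow_measure_univ (q := 6) (by norm_num) (hm x)).trans ?_
    calc _ ≤ C * ‖x‖ₑ * m := mul_le_mul' (h x) le_rfl
      _ = _ := by ring
  have hmem : ∀ x : H1 Ω, MemLp (val x) 4 (volume.restrict (Ω : Set Plane)) := fun x =>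
    ⟨hm x, (h4 x).trans_lt (ENNReal.mul_lt_top (ENNReal.mul_lt_top hC.lt_top hmt.lt_top)
      enorm_lt_top)⟩
  let E₀ : H1 Ω →ₗ[ℝ] Lp ℝ 4 (volume.restrict (Ω : Set Plane)) :=
    { toFun := fun x => (hmem x).toLp _
      map_add' := fun x y => by
        rw [← MemLp.toLp_add]
        refine MemLp.toLp_congr _ _ ?_
        rw [map_add]
        exact Lp.coeFn_add _ _
      map_smul' := fun c x => by
        rw [RingHom.id_apply, ← MemLp.toLp_const_smul]
        refine MemLp.toLp_congr _ _ ?_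
        rw [map_smul]
        exact Lp.coeFn_smul _ _ }
  refine ⟨E₀.mkContinuous (C * m).toReal fun x => ?_, fun x => (hmem x).coeFn_toLp⟩
  change ‖(hmem x).toLp (val x)‖ ≤ _
  rw [Lp.norm_toLp, ← toReal_enorm x, ← ENNReal.toReal_mul]
  exact ENNReal.toReal_mono (ENNReal.mul_ne_top (by finiteness) enorm_ne_top) (h4 x)

/-- The trilinear form `∫ m g z` with `m, z ∈ H¹(Ω)` and `g ∈ L²(Ω)` is well defined, and continuous
in `z`. -/
theorem exists_functional_mul (hbdd : Bornology.IsBounded (Ω : Set Plane))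
    (hcone : ConeCondition Ω) {m : L2 Ω} (hm : MemH1 Ω m) (g : L2 Ω) :
    ∃ Λ : H1 Ω →L[ℝ] ℝ, ∀ z,
      Integrable (fun x => m x * g x * val z x) (volume.restrict (Ω : Set Plane)) ∧
      ∫ x in (Ω : Set Plane), m x * g x * val z x = Λ z := by
  obtain ⟨E, hE⟩ := exists_embedding_L4 hbdd hcone
  set T := (ContinuousLinearMap.mul ℝ ℝ).holderL (volume.restrict (Ω : Set Plane)) 4 4 2
  have hT : ∀ z, T (E hm.toH1) (E z) =ᵐ[volume.restrict (Ω : Set Plane)]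
      fun x => m x * val z x := by
    intro z
    have h0 : T (E hm.toH1) (E z) =ᵐ[volume.restrict (Ω : Set Plane)]
        fun x => ContinuousLinearMap.mul ℝ ℝ (E hm.toH1 x) (E z x) :=
      ContinuousLinearMap.coeFn_holder _ _ _
    filter_upwards [h0, hE hm.toH1, hE z] with x h1 h2 h3
    rw [h1, h2, h3]; rfl
  refine ⟨(innerSL ℝ g).comp ((T (E hm.toH1)).comp E), fun z => ?_⟩
  have hae : (fun x => m x * g x * val z x) =ᵐ[volume.restrict (Ω : Set Plane)]
      fun x => g x * T (E hm.toH1) (E z) x := by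
    filter_upwards [hT z] with x hx
    rw [hx]; ring
  refine ⟨Integrable.congr ?_ hae.symm, ?_⟩
  · exact (Lp.memLp g).integrable_mul (Lp.memLp (T (E hm.toH1) (E z)))
  · rw [integral_congr_ae hae, ← inner_eq_integral]; rfl

theorem exists_functional_advect (hbdd : Bornology.IsBounded (Ω : Set Plane))
    (hcone : ConeCondition Ω) {v : L2Vec Ω} (hv : ∀ i, MemH1 Ω (v i)) (f : L2 Ω) :
    ∃ Λ : H1 Ω →L[ℝ] ℝ, ∀ z, advect Ω v f (val z) = Λ z := by
  choose Λ hΛ using fun i => exists_functional_mul hbdd hcone (hv i) (pd Ω i f)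
  refine ⟨∑ i, Λ i, fun z => ?_⟩
  rw [sum_apply, advect]
  simp only [Finset.sum_mul]
  rw [integral_finsetSum _ fun i _ => (hΛ i z).1]
  exact Finset.sum_congr rfl fun i _ => (hΛ i z).2

theorem exists_functional_trilinear (hbdd : Bornology.IsBounded (Ω : Set Plane))
    (hcone : ConeCondition Ω) {v : L2Vec Ω} (hv : ∀ i, MemH1 Ω (v i)) (w : L2Vec Ω) :
    ∃ Λ : H10Vec Ω →L[ℝ] ℝ, ∀ z, trilinear Ω v w (valVec z) = Λ z := by
  choose Λ hΛ using fun j i => exists_functional_mul hbdd hcone (hv i) (pd Ω i (w j))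
  refine ⟨∑ j, ∑ i, (Λ j i).comp (comp j), fun z => ?_⟩
  simp only [trilinear, sum_apply, Finset.sum_mul, valVec]
  rw [integral_finsetSum _ fun j _ => integrable_finsetSum _ fun i _ => (hΛ j i (comp j z)).1]
  refine Finset.sum_congr rfl fun j _ => ?_
  rw [integral_finsetSum _ fun i _ => (hΛ j i (comp j z)).1]
  exact Finset.sum_congr rfl fun i _ => (hΛ j i (comp j z)).2

theorem exists_functional_forcing (hbdd : Bornology.IsBounded (Ω : Set Plane))
    (hcone : ConeCondition Ω) {m : L2 Ω} (hm : MemH1 Ω m) (f : L2 Ω) :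
    ∃ Λ : H10Vec Ω →L[ℝ] ℝ, ∀ z, forcing Ω m f (valVec z) = Λ z := by
  choose Λ hΛ using fun i => exists_functional_mul hbdd hcone hm (pd Ω i f)
  refine ⟨∑ i, (Λ i).comp (comp i), fun z => ?_⟩
  simp only [forcing, sum_apply, valVec]
  rw [integral_finsetSum _ fun i _ => (hΛ i (comp i z)).1]
  exact Finset.sum_congr rfl fun i _ => (hΛ i (comp i z)).2

theorem deriv_potF (P : Params) (s : ℝ) :
    deriv (potF P) s = P.ε⁻¹ ^ 2 * s ^ 3 - (P.ε⁻¹ ^ 2 + P.γ) * s := by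
  have h : HasDerivAt (potF P) (1 / (4 * P.ε ^ 2) * (2 * (1 - s ^ 2) ^ 1 * (-(2 * s)))
      - P.γ / 2 * (2 * s)) s := by
    have h1 : HasDerivAt (fun s : ℝ => s ^ 2) (2 * s) s := by
      simpa using hasDerivAt_pow 2 s
    have h2 : HasDerivAt (fun s : ℝ => (1 - s ^ 2) ^ 2) (2 * (1 - s ^ 2) ^ 1 * (-(2 * s))) s := by
      have := (h1.const_sub 1).fun_pow 2
      simpa using this
    exact (h2.const_mul _).sub (h1.const_mul _)
  rw [h.deriv, one_div, mul_inv, inv_pow]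
  ring

/-- `F'(φ) ∈ L²(Ω)` for `φ ∈ H¹(Ω)`, because `F'` is cubic and `φ ∈ L⁶(Ω)`. -/
theorem exists_dFInner_eq (hbdd : Bornology.IsBounded (Ω : Set Plane))
    (hcone : ConeCondition Ω) (P : Params) {φ : L2 Ω} (hφ : MemH1 Ω φ) :
    ∃ d : L2 Ω, ∀ z, dFInner Ω P φ z = inner ℝ d z := by
  obtain ⟨C, hC, h⟩ := exists_sobolev hbdd hcone
  have hm : AEStronglyMeasurable φ (volume.restrict (Ω : Set Plane)) := (Lp.memLp φ).1
  have h6 : Integrable (fun x => (φ x ^ 3) ^ 2) (volume.restrict (Ω : Set Plane)) := by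
    refine ⟨(hm.pow 3).pow 2, ?_⟩
    rw [hasFiniteIntegral_iff_enorm]
    simp only [enorm_pow, ← pow_mul]
    norm_num
    refine (h φ hφ).trans_lt ?_
    rw [nsq_eq, gsq_eq]
    finiteness
  have h3 : MemLp (fun x => φ x ^ 3) 2 (volume.restrict (Ω : Set Plane)) :=
    (memLp_two_iff_integrable_sq (hm.pow 3)).2 h6
  have hd : MemLp (fun x => deriv (potF P) (φ x)) 2 (volume.restrict (Ω : Set Plane)) := by
    simp only [deriv_potF]
    exact (h3.const_mul _).sub ((Lp.memLp φ).const_mul _)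
  refine ⟨hd.toLp _, fun z => ?_⟩
  rw [inner_eq_integral, dFInner]
  refine integral_congr_ae ?_
  filter_upwards [hd.coeFn_toLp] with x hx
  rw [hx]

/-! ### The Helmholtz projection -/

theorem norm_constL2_sq (hbdd : Bornology.IsBounded (Ω : Set Plane)) (c : ℝ) :
    ‖constL2 hbdd c‖ ^ 2 = c ^ 2 * volume.real (Ω : Set Plane) := by
  rw [← real_inner_self_eq_norm_sq, inner_constL2, integral_congr_ae (coeFn_constL2 hbdd c)]
  simp
  ring

/-- The Neumann problem `(∇ψ, ∇χ) = (f, ∇χ)`, with a prescribed integral of the solution. The form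
`(∇ψ, ∇χ) + ∫ψ ∫χ` is coercive by Poincaré's inequality, and testing with `χ = 1` gives `∫ψ`. -/
theorem exists_neumann (hconn : IsConnected (Ω : Set Plane))
    (hbdd : Bornology.IsBounded (Ω : Set Plane)) (hcone : ConeCondition Ω) (f : L2Vec Ω) (c : ℝ) :
    ∃ ψ : L2 Ω, MemH1 Ω ψ ∧ ∫ x in (Ω : Set Plane), ψ x = c ∧
      ∀ χ, MemH1 Ω χ → gradInner Ω ψ χ = ∑ i, inner ℝ (f i) (pd Ω i χ) := by
  obtain ⟨C, hC, hP⟩ := exists_poincare hconn hbdd hcone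
  set vol := volume.real (Ω : Set Plane) with hvol
  have hvol0 : 0 < vol := ENNReal.toReal_pos
    (Ω.isOpen.measure_pos volume hconn.nonempty).ne' (volume_ne_top hbdd)
  let I : H1 Ω →L[ℝ] ℝ := (innerSL ℝ (constL2 hbdd 1)).comp val
  have hI : ∀ x : H1 Ω, I x = ∫ y in (Ω : Set Plane), val x y := fun x => by
    change inner ℝ (constL2 hbdd 1) (val x) = _
    rw [real_inner_comm, inner_constL2, one_mul]
  let B : H1 Ω →L[ℝ] H1 Ω →L[ℝ] ℝ := gradForm Ω + I.smulRight I
  have hB : ∀ x y, B x y = gradForm Ω x y + I x * I y := fun x y => rfl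
  set K := 2 * C + 1 + 2 / vol with hK
  have hK0 : 0 < K := by positivity
  have hcoer : IsCoercive B := by
    refine ⟨K⁻¹, inv_pos.2 hK0, fun x => ?_⟩
    rw [mul_assoc, inv_mul_le_iff₀ hK0, ← sq, hB, gradForm_apply, gradInner_self]
    set v := val x
    set G := gradNormSq Ω v with hG
    have hG0 : 0 ≤ G := Finset.sum_nonneg fun i _ => sq_nonneg _
    set s := vol⁻¹ * I x with hs
    have hv1 : MemH1 Ω v := memH1_val x
    have hu1 : MemH1 Ω (v - constL2 hbdd s) := hv1.sub (memH1_constL2 hbdd s)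
    have hgu : gradNormSq Ω (v - constL2 hbdd s) = G := by
      have hpd : ∀ i, pd Ω i (v - constL2 hbdd s) = pd Ω i v := fun i => by
        rw [pd_sub hv1 (memH1_constL2 hbdd s), pd_constL2, sub_zero]
      simp only [hG, gradNormSq, hpd]
    have hmean : ∫ y in (Ω : Set Plane), (v - constL2 hbdd s) y = 0 := by
      have h1 := inner_constL2 hbdd (v - constL2 hbdd s) 1
      rw [one_mul] at h1
      rw [← h1, inner_sub_left, inner_constL2, inner_constL2,
        integral_congr_ae (coeFn_constL2 hbdd s), ← hI x]
      simp only [integral_const, measureReal_restrict_apply_univ, smul_eq_mul, one_mul]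
      rw [hs, ← hvol]
      field_simp
      ring
    have h1 := hP _ hu1 hmean
    rw [hgu] at h1
    have h2 : ‖v‖ ^ 2 ≤ 2 * ‖v - constL2 hbdd s‖ ^ 2 + 2 * ‖constL2 hbdd s‖ ^ 2 := by
      have e : ‖v‖ ≤ ‖v - constL2 hbdd s‖ + ‖constL2 hbdd s‖ := by
        simpa using norm_add_le (v - constL2 hbdd s) (constL2 hbdd s)
      nlinarith [norm_nonneg v, sq_nonneg (‖v - constL2 hbdd s‖ - ‖constL2 hbdd s‖)]
    have h3 : ‖constL2 hbdd s‖ ^ 2 = 1 / vol * (I x * I x) := by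
      rw [norm_constL2_sq, hs, ← hvol]; field_simp
    have h4 : ‖x‖ ^ 2 = ‖v‖ ^ 2 + G := by
      rw [norm_sq_H1]
      simp only [hG, gradNormSq, v, pd_val]
    have h5 : 0 ≤ I x * I x := mul_self_nonneg _
    have h6 : 0 ≤ 2 / vol * G := by positivity
    have h7 : 0 ≤ (2 * C + 1) * (I x * I x) := by positivity
    have h8 : 1 / vol = 2 / vol / 2 := by ring
    rw [h4, hK]
    nlinarith
  let R : H1 Ω →L[ℝ] ℝ := ∑ i, (innerSL ℝ (f i)).comp (grad i) + c • I
  have hR : ∀ χ, R χ = ∑ i, inner ℝ (f i) (grad i χ) + c * I χ := fun χ => by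
    simp only [R, add_apply, sum_apply]; rfl
  set T := hcoer.continuousLinearEquivOfBilin
  set x := T.symm ((InnerProductSpace.toDual ℝ (H1 Ω)).symm R) with hx
  have hsol : ∀ χ, B x χ = R χ := fun χ => by
    rw [← hcoer.continuousLinearEquivOfBilin_apply]
    change inner ℝ (T x) χ = _
    rw [hx, T.apply_symm_apply, InnerProductSpace.toDual_symm_apply]
  have hmean : I x = c := by
    have h1 := hsol (memH1_constL2 hbdd 1).toH1
    rw [hB, hR, gradForm_apply, hI (memH1_constL2 hbdd 1).toH1, val_toH1,
      integral_congr_ae (coeFn_constL2 hbdd 1)] at h1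
    simp only [gradInner, grad_toH1, pd_constL2, inner_zero_right, Finset.sum_const_zero, zero_add,
      integral_const, measureReal_restrict_apply_univ, smul_eq_mul, mul_one] at h1
    exact mul_right_cancel₀ hvol0.ne' h1
  refine ⟨val x, memH1_val x, (hI x).symm.trans hmean, fun χ hχ => ?_⟩
  have h1 := hsol hχ.toH1
  rw [hB, hR, hmean, gradForm_apply] at h1
  simpa using h1

/-! ### Unique solvability of one step -/

/-- The coupled equations of one step, without the projection. -/
structure CoupledEqs (P : Params) (dt t : ℝ) (a b c : Level Ω) : Prop where
  eq_φ : ∀ χ : L2 Ω, MemH1 Ω χ →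
    inner ℝ ((2 * dt)⁻¹ • ((3 : ℝ) • c.φ - (4 : ℝ) • b.φ + a.φ)) χ
      + c.r / √(E1 Ω P ((2 : ℝ) • b.φ - a.φ) + P.δ)
          * advect Ω ((2 : ℝ) • b.u - a.u) ((2 : ℝ) • b.φ - a.φ) χ
      = - P.M * gradInner Ω c.μ χ
  eq_μ : ∀ χ : L2 Ω, MemH1 Ω χ →
    inner ℝ c.μ χ = gradInner Ω c.φ χ + P.γ * inner ℝ c.φ χ
      + c.r / √(E1 Ω P ((2 : ℝ) • b.φ - a.φ) + P.δ) * dFInner Ω P ((2 : ℝ) • b.φ - a.φ) χ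
  eq_r : (3 * c.r - 4 * b.r + a.r) / (2 * dt)
      = 1 / (2 * √(E1 Ω P ((2 : ℝ) • b.φ - a.φ) + P.δ))
        * (dFInner Ω P ((2 : ℝ) • b.φ - a.φ)
              ((2 * dt)⁻¹ • ((3 : ℝ) • c.φ - (4 : ℝ) • b.φ + a.φ))
            + advect Ω ((2 : ℝ) • b.u - a.u) ((2 : ℝ) • b.φ - a.φ) c.μ
            - forcing Ω ((2 : ℝ) • b.μ - a.μ) ((2 : ℝ) • b.φ - a.φ) c.ut)
  eq_ut : ∀ w : L2Vec Ω, (∀ i, MemH10 Ω (w i)) →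
    vecInner Ω ((2 * dt)⁻¹ • ((3 : ℝ) • c.ut - (4 : ℝ) • b.u + a.u)) w
      + Real.exp (t / P.T) * c.q
          * trilinear Ω ((2 : ℝ) • b.u - a.u) ((2 : ℝ) • b.u - a.u) w
      + P.ν * ∑ j, gradInner Ω (c.ut j) (w j)
      - inner ℝ b.p (divg Ω w)
      = c.r / √(E1 Ω P ((2 : ℝ) • b.φ - a.φ) + P.δ)
          * forcing Ω ((2 : ℝ) • b.μ - a.μ) ((2 : ℝ) • b.φ - a.φ) w
  eq_q : (3 * c.q - 4 * b.q + a.q) / (2 * dt)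
      = - (1 / P.T) * c.q
        + Real.exp (t / P.T) * trilinear Ω ((2 : ℝ) • b.u - a.u) ((2 : ℝ) • b.u - a.u) c.ut

theorem Step.coupledEqs {P : Params} {dt t : ℝ} {a b c : Level Ω} (h : Step Ω P dt t a b c) :
    CoupledEqs P dt t a b c := ⟨h.eq_φ, h.eq_μ, h.eq_r, h.eq_ut, h.eq_q⟩

/-- The coupled equations of one step are an instance of the abstract coupled problem. -/
theorem exists_coupledData (hbdd : Bornology.IsBounded (Ω : Set Plane)) (hcone : ConeCondition Ω)
    {P : Params} (hT : 0 < P.T) (hM : 0 < P.M) (hν : 0 < P.ν) (hγ : 0 < P.γ) {dt : ℝ}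
    (hdt : 0 < dt) (t : ℝ) {a b : Level Ω} (hadm : Admissible Ω P a b) :
    ∃ (d : CoupledData (H1 Ω) (H10Vec Ω)) (ℓ : H1 Ω →L[ℝ] ℝ) (f : H10Vec Ω →L[ℝ] ℝ) (c₃ c₅ : ℝ),
      ∀ (c : Level Ω) (φ μ : H1 Ω) (w : H10Vec Ω), c.φ = val φ → c.μ = val μ → c.ut = valVec w →
        (CoupledEqs P dt t a b c ↔ d.Solves ℓ f c₃ c₅ φ μ w c.r c.q) := by
  have hφ' : MemH1 Ω ((2 : ℝ) • b.φ - a.φ) := (hadm.φ_new.smul 2).sub hadm.φ_old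
  have hμ' : MemH1 Ω ((2 : ℝ) • b.μ - a.μ) := (hadm.μ_new.smul 2).sub hadm.μ_old
  have hu' : ∀ i, MemH1 Ω (((2 : ℝ) • b.u - a.u) i) := fun i =>
    ((hadm.u_new i).smul 2).sub (hadm.u_old i)
  obtain ⟨A, hA⟩ := exists_functional_advect hbdd hcone hu' ((2 : ℝ) • b.φ - a.φ)
  obtain ⟨D, hD⟩ := exists_dFInner_eq hbdd hcone P hφ'
  obtain ⟨Fo, hFo⟩ := exists_functional_forcing hbdd hcone hμ' ((2 : ℝ) • b.φ - a.φ)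
  obtain ⟨Tr, hTr⟩ := exists_functional_trilinear hbdd hcone hu' ((2 : ℝ) • b.u - a.u)
  set k := √(E1 Ω P ((2 : ℝ) • b.φ - a.φ) + P.δ) with hk
  set α := 3 * (2 * dt)⁻¹ with hα
  have hα0 : 0 < α := by positivity
  set ξ : L2 Ω := (2 * dt)⁻¹ • ((4 : ℝ) • b.φ - a.φ) with hξ
  set η : L2Vec Ω := (2 * dt)⁻¹ • ((4 : ℝ) • b.u - a.u) with hη
  let d : CoupledData (H1 Ω) (H10Vec Ω) :=
    { m := massForm Ω
      g := gradForm Ω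
      a := ellipticForm Ω α P.ν
      A := A
      D := (innerSL ℝ D).comp val
      Fo := Fo
      Tr := Tr
      α := α
      γ := P.γ
      M := P.M
      τ := α + 1 / P.T
      κ := k⁻¹
      e := Real.exp (t / P.T)
      c := min α P.ν
      m_symm := fun v w => by rw [massForm_apply, massForm_apply, real_inner_comm]
      m_nonneg := fun v => by rw [massForm_apply]; exact real_inner_self_nonneg
      g_nonneg := fun v => by
        rw [gradForm_self]; exact Finset.sum_nonneg fun i _ => sq_nonneg _
      norm_sq_le := fun v => by
        rw [gradForm_self, massForm_apply, real_inner_self_eq_norm_sq, norm_sq_H1]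
      a_coercive := ellipticForm_coercive α P.ν
      α_pos := hα0
      γ_pos := hγ
      M_pos := hM
      τ_pos := by positivity
      c_pos := lt_min hα0 hν }
  let f : H10Vec Ω →L[ℝ] ℝ := ∑ j, ((innerSL ℝ (η j)).comp (val.comp (comp j))
    + (innerSL ℝ b.p).comp ((grad j).comp (comp j)))
  have hf : ∀ z, f z = vecInner Ω η (valVec z) + inner ℝ b.p (divg Ω (valVec z)) := by
    intro z
    have h1 : ∀ j, pd Ω j (valVec z j) = grad j (comp j z) := fun j => pd_val _ _
    simp only [divg, h1, inner_sum, vecInner, ← Finset.sum_add_distrib]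
    simp only [f, sum_apply]
    rfl
  refine ⟨d, (innerSL ℝ ξ).comp val, f, (4 * b.r - a.r) / (2 * dt) - k⁻¹ / 2 * inner ℝ D ξ,
    (4 * b.q - a.q) / (2 * dt), fun c φ μ w hcφ hcμ hcw => ?_⟩
  have e₁ : (2 * dt)⁻¹ • ((3 : ℝ) • c.φ - (4 : ℝ) • b.φ + a.φ) = α • val φ - ξ := by
    rw [hξ, hα, hcφ]; module
  have e₂ : (2 * dt)⁻¹ • ((3 : ℝ) • c.ut - (4 : ℝ) • b.u + a.u) = α • valVec w - η := by
    rw [hη, hα, hcw]; module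
  have e₃ : ∀ z, vecInner Ω (α • valVec w - η) z
      = α * vecInner Ω (valVec w) z - vecInner Ω η z := by
    intro z
    simp only [vecInner, Finset.mul_sum, ← Finset.sum_sub_distrib]
    refine Finset.sum_congr rfl fun i _ => ?_
    rw [Pi.sub_apply, Pi.smul_apply, inner_sub_left, real_inner_smul_left]
  constructor
  · intro h
    refine ⟨fun χ => ?_, fun ψ => ?_, ?_, fun z => ?_, ?_⟩
    · have := h.eq_φ (val χ) (memH1_val χ)
      rw [e₁, hA, inner_sub_left, real_inner_smul_left, hcμ, ← gradForm_apply] at this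
      change α * inner ℝ (val φ) (val χ) + c.r * k⁻¹ * A χ + P.M * gradForm Ω μ χ
        = inner ℝ ξ (val χ)
      rw [div_eq_mul_inv] at this
      linarith
    · have := h.eq_μ (val ψ) (memH1_val ψ)
      rw [hD, hcμ, hcφ, ← gradForm_apply, div_eq_mul_inv] at this
      exact this
    · have := h.eq_r
      rw [e₁, hD, hcμ, hA, hcw, hFo, inner_sub_right, real_inner_smul_right] at this
      change α * c.r - k⁻¹ / 2 * (α * inner ℝ D (val φ) + A μ - Fo w) = _
      rw [one_div, mul_inv, div_eq_mul_inv] at this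
      rw [hα, div_eq_mul_inv]
      rw [hα] at this
      linear_combination this
    · have := h.eq_ut (valVec z) (memH10_valVec z)
      rw [e₂, e₃, hTr, hFo, hcw, div_eq_mul_inv c.r] at this
      change ellipticForm Ω α P.ν w z + Real.exp (t / P.T) * c.q * Tr z - c.r * k⁻¹ * Fo z = f z
      rw [ellipticForm_apply, hf]
      linarith
    · have := h.eq_q
      rw [hcw, hTr, div_eq_mul_inv] at this
      change (α + 1 / P.T) * c.q - Real.exp (t / P.T) * Tr w = _
      rw [hα, div_eq_mul_inv (4 * b.q - a.q)]
      linear_combination this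
  · intro h
    refine ⟨fun χ hχ => ?_, fun ψ hψ => ?_, ?_, fun z hz => ?_, ?_⟩
    · have := h.eq_φ hχ.toH1
      change α * inner ℝ (val φ) χ + c.r * k⁻¹ * A hχ.toH1 + P.M * gradForm Ω μ hχ.toH1
        = inner ℝ ξ χ at this
      rw [gradForm_apply, ← hA, val_toH1] at this
      rw [e₁, inner_sub_left, real_inner_smul_left, hcμ, div_eq_mul_inv]
      linarith
    · have := h.eq_μ hψ.toH1
      change inner ℝ (val μ) ψ = gradForm Ω φ hψ.toH1 + P.γ * inner ℝ (val φ) ψ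
        + c.r * k⁻¹ * inner ℝ D ψ at this
      rw [gradForm_apply, val_toH1] at this
      rw [hD, hcμ, hcφ, div_eq_mul_inv]
      exact this
    · have := h.eq_r
      change α * c.r - k⁻¹ / 2 * (α * inner ℝ D (val φ) + A μ - Fo w) = _ at this
      rw [e₁, hD, hcμ, hA, hcw, hFo, inner_sub_right, real_inner_smul_right]
      rw [one_div, mul_inv, div_eq_mul_inv]
      rw [hα, div_eq_mul_inv] at this
      rw [hα]
      linear_combination this
    · have := h.eq_w (toH10Vec hz)
      change ellipticForm Ω α P.ν w (toH10Vec hz) + Real.exp (t / P.T) * c.q * Tr (toH10Vec hz)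
        - c.r * k⁻¹ * Fo (toH10Vec hz) = f (toH10Vec hz) at this
      rw [ellipticForm_apply, hf, ← hTr, ← hFo, valVec_toH10Vec] at this
      rw [e₂, e₃, hcw, div_eq_mul_inv c.r]
      linarith
    · have := h.eq_q
      change (α + 1 / P.T) * c.q - Real.exp (t / P.T) * Tr w = _ at this
      rw [hcw, hTr, div_eq_mul_inv]
      rw [hα, div_eq_mul_inv (4 * b.q - a.q)] at this
      linear_combination this

theorem integral_add_L2 (hbdd : Bornology.IsBounded (Ω : Set Plane)) (v w : L2 Ω) :
    ∫ x in (Ω : Set Plane), (v + w) x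
      = (∫ x in (Ω : Set Plane), v x) + ∫ x in (Ω : Set Plane), w x := by
  have h : ∀ u : L2 Ω, ∫ x in (Ω : Set Plane), u x = inner ℝ u (constL2 hbdd 1) := fun u => by
    rw [inner_constL2, one_mul]
  rw [h, h, h, inner_add_left]

/-- Unique solvability of one step, for time steps of any size. -/
theorem existsUnique_step (hconn : IsConnected (Ω : Set Plane))
    (hbdd : Bornology.IsBounded (Ω : Set Plane)) (hcone : ConeCondition Ω)
    {P : Params} (hT : 0 < P.T) (hM : 0 < P.M) (hν : 0 < P.ν) (hγ : 0 < P.γ) {dt : ℝ}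
    (hdt : 0 < dt) (t : ℝ) {a b : Level Ω} (hadm : Admissible Ω P a b) :
    ∃! c : Level Ω, Step Ω P dt t a b c ∧ ∫ x in (Ω : Set Plane), c.p x = 0 := by
  obtain ⟨d, ℓ, f, c₃, c₅, hd⟩ := exists_coupledData hbdd hcone hT hM hν hγ hdt t hadm
  refine existsUnique_of_exists_of_unique ?_ ?_
  · obtain ⟨φ, μ, w, r, q, hsol⟩ := d.exists_solves ℓ f c₃ c₅
    set p₀ : L2 Ω := b.p + (-P.ν) • divg Ω (valVec w) with hp₀
    obtain ⟨ψ, hψ, hmean, hneu⟩ := exists_neumann hconn hbdd hcone ((3 / (2 * dt)) • valVec w)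
      (-∫ x in (Ω : Set Plane), p₀ x)
    let c : Level Ω :=
      { φ := val φ, μ := val μ, ut := valVec w,
        u := fun i => valVec w i - (2 * dt / 3) • pd Ω i ψ, p := ψ + p₀, r := r, q := q }
    have hc := (hd c φ μ w rfl rfl rfl).2 hsol
    have hcψ : c.p - b.p + P.ν • divg Ω c.ut = ψ := by
      change ψ + p₀ - b.p + P.ν • divg Ω (valVec w) = ψ
      rw [hp₀]; module
    refine ⟨c, ⟨memH1_val φ, memH1_val μ, memH10_valVec w, fun χ hχ => ?_, hc.eq_φ, hc.eq_μ,
      hc.eq_r, hc.eq_ut, by rwa [hcψ], fun i => ?_, hc.eq_q⟩, ?_⟩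
    · have h1 := hneu χ hχ
      have h2 : ∀ i, inner ℝ (c.u i) (pd Ω i χ) = inner ℝ (valVec w i) (pd Ω i χ)
          - 2 * dt / 3 * inner ℝ (pd Ω i ψ) (pd Ω i χ) := fun i => by
        rw [← real_inner_smul_left, ← inner_sub_left]
      have h3 : ∀ i, inner ℝ (((3 / (2 * dt)) • valVec w) i) (pd Ω i χ)
          = 3 / (2 * dt) * inner ℝ (valVec w i) (pd Ω i χ) := fun i => by
        rw [Pi.smul_apply, real_inner_smul_left]
      simp only [h3, ← Finset.mul_sum, gradInner] at h1
      simp only [h2, Finset.sum_sub_distrib, ← Finset.mul_sum, h1]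
      field_simp
      ring
    · rw [hcψ]
      change (2 * dt)⁻¹ • ((3 : ℝ) • (valVec w i - (2 * dt / 3) • pd Ω i ψ)
        - (3 : ℝ) • valVec w i) + pd Ω i ψ = 0
      have e : (2 * dt)⁻¹ * (3 * (2 * dt / 3)) = 1 := by field_simp
      have e' : (3 : ℝ) • (valVec w i - (2 * dt / 3) • pd Ω i ψ) - (3 : ℝ) • valVec w i
          = -((3 * (2 * dt / 3)) • pd Ω i ψ) := by module
      rw [e', smul_neg, smul_smul, e, one_smul, neg_add_cancel]
    · change ∫ x in (Ω : Set Plane), (ψ + p₀) x = 0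
      rw [integral_add_L2 hbdd, hmean, neg_add_cancel]
  · rintro c c' ⟨hc, hcp⟩ ⟨hc', hcp'⟩
    have s := (hd c hc.φ_mem.toH1 hc.μ_mem.toH1 (toH10Vec hc.ut_mem) rfl rfl rfl).1 hc.coupledEqs
    have s' := (hd c' hc'.φ_mem.toH1 hc'.μ_mem.toH1 (toH10Vec hc'.ut_mem) rfl rfl rfl).1
      hc'.coupledEqs
    obtain ⟨hφ, hμ, hw, hr, hq⟩ := s.unique s'
    have hφ : c.φ = c'.φ := congrArg val hφ
    have hμ : c.μ = c'.μ := congrArg val hμ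
    have hut : c.ut = c'.ut := congrArg valVec hw
    have hu := hc.u_eq hdt
    have hu' := hc'.u_eq hdt
    have hψ := hc.ψ_mem
    have hψ' := hc'.ψ_mem
    rw [← hut] at hu' hψ'
    have hθ : MemH1 Ω (c.p - c'.p) := by
      have h1 := hψ.sub hψ'
      rwa [show c.p - b.p + P.ν • divg Ω c.ut - (c'.p - b.p + P.ν • divg Ω c.ut) = c.p - c'.p by
        abel] at h1
    have hpd : ∀ i, pd Ω i (c.p - b.p + P.ν • divg Ω c.ut)
        = pd Ω i (c.p - c'.p) + pd Ω i (c'.p - b.p + P.ν • divg Ω c.ut) := fun i => by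
      rw [← pd_add hθ hψ']
      congr 1
      abel
    -- the difference of the two pressures is a function in `H¹` whose gradient lies in `H`
    have hgrad : gradNormSq Ω (c.p - c'.p) = 0 := by
      have h1 := hc.u_mem _ hθ
      have h2 := hc'.u_mem _ hθ
      have h3 : ∀ i, inner ℝ (c.u i) (pd Ω i (c.p - c'.p))
          = inner ℝ (c'.u i) (pd Ω i (c.p - c'.p)) - 2 * dt / 3 * ‖pd Ω i (c.p - c'.p)‖ ^ 2 := by
        intro i
        rw [hu i, hu' i, hpd i, smul_add, ← sub_sub, inner_sub_left, inner_sub_left,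
          inner_sub_left, real_inner_smul_left, real_inner_smul_left, real_inner_self_eq_norm_sq]
        ring
      simp only [h3, Finset.sum_sub_distrib, h2, ← Finset.mul_sum] at h1
      have h4 : 2 * dt / 3 ≠ 0 := by positivity
      have h5 : 2 * dt / 3 * gradNormSq Ω (c.p - c'.p) = 0 := by
        simp only [gradNormSq]; linarith
      exact (mul_eq_zero.1 h5).resolve_left h4
    have hp : c.p = c'.p := by
      obtain ⟨C, -, hP⟩ := exists_poincare hconn hbdd hcone
      have hmean : ∫ x in (Ω : Set Plane), (c.p - c'.p) x = 0 := by
        have h1 := integral_add_L2 hbdd (c.p - c'.p) c'.p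
        rw [sub_add_cancel, hcp, hcp', add_zero] at h1
        exact h1.symm
      have h1 := hP _ hθ hmean
      rw [hgrad, mul_zero] at h1
      have h2 : ‖c.p - c'.p‖ = 0 := by nlinarith [norm_nonneg (c.p - c'.p)]
      exact sub_eq_zero.1 (norm_eq_zero.1 h2)
    refine Level.ext hφ hμ hut (funext fun i => ?_) hp hr hq
    rw [hu i, hu' i, hp]

end CHNS

end

theorem theorem3p2 (Ω : TopologicalSpace.Opens CHNS.Plane)
    (hconn : IsConnected (Ω : Set CHNS.Plane)) (hbdd : Bornology.IsBounded (Ω : Set CHNS.Plane))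
    (hcone : CHNS.ConeCondition Ω) (P : CHNS.Params)
    (hT : 0 < P.T) (hM : 0 < P.M) (hν : 0 < P.ν) (hγ : 0 < P.γ) (hε : 0 < P.ε) :
    -- unconditional energy stability (the step from `L (n+1)` to `L (n+2)`)
    (∀ (N : ℕ) (L : ℕ → CHNS.Level Ω), CHNS.IsSolution Ω P N L → ∀ n, n + 2 ≤ N →
      CHNS.MemH1 Ω (CHNS.HSeq Ω P L (n + 1)) ∧ CHNS.MemH1 Ω (CHNS.HSeq Ω P L (n + 2)) ∧
      ∃ c : CHNS.L2 Ω, CHNS.IsWeakCurl Ω (L (n + 2)).u c ∧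
        CHNS.energy Ω P (P.T / N) (L (n + 1)) (L (n + 2))
            (CHNS.gSeq Ω P L (n + 2)) (CHNS.HSeq Ω P L (n + 2))
          - CHNS.energy Ω P (P.T / N) (L n) (L (n + 1))
            (CHNS.gSeq Ω P L (n + 1)) (CHNS.HSeq Ω P L (n + 1))
        ≤ - P.ν * (P.T / N) * CHNS.vecGradNormSq Ω (L (n + 2)).ut
          - P.ν * (P.T / N) * ‖c‖ ^ 2
          - 2 * (P.T / N) / P.T * |(L (n + 2)).q| ^ 2
          - 2 * P.M * (P.T / N) * CHNS.gradNormSq Ω (L (n + 2)).μ) ∧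
    -- unique solvability for small time steps (the pressure being normalized to zero mean)
    (∃ dt₀ : ℝ, 0 < dt₀ ∧ ∀ N : ℕ, 0 < N → P.T / N < dt₀ → ∀ n, n + 2 ≤ N →
      ∀ a b : CHNS.Level Ω, CHNS.Admissible Ω P a b →
        ∃! c : CHNS.Level Ω,
          CHNS.Step Ω P (P.T / N) (((n + 2 : ℕ) : ℝ) * (P.T / N)) a b c ∧
          ∫ x in (Ω : Set CHNS.Plane), c.p x = 0) := by
  refine ⟨fun N L hL n hn => ?_, 1, one_pos, fun N hN _ n _ a b hadm => ?_⟩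
  · have hN : 0 < N := by omega
    have hdt : 0 < P.T / N := by positivity
    have hstep := hL.step n hn
    have hH := hL.memH1_HSeq n (by omega)
    exact ⟨hH, hstep.memH1_H hH, CHNS.rot (L (n + 2)).ut,
      (CHNS.isWeakCurl_rot fun i => (hstep.ut_mem i).memH1).sub_smul_grad hstep.ψ_mem _
        (hstep.u_eq hdt),
      hstep.energy_estimate (hL.adm n hn) hdt hν hγ hH⟩
  -- the coupled problem is coercive for every positive time step, so any `dt₀` will do
  · exact CHNS.existsUnique_step hconn hbdd hcone hT hM hν hγ (by positivity) _ hadm
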